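/- Let $c \in \{2,3\}$. The problem Max-$c$-Permutation CSP Above Average is the following decision problem. Input: a set $V$ of $n$ variables, a collection of weighted constraints $\mathcal C=\{(f_1,S_1,w_1),\dots,(f_m,S_m,w_m)\}$, and an integer $k \ge 0$ (the parameter). Here each $S_i=(v_1,\dots,v_{c'})$ is an ordered tuple of $c' \le c$ distinct variables of $V$ (with $c'$ depending on $i$), each $f_i : \mathbb S_{c'} \to \{0,1\}$ is an arbitrary predicate on the permutations of $\{1,\dots,c'\}$, and each $w_i$ is a positive integer. A bijection $\phi : V \to \{1,\dots,n\}$ satisfies $(f_i,S_i,w_i)$ if $f_i(\pi)=1$, where $\pi\in\mathbb S_{c'}$ is the permutation with $\pi(a)<\pi(b) \iff \phi(v_a)<\phi(v_b)$ for all $a,b$. The weight of $\phi$ is the sum of the weights of the constraints that it satisfies. Question: is there a bijection $\phi : V \to \{1,\dots,n\}$ of weight at least $$\rho\, W + \frac{k}{c!\,4^c},$$ where $W=\sum_i w_i$ and $\rho$ is the expected value of (weight of $\phi$)$/W$ for a uniformly random bijection $\phi$ (if $W=0$, then $\rho W$ is read as $0$)? Theorem. For $c=2$ and for $c=3$, Max-$c$-Permutation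 CSP Above Average can be solved in time $2^{O(k)}$, up to a factor polynomial in the size of the input: there are constants $A,B,D$ and a single deterministic algorithm (a program for a random access machine with the logarithmic cost criterion) that decides every instance $I$ with parameter $k$ within time $A\cdot 2^{Bk}\cdot |I|^{D}$, where $|I|$ is the bit length of $I$, all numbers being written in binary. -/

import Mathlib

/-! ### Random access machines with the logarithmic cost criterion

A program works on finitely many arrays `0, 1, 2, …` of natural numbers (the array names are
constants of the program text, the indices are computed), so registers are the cells of index `0`.
Control flow is structured. Every operation is charged the bit lengths of all the numbers it
handles, addresses included, so that time is polynomially related to Turing machine time. -/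

namespace RAM

/-- Memory contents: `σ a i` is the content of cell `i` of array `a`. -/
abbrev Mem : Type := ℕ → ℕ → ℕ

/-- Arithmetic expressions. -/
inductive Expr : Type
  | const (n : ℕ)
  | read (a : ℕ) (i : Expr)
  | add (e₁ e₂ : Expr)
  | sub (e₁ e₂ : Expr)
  | mul (e₁ e₂ : Expr)
  | div (e₁ e₂ : Expr)

/-- The value of an expression (truncated subtraction, rounded division). -/
def Expr.eval (σ : Mem) : Expr → ℕ
  | .const n => n
  | .read a i => σ a (i.eval σ)
  | .add e₁ e₂ => e₁.eval σ + e₂.eval σ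
  | .sub e₁ e₂ => e₁.eval σ - e₂.eval σ
  | .mul e₁ e₂ => e₁.eval σ * e₂.eval σ
  | .div e₁ e₂ => e₁.eval σ / e₂.eval σ

/-- The logarithmic cost of evaluating an expression. -/
def Expr.cost (σ : Mem) : Expr → ℕ
  | .const n => n.size + 1
  | .read a i => i.cost σ + (i.eval σ).size + (σ a (i.eval σ)).size + 1
  | .add e₁ e₂ => e₁.cost σ + e₂.cost σ + (e₁.eval σ).size + (e₂.eval σ).size + 1
  | .sub e₁ e₂ => e₁.cost σ + e₂.cost σ + (e₁.eval σ).size + (e₂.eval σ).size + 1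
  | .mul e₁ e₂ => e₁.cost σ + e₂.cost σ + (e₁.eval σ).size + (e₂.eval σ).size + 1
  | .div e₁ e₂ => e₁.cost σ + e₂.cost σ + (e₁.eval σ).size + (e₂.eval σ).size + 1

/-- Programs: `write a i e` stores the value of `e` in cell `i` of array `a`;
`branch b p q` is "if `b ≠ 0` then `p` else `q`"; `loop b p` is "while `b ≠ 0` do `p`". -/
inductive Prog : Type
  | skip
  | write (a : ℕ) (i e : Expr)
  | seq (p q : Prog)
  | branch (b : Expr) (p q : Prog)
  | loop (b : Expr) (p : Prog)

/-- The memory after storing `v` in cell `i` of array `a`. -/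
def Mem.store (σ : Mem) (a i v : ℕ) : Mem :=
  fun a' i' => if a' = a ∧ i' = i then v else σ a' i'

/-- `Exec p σ t σ'`: started in `σ`, the program `p` halts in `σ'` after time exactly `t`. -/
inductive Exec : Prog → Mem → ℕ → Mem → Prop
  | skip (σ : Mem) : Exec .skip σ 1 σ
  | write (a : ℕ) (i e : Expr) (σ : Mem) :
      Exec (.write a i e) σ
        (i.cost σ + e.cost σ + (i.eval σ).size + (e.eval σ).size + 1)
        (σ.store a (i.eval σ) (e.eval σ))
  | seq {p q : Prog} {σ σ' σ'' : Mem} {t t' : ℕ} :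
      Exec p σ t σ' → Exec q σ' t' σ'' → Exec (.seq p q) σ (t + t' + 1) σ''
  | branch_true {b : Expr} {p q : Prog} {σ σ' : Mem} {t : ℕ} :
      b.eval σ ≠ 0 → Exec p σ t σ' → Exec (.branch b p q) σ (b.cost σ + t + 1) σ'
  | branch_false {b : Expr} {p q : Prog} {σ σ' : Mem} {t : ℕ} :
      b.eval σ = 0 → Exec q σ t σ' → Exec (.branch b p q) σ (b.cost σ + t + 1) σ'
  | loop_true {b : Expr} {p : Prog} {σ σ' σ'' : Mem} {t t' : ℕ} :
      b.eval σ ≠ 0 → Exec p σ t σ' → Exec (.loop b p) σ' t' σ'' →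
        Exec (.loop b p) σ (b.cost σ + t + t' + 1) σ''
  | loop_false {b : Expr} {p : Prog} {σ : Mem} :
      b.eval σ = 0 → Exec (.loop b p) σ (b.cost σ + 1) σ

/-- Programs are deterministic, in their result and in their running time. -/
theorem Exec.deterministic {p : Prog} {σ σ₁ : Mem} {t₁ : ℕ} (h₁ : Exec p σ t₁ σ₁) :
    ∀ {t₂ : ℕ} {σ₂ : Mem}, Exec p σ t₂ σ₂ → t₁ = t₂ ∧ σ₁ = σ₂ := by
  induction h₁ with
  | skip σ => intro _ _ h; cases h; exact ⟨rfl, rfl⟩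
  | write a i e σ => intro _ _ h; cases h; exact ⟨rfl, rfl⟩
  | seq _ _ ih ih' =>
    intro _ _ h
    cases h with
    | seq g g' =>
      obtain ⟨rfl, rfl⟩ := ih g
      obtain ⟨rfl, rfl⟩ := ih' g'
      exact ⟨rfl, rfl⟩
  | branch_true hb _ ih =>
    intro _ _ h
    cases h with
    | branch_true _ g => obtain ⟨rfl, rfl⟩ := ih g; exact ⟨rfl, rfl⟩
    | branch_false hb' _ => exact absurd hb' hb
  | branch_false hb _ ih =>
    intro _ _ h
    cases h with
    | branch_true hb' _ => exact absurd hb hb'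
    | branch_false _ g => obtain ⟨rfl, rfl⟩ := ih g; exact ⟨rfl, rfl⟩
  | loop_true hb _ _ ih ih' =>
    intro _ _ h
    cases h with
    | loop_true _ g g' =>
      obtain ⟨rfl, rfl⟩ := ih g
      obtain ⟨rfl, rfl⟩ := ih' g'
      exact ⟨rfl, rfl⟩
    | loop_false hb' => exact absurd hb' hb
  | loop_false hb =>
    intro _ _ h
    cases h with
    | loop_true hb' _ _ => exact absurd hb hb'
    | loop_false _ => exact ⟨rfl, rfl⟩

/-- The initial memory on input `l`: the input is in array `0`, everything else is `0`. -/
def initialMem (l : List ℕ) : Mem :=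
  fun a i => if a = 0 then l.getD i 0 else 0

/-- The bit length of an input (all numbers are in binary, one more for each separator). -/
def inputSize (l : List ℕ) : ℕ :=
  (l.map fun x => x.size + 1).sum

/-- One program decides, on every instance `x` (presented by its encoding `enc x`), whether `x`
belongs to `L`, and halts within time `T x`. The answer, `1` for yes and `0` for no, is left in
cell `0` of array `1`. -/
def DecidableWithin {α : Type} (enc : α → List ℕ) (L : Set α) (T : α → ℕ) : Prop :=
  ∃ p : Prog, ∀ x : α, ∃ (t : ℕ) (σ : Mem),
    Exec p (initialMem (enc x)) t σ ∧ t ≤ T x ∧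
      (x ∈ L → σ 1 0 = 1) ∧ (x ∉ L → σ 1 0 = 0)

end RAM

/-! ### Permutation constraint satisfaction above average -/

namespace PermCSP

/-- A weighted constraint `(f, S, w)` of arity at most `c` on the variables `0, …, n - 1`:
`S` is a tuple of distinct variables, `f` is an arbitrary predicate on the permutations of the
positions of the tuple, and `w` is a positive integer. -/
structure Constraint (c n : ℕ) : Type where
  arity : ℕ
  arity_le : arity ≤ c
  pred : Equiv.Perm (Fin arity) → Bool
  scope : Fin arity ↪ Fin n
  weight : ℕ
  weight_pos : 0 < weight

/-- `φ` satisfies `(f, S, w)` if `f π = 1` for the local permutation `π`, that is for the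
permutation `π` whose values are in the same relative order as the values of `φ` on `S`. -/
def Constraint.Satisfied {c n : ℕ} (C : Constraint c n) (φ : Equiv.Perm (Fin n)) : Prop :=
  ∃ π : Equiv.Perm (Fin C.arity),
    (∀ i j : Fin C.arity, π i < π j ↔ φ (C.scope i) < φ (C.scope j)) ∧ C.pred π = true

instance {c n : ℕ} (C : Constraint c n) (φ : Equiv.Perm (Fin n)) : Decidable (C.Satisfied φ) :=
  inferInstanceAs (Decidable (∃ π : Equiv.Perm (Fin C.arity),
    (∀ i j : Fin C.arity, π i < π j ↔ φ (C.scope i) < φ (C.scope j)) ∧ C.pred π = true))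

/-- An instance of Max-`c`-Permutation CSP Above Average: `n` variables, a collection of
constraints, the parameter `k`. -/
structure Instance (c : ℕ) : Type where
  n : ℕ
  constraints : List (Constraint c n)
  k : ℕ

namespace Instance

variable {c : ℕ}

/-- The weight of an assignment: the total weight of the constraints that it satisfies. -/
def weight (I : Instance c) (φ : Equiv.Perm (Fin I.n)) : ℕ :=
  (I.constraints.map fun C => if C.Satisfied φ then C.weight else 0).sum

/-- The total weight `W` of all constraints. -/
def totalWeight (I : Instance c) : ℕ :=
  (I.constraints.map fun C => C.weight).sum

/-- The expected fraction `ρ` of weighted constraints satisfied by a uniform random permutation. -/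
def rho (I : Instance c) : ℚ :=
  (∑ φ : Equiv.Perm (Fin I.n), (I.weight φ : ℚ) / I.totalWeight) /
    Fintype.card (Equiv.Perm (Fin I.n))

/-- Yes-instances: some assignment has weight at least `ρ W + k / (c! 4 ^ c)`. -/
def IsYes (I : Instance c) : Prop :=
  ∃ φ : Equiv.Perm (Fin I.n),
    (I.weight φ : ℚ) ≥ I.rho * I.totalWeight + (I.k : ℚ) / ((c.factorial : ℚ) * 4 ^ c)

/-- A permutation written as the word of its values. -/
def encodePerm {r : ℕ} (π : Equiv.Perm (Fin r)) : List ℕ :=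
  (List.finRange r).map fun i => (π i : ℕ)

/-- The permutations that satisfy a predicate, without repetition. -/
def satisfyingPerms {r : ℕ} (f : Equiv.Perm (Fin r) → Bool) : List (Equiv.Perm (Fin r)) :=
  (permsOfList (List.finRange r)).filter f

/-- A constraint is written as its weight, its arity, its tuple, the number of local permutations
that its predicate accepts, and the words of these permutations. -/
def encodeConstraint {n : ℕ} (C : Constraint c n) : List ℕ :=
  [C.weight, C.arity] ++ ((List.finRange C.arity).map fun i => (C.scope i : ℕ)) ++
    [(satisfyingPerms C.pred).length] ++ (satisfyingPerms C.pred).flatMap encodePerm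

/-- An instance is written as `n`, `k`, the number of constraints, and the constraints. -/
def encode (I : Instance c) : List ℕ :=
  [I.n, I.k, I.constraints.length] ++ I.constraints.flatMap encodeConstraint

/-- The size of an instance is the bit length of its encoding. -/
def size (I : Instance c) : ℕ :=
  RAM.inputSize I.encode

end Instance

end PermCSP

/-!
The starting point is a locality principle: a tuple of at most three variables cannot contain both
a pair inside a set `X` and a pair inside the complement of `X`. Hence the effect on the weight of
rearranging `X` does not depend on how the complement is arranged (`Instance.keyWeight_four`). It
has three consequences.

* A variable is called relevant if a transposition with some neighbour changes the weight while at
  most one more variable stands behind the two. Since the effect of a transposition is an affine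
  function of the set of variables behind it, the weight depends only on the order of the relevant
  variables (`Instance.keyWeight_eq_of_agreeOff`), and relevance can be tested in polynomial time.
* The maximal weight of an order of a set `S` of variables, with all other variables in front, obeys
  a recursion over the first variable of `S` (`Instance.exists_maxWeight_le`,
  `Instance.maxWeight_erase_le`). So with `r` relevant variables the maximum is computed exactly in
  `2 ^ r` rounds of polynomial length.
* The maximum exceeds the mean by at least `r` divided by a constant (`exists_card_relevant_le`).
  To see this, each variable is given a random label of three bits, and the variables are ordered by
  their labels with a random order breaking ties. For a fixed order of the ties, the weight is, up to
  the factor `2 ^ 9`, an integer polynomial of degree at most `9` in the bits, in which every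
  relevant variable still occurs. An integer polynomial of bounded degree on the discrete cube
  exceeds its mean by an amount linear in the number of its coordinates (`Walsh.exists_card_rel_le`).
  The mean over all labels and all orders of the ties is the mean weight, by symmetry.

The algorithm therefore counts the relevant variables. If there are at least `K k` of them, for a
constant `K`, then the answer is yes. Otherwise the maximal weight is computed over their at most
`2 ^ (K k)` subsets, and compared with the bound (`Instance.solve_spec`).

Programs are verified with the predicate transformer `RAM.WP`, which bounds the number of steps and
the bit length `B` of all stored numbers. By `RAM.BExec.exec`, such a run costs at most `B + 1` times
the number of steps, up to a constant that depends on the program only.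
-/

/-! ### Integer polynomials on the discrete cube -/

namespace Walsh

open Finset

section

variable {U : Type*}

/-- The monomial (Walsh function) of a set of coordinates, on the cube `{1, -1} ^ U`. -/
def chi (T : Finset U) (x : U → ℤˣ) : ℤ := ∏ u ∈ T, (x u : ℤ)

@[simp] theorem chi_empty (x : U → ℤˣ) : chi ∅ x = 1 := by simp [chi]

theorem chi_mul_point (T : Finset U) (x y : U → ℤˣ) : chi T (x * y) = chi T x * chi T y := by
  simp [chi, Finset.prod_mul_distrib]

theorem chi_eq_one_or (T : Finset U) (x : U → ℤˣ) : chi T x = 1 ∨ chi T x = -1 := by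
  have : chi T x = ((∏ u ∈ T, x u : ℤˣ) : ℤ) := by simp [chi]
  rw [this]
  rcases Int.units_eq_one_or (∏ u ∈ T, x u) with h | h <;> simp [h]

variable [Fintype U] [DecidableEq U]

/-- The multilinear polynomial with coefficients `c`, as a function on the cube. -/
def poly (c : Finset U → ℤ) (x : U → ℤˣ) : ℤ := ∑ T, c T * chi T x

open Classical in
/-- The coordinates that occur in a polynomial. -/
noncomputable def rel (c : Finset U → ℤ) : Finset U := univ.filter fun u => ∃ T, u ∈ T ∧ c T ≠ 0

theorem chi_eq_prod_univ (T : Finset U) (x : U → ℤˣ) :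
    chi T x = ∏ u, if u ∈ T then (x u : ℤ) else 1 := by
  simp [chi]

theorem sum_units (f : ℤˣ → ℤ) : ∑ a, f a = f 1 + f (-1) := by
  have : (univ : Finset ℤˣ) = {1, -1} := by decide
  rw [this, Finset.sum_pair (by decide)]

/-- The monomials are orthogonal. -/
theorem sum_chi_mul (S T : Finset U) :
    ∑ x : U → ℤˣ, chi S x * chi T x = if S = T then 2 ^ Fintype.card U else 0 := by
  have h : ∀ x : U → ℤˣ, chi S x * chi T x =
      ∏ u, ((if u ∈ S then (x u : ℤ) else 1) * (if u ∈ T then (x u : ℤ) else 1)) := by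
    intro x
    rw [chi_eq_prod_univ, chi_eq_prod_univ, Finset.prod_mul_distrib]
  simp_rw [h]
  rw [← Fintype.piFinset_univ, ← Finset.prod_univ_sum (fun _ => (univ : Finset ℤˣ))
    (fun u a => (if u ∈ S then (a : ℤ) else 1) * (if u ∈ T then (a : ℤ) else 1))]
  have h2 : ∀ u, ∑ a : ℤˣ, (if u ∈ S then (a : ℤ) else 1) * (if u ∈ T then (a : ℤ) else 1) =
      if (u ∈ S ↔ u ∈ T) then 2 else 0 := by
    intro u
    rw [sum_units]
    by_cases h1 : u ∈ S <;> by_cases h2 : u ∈ T <;> simp [h1, h2]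
  simp_rw [h2]
  split_ifs with hST
  · subst hST; simp
  · have : ∃ u, ¬ (u ∈ S ↔ u ∈ T) := by
      by_contra! hc
      exact hST (Finset.ext hc)
    obtain ⟨u, hu⟩ := this
    exact Finset.prod_eq_zero (mem_univ u) (by simp [hu])

theorem sum_chi_mul_poly (S : Finset U) (c : Finset U → ℤ) :
    ∑ x, chi S x * poly c x = 2 ^ Fintype.card U * c S := by
  simp_rw [poly, Finset.mul_sum]
  rw [Finset.sum_comm]
  have : ∀ T, ∑ x, chi S x * (c T * chi T x) = if S = T then 2 ^ Fintype.card U * c T else 0 := by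
    intro T
    have : ∀ x, chi S x * (c T * chi T x) = c T * (chi S x * chi T x) := fun x => by ring
    simp_rw [this]
    rw [← Finset.mul_sum, sum_chi_mul]
    split_ifs <;> ring
  simp_rw [this]
  simp

theorem sum_poly (c : Finset U → ℤ) : ∑ x, poly c x = 2 ^ Fintype.card U * c ∅ := by
  simpa using sum_chi_mul_poly ∅ c

/-- The point of the cube with coordinate `-1` exactly on `Z`. -/
def flip (Z : Finset U) : U → ℤˣ := fun u => if u ∈ Z then -1 else 1

theorem chi_flip (S Z : Finset U) : chi S (flip Z) = ∏ u ∈ Z, if u ∈ S then -1 else 1 := by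
  have h1 : chi S (flip Z) = ∏ u, if u ∈ S then (if u ∈ Z then (-1 : ℤ) else 1) else 1 := by
    rw [chi_eq_prod_univ]
    refine Finset.prod_congr rfl fun u _ => ?_
    by_cases h : u ∈ Z <;> simp [flip, h]
  have h2 : (∏ u ∈ Z, if u ∈ S then (-1 : ℤ) else 1) =
      ∏ u, if u ∈ Z then (if u ∈ S then (-1 : ℤ) else 1) else 1 := by
    simp
  rw [h1, h2]
  refine Finset.prod_congr rfl fun u _ => ?_
  split_ifs <;> rfl

theorem sum_flip (S T : Finset U) :
    ∑ Z ∈ T.powerset, chi T (flip Z) * chi S (flip Z) = if T ⊆ S then 2 ^ T.card else 0 := by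
  have h : ∀ Z ∈ T.powerset, chi T (flip Z) * chi S (flip Z) =
      ∏ u ∈ Z, if u ∈ S then (1 : ℤ) else -1 := by
    intro Z hZ
    rw [mem_powerset] at hZ
    rw [chi_flip, chi_flip, ← Finset.prod_mul_distrib]
    refine Finset.prod_congr rfl fun u hu => ?_
    by_cases h : u ∈ S <;> simp [h, hZ hu]
  rw [Finset.sum_congr rfl h, ← Finset.prod_one_add]
  split_ifs with hTS
  · rw [Finset.prod_congr rfl (g := fun _ => (2 : ℤ))]
    · simp
    · intro u hu; simp [hTS hu]
  · obtain ⟨u, hu, hu'⟩ := Finset.not_subset.1 hTS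
    exact Finset.prod_eq_zero hu (by simp [hu'])

/-- A nonzero polynomial of degree at most `d` is nonzero at a `2 ^ (-d)` fraction of the cube:
along the directions of a maximal monomial, every subcube has a point where it is nonzero. -/
theorem card_ne_zero (d : ℕ) (c : Finset U → ℤ) (hd : ∀ T, c T ≠ 0 → T.card ≤ d)
    (h0 : ∃ T, c T ≠ 0) :
    2 ^ Fintype.card U ≤ 2 ^ d * (univ.filter fun x => poly c x ≠ 0).card := by
  classical
  obtain ⟨T₀, hT₀⟩ := h0
  obtain ⟨T, hT, hmax⟩ := Finset.exists_max_image (univ.filter fun T => c T ≠ 0) Finset.card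
    ⟨T₀, by simpa using hT₀⟩
  have hcT : c T ≠ 0 := by simpa using hT
  have hmax' : ∀ S, T ⊆ S → c S ≠ 0 → S = T := by
    intro S hTS hS
    exact (Finset.eq_of_subset_of_card_le hTS (hmax S (by simpa using hS))).symm
  have key : ∀ x, ∃ Z ∈ T.powerset, poly c (x * flip Z) ≠ 0 := by
    intro x
    by_contra! hc
    have h1 : ∑ Z ∈ T.powerset, chi T (flip Z) * poly c (x * flip Z) = 0 :=
      Finset.sum_eq_zero fun Z hZ => by rw [hc Z hZ, mul_zero]
    -- Up to sign, this Fourier coefficient of the restriction to the subcube is `c T`, since no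
    -- larger monomial contains `T`.
    have h2 : ∑ Z ∈ T.powerset, chi T (flip Z) * poly c (x * flip Z) =
        2 ^ T.card * (c T * chi T x) := by
      simp_rw [poly, Finset.mul_sum]
      rw [Finset.sum_comm, Finset.sum_eq_single T]
      · have : ∀ Z, chi T (flip Z) * (c T * chi T (x * flip Z)) =
            (c T * chi T x) * (chi T (flip Z) * chi T (flip Z)) := by
          intro Z; rw [chi_mul_point]; ring
        simp_rw [this]
        rw [← Finset.mul_sum, sum_flip, if_pos (Finset.Subset.refl _)]
        ring
      · intro S _ hST
        have : ∀ Z, chi T (flip Z) * (c S * chi S (x * flip Z)) =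
            (c S * chi S x) * (chi T (flip Z) * chi S (flip Z)) := by
          intro Z; rw [chi_mul_point]; ring
        simp_rw [this]
        rw [← Finset.mul_sum, sum_flip]
        split_ifs with hTS
        · by_cases hS : c S = 0
          · simp [hS]
          · exact absurd (hmax' S hTS hS) hST
        · simp
      · simp
    rw [h2] at h1
    rcases chi_eq_one_or T x with h | h <;> simp [h, hcT] at h1
  have hcount : 2 ^ Fintype.card U ≤
      ∑ x : U → ℤˣ, ∑ Z ∈ T.powerset, if poly c (x * flip Z) ≠ 0 then 1 else 0 := by
    have : (2 ^ Fintype.card U : ℕ) = ∑ x : U → ℤˣ, 1 := by simp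
    rw [this]
    refine Finset.sum_le_sum fun x _ => ?_
    obtain ⟨Z, hZ, hne⟩ := key x
    calc 1 = if poly c (x * flip Z) ≠ 0 then 1 else 0 := by simp [hne]
      _ ≤ _ := Finset.single_le_sum (f := fun Z => if poly c (x * flip Z) ≠ 0 then 1 else 0)
          (fun _ _ => Nat.zero_le _) hZ
  refine hcount.trans ?_
  rw [Finset.sum_comm]
  have : ∀ Z ∈ T.powerset, (∑ x : U → ℤˣ, if poly c (x * flip Z) ≠ 0 then 1 else 0) =
      (univ.filter fun x => poly c x ≠ 0).card := by
    intro Z _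
    rw [Finset.card_filter]
    exact Fintype.sum_equiv (Equiv.mulRight (flip Z)) _ _ fun x => rfl
  rw [Finset.sum_congr rfl this]
  simp only [sum_const, card_powerset, smul_eq_mul]
  exact Nat.mul_le_mul_right _ (Nat.pow_le_pow_right (by norm_num) (hd T hcT))

/-- The coefficients after fixing the coordinates in `H` to their values in `x`. -/
def restr (c : Finset U → ℤ) (H : Finset U) (x : U → ℤˣ) : Finset U → ℤ :=
  fun T' => ∑ T with T \ H = T', c T * chi (T ∩ H) x

theorem poly_restr (c : Finset U → ℤ) (H : Finset U) (x y : U → ℤˣ) :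
    poly (restr c H x) y = poly c (fun u => if u ∈ H then x u else y u) := by
  simp only [poly, restr, Finset.sum_mul]
  rw [← Finset.sum_fiberwise univ (fun T : Finset U => T \ H) (fun T => c T * chi T _)]
  refine Finset.sum_congr rfl fun T' _ => Finset.sum_congr rfl fun T hT => ?_
  have hT' : T \ H = T' := by simpa using hT
  have h1 : chi T (fun u => if u ∈ H then x u else y u) = chi (T ∩ H) x * chi (T \ H) y := by
    rw [chi, ← Finset.prod_inter_mul_prod_sdiff T H]
    congr 1
    · exact Finset.prod_congr rfl fun u hu => by simp [(mem_inter.1 hu).2]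
    · exact Finset.prod_congr rfl fun u hu => by simp [(mem_sdiff.1 hu).2]
  rw [h1, hT']
  ring

theorem restr_eq_poly (c : Finset U → ℤ) (H : Finset U) (x : U → ℤˣ) (T' : Finset U) :
    restr c H x T' = poly (fun Y => ∑ T with T \ H = T' ∧ T ∩ H = Y, c T) x := by
  simp only [poly, restr, Finset.sum_mul]
  rw [← Finset.sum_fiberwise _ (fun T : Finset U => T ∩ H)]
  refine Finset.sum_congr rfl fun Y _ => ?_
  rw [Finset.filter_filter]
  refine Finset.sum_congr rfl fun T hT => ?_
  rw [(by simpa using hT : T \ H = T' ∧ T ∩ H = Y).2]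

theorem sum_restr_empty (c : Finset U → ℤ) (H : Finset U) :
    ∑ x, restr c H x ∅ = 2 ^ Fintype.card U * c ∅ := by
  simp_rw [restr_eq_poly]
  rw [sum_poly]
  congr 1
  rw [Finset.sum_eq_single ∅]
  · rintro T hT hne
    have : T \ H = ∅ ∧ T ∩ H = ∅ := by simpa using hT
    refine absurd ?_ hne
    rw [← Finset.sdiff_union_inter T H, this.1, this.2, Finset.union_empty]
  · simp

/-- A coordinate outside `H` survives a random assignment to the coordinates in `H` with probability
at least `2 ^ (-d)`: after the assignment, a coefficient is the value of a nonzero polynomial. -/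
theorem card_rel_restr (d : ℕ) (c : Finset U → ℤ) (hd : ∀ T, c T ≠ 0 → T.card ≤ d)
    (H : Finset U) (u : U) (hu : u ∈ rel c) (huH : u ∉ H) :
    2 ^ Fintype.card U ≤ 2 ^ d * (univ.filter fun x => u ∈ rel (restr c H x)).card := by
  classical
  obtain ⟨T, huT, hT⟩ := (by simpa [rel] using hu : ∃ T, u ∈ T ∧ c T ≠ 0)
  set e : Finset U → ℤ := fun Y => ∑ S with S \ H = T \ H ∧ S ∩ H = Y, c S with he
  have h1 := card_ne_zero d e ?_ ⟨T ∩ H, ?_⟩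
  · refine h1.trans (Nat.mul_le_mul_left _ (Finset.card_le_card ?_))
    intro x hx
    simp only [mem_filter, mem_univ, true_and, rel] at hx ⊢
    exact ⟨T \ H, by simp [huT, huH], by rwa [restr_eq_poly]⟩
  · intro Y hY
    obtain ⟨S, hS, hcS⟩ := Finset.exists_ne_zero_of_sum_ne_zero hY
    have hS' : S \ H = T \ H ∧ S ∩ H = Y := by simpa using hS
    rw [← hS'.2]
    exact (Finset.card_le_card Finset.inter_subset_left).trans (hd S hcS)
  · rw [he]
    simp only
    rw [Finset.sum_eq_single T]
    · exact hT
    · rintro S hS hne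
      have hS' : S \ H = T \ H ∧ S ∩ H = T ∩ H := by simpa using hS
      refine absurd ?_ hne
      rw [← Finset.sdiff_union_inter S H, hS'.1, hS'.2, Finset.sdiff_union_inter]
    · simp

theorem sum_powerset_of_card_le_one {α : Type*} [DecidableEq α] (F : Finset α)
    (f : Finset α → ℤ) (hf : ∀ G ⊆ F, 2 ≤ G.card → f G = 0) :
    ∑ G ∈ F.powerset, f G = f ∅ + ∑ S ∈ F, f {S} := by
  induction F using Finset.induction_on with
  | empty => simp
  | insert S F hS ih =>
    rw [Finset.sum_powerset_insert hS, ih fun G hG => hf G (hG.trans (subset_insert _ _)),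
      Finset.sum_insert hS, Finset.sum_eq_single (∅ : Finset α)]
    · rw [insert_empty_eq]; ring
    · intro G hG hne
      rw [mem_powerset] at hG
      refine hf _ (Finset.insert_subset_insert _ hG) ?_
      rw [Finset.card_insert_of_notMem fun h => hS (hG h)]
      have := Finset.card_pos.2 (Finset.nonempty_iff_ne_empty.2 hne)
      omega
    · simp

/-- Disjoint monomials of top degree can be satisfied simultaneously without any loss: the product
density `∏ (1 + sign (c S) χ_S)` is orthogonal to all other nonconstant monomials of the
polynomial. -/
theorem exists_ge_of_disjoint (d : ℕ) (c : Finset U → ℤ) (hd : ∀ T, c T ≠ 0 → T.card ≤ d + 1)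
    (F : Finset (Finset U)) (hF : (F : Set (Finset U)).PairwiseDisjoint id)
    (hFc : ∀ S ∈ F, S.card = d + 1 ∧ c S ≠ 0) :
    ∃ x, c ∅ + F.card ≤ poly c x := by
  classical
  by_contra! hlt
  set w : (U → ℤˣ) → ℤ := fun x => ∏ S ∈ F, (1 + (c S).sign * chi S x) with hw
  have hw0 : ∀ x, 0 ≤ w x := by
    intro x
    refine Finset.prod_nonneg fun S _ => ?_
    rcases chi_eq_one_or S x with h | h <;> rcases Int.sign_trichotomy (c S) with h' | h' | h' <;>
      simp [h, h']
  have hexp : ∀ x, w x = ∑ G ∈ F.powerset, (∏ S ∈ G, (c S).sign) * chi (G.biUnion id) x := by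
    intro x
    rw [hw]
    simp only
    rw [Finset.prod_one_add]
    refine Finset.sum_congr rfl fun G hG => ?_
    rw [Finset.prod_mul_distrib]
    congr 1
    rw [chi, Finset.prod_biUnion]
    · rfl
    · exact hF.subset (by simpa using hG)
  have hE : ∀ e : Finset U → ℤ, (∀ T, e T ≠ 0 → T.card ≤ d + 1) →
      ∑ x, w x * poly e x = 2 ^ Fintype.card U * (e ∅ + ∑ S ∈ F, (c S).sign * e S) := by
    intro e hed
    simp_rw [hexp, Finset.sum_mul]
    rw [Finset.sum_comm]
    have : ∀ G, ∑ x, (∏ S ∈ G, (c S).sign) * chi (G.biUnion id) x * poly e x =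
        2 ^ Fintype.card U * ((∏ S ∈ G, (c S).sign) * e (G.biUnion id)) := by
      intro G
      simp_rw [mul_assoc]
      rw [← Finset.mul_sum, sum_chi_mul_poly]
      ring
    simp_rw [this]
    rw [← Finset.mul_sum, sum_powerset_of_card_le_one]
    · simp
    · -- A union of two or more members of `F` has more than `d + 1` elements.
      intro G hG h2
      by_contra hne
      have h3 : e (G.biUnion id) ≠ 0 := fun h => hne (by rw [h, mul_zero])
      have h4 := hed _ h3
      rw [Finset.card_biUnion] at h4
      · rw [Finset.sum_congr (f := fun S => (id S).card) (g := fun _ => d + 1) rfl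
            fun S hS => (hFc S (hG hS)).1] at h4
        simp only [sum_const, smul_eq_mul] at h4
        nlinarith
      · intro S hS T hT hne
        exact hF (hG hS) (hG hT) hne
  have h1 : ∑ x, w x = 2 ^ Fintype.card U := by
    have := hE (fun T => if T = ∅ then 1 else 0) (by intro T; simp; rintro rfl; simp)
    have hp : ∀ x, poly (fun T : Finset U => if T = ∅ then 1 else 0) x = 1 := by
      intro x; simp [poly]
    simp only [hp, mul_one, if_true] at this
    rw [this, Finset.sum_eq_zero]
    · ring
    · intro S hS
      have : S ≠ ∅ := by
        rintro rfl
        simpa using (hFc ∅ hS).1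
      simp [this]
  have h2 := hE c hd
  have h3 : (F.card : ℤ) ≤ ∑ S ∈ F, (c S).sign * c S := by
    rw [Finset.card_eq_sum_ones, Nat.cast_sum]
    refine Finset.sum_le_sum fun S hS => ?_
    rw [Int.sign_mul_self_eq_abs]
    simpa using Int.one_le_abs (hFc S hS).2
  have h4 : ∑ x, w x * poly c x < ∑ x, w x * (c ∅ + F.card) := by
    refine Finset.sum_lt_sum (fun x _ => mul_le_mul_of_nonneg_left (hlt x).le (hw0 x)) ?_
    have : ∃ x, w x ≠ 0 := by
      by_contra! hc
      simp only [hc, sum_const_zero] at h1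
      exact absurd h1 (by positivity)
    obtain ⟨x, hx⟩ := this
    exact ⟨x, mem_univ _, mul_lt_mul_of_pos_left (hlt x) (lt_of_le_of_ne (hw0 x) hx.symm)⟩
  rw [← Finset.sum_mul, h1, h2] at h4
  have h5 : (0 : ℤ) < 2 ^ Fintype.card U := by positivity
  nlinarith

end

/-- An integer polynomial of degree at most `d` on the cube exceeds its mean by an amount linear
in the number of its coordinates. Either there are many disjoint monomials of top degree, or few
coordinates hit all of them, and then a random assignment of these coordinates lowers the degree
and keeps every other coordinate with probability at least `2 ^ (-d)`. -/
theorem exists_card_rel_le (d : ℕ) : ∃ K : ℕ, ∀ (U : Type) [Fintype U] [DecidableEq U]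
    (c : Finset U → ℤ), (∀ T, c T ≠ 0 → T.card ≤ d) →
    ∃ x, ((rel c).card : ℤ) ≤ K * (poly c x - c ∅) := by
  classical
  induction d with
  | zero =>
    refine ⟨0, fun U _ _ c hc => ⟨1, ?_⟩⟩
    have : rel c = ∅ := by
      rw [rel, Finset.filter_eq_empty_iff]
      rintro u - ⟨T, hu, hT⟩
      have := hc T hT
      rw [Nat.le_zero, Finset.card_eq_zero] at this
      simp [this] at hu
    simp [this]
  | succ d ih =>
    obtain ⟨K, hK⟩ := ih
    refine ⟨K * 2 ^ (d + 1) + (d + 1), fun U _ _ c hc => ?_⟩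
    obtain ⟨x₀, -, hx₀⟩ := Finset.exists_max_image (univ : Finset (U → ℤˣ)) (poly c) ⟨1, mem_univ _⟩
    refine ⟨x₀, ?_⟩
    -- A maximal family of disjoint monomials of top degree.
    obtain ⟨F, hF, hmax⟩ := Finset.exists_max_image
      (univ.filter fun F : Finset (Finset U) => (F : Set (Finset U)).PairwiseDisjoint id ∧
        ∀ S ∈ F, S.card = d + 1 ∧ c S ≠ 0) Finset.card ⟨∅, by simp⟩
    obtain ⟨hFd, hFc⟩ := (mem_filter.1 hF).2
    obtain ⟨x₁, hx₁⟩ := exists_ge_of_disjoint d c hc F hFd hFc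
    have hq : (F.card : ℤ) ≤ poly c x₀ - c ∅ := by linarith [hx₀ x₁ (mem_univ _)]
    set H := F.biUnion id with hH
    have hHcard : H.card ≤ (d + 1) * F.card := by
      refine Finset.card_biUnion_le.trans ?_
      rw [Finset.sum_congr (f := fun S => (id S).card) (g := fun _ => d + 1) rfl
        fun S hS => (hFc S hS).1]
      simp [mul_comm]
    have hhit : ∀ T, c T ≠ 0 → T.card = d + 1 → ¬ Disjoint T H := by
      intro T hT hTc hdis
      have hTF : T ∉ F := by
        intro h
        have hsub : T ⊆ H := Finset.subset_biUnion_of_mem id h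
        have := Finset.disjoint_self_iff_empty T |>.1 (hdis.mono_right hsub)
        simp [this] at hTc
      have := hmax (insert T F) ?_
      · rw [Finset.card_insert_of_notMem hTF] at this
        omega
      · rw [mem_filter]
        refine ⟨mem_univ _, ?_, ?_⟩
        · rw [Finset.coe_insert, Set.pairwiseDisjoint_insert]
          exact ⟨hFd, fun S hS _ => hdis.mono_right (Finset.subset_biUnion_of_mem id hS)⟩
        · intro S hS
          rcases mem_insert.1 hS with rfl | hS
          · exact ⟨hTc, hT⟩
          · exact hFc S hS
    have hdeg : ∀ x T', restr c H x T' ≠ 0 → T'.card ≤ d := by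
      intro x T' hne
      obtain ⟨T, hT, hcT⟩ := Finset.exists_ne_zero_of_sum_ne_zero hne
      have hT' : T \ H = T' := by simpa using hT
      have hcT' : c T ≠ 0 := fun h => hcT (by simp [h])
      have h1 := hc T hcT'
      by_contra hlt
      have h2 : T'.card ≤ T.card := by rw [← hT']; exact Finset.card_le_card Finset.sdiff_subset
      have h3 : T' = T := Finset.eq_of_subset_of_card_le (hT' ▸ Finset.sdiff_subset) (by omega)
      refine hhit T hcT' (by omega) ?_
      rw [← Finset.sdiff_eq_self_iff_disjoint]
      rw [hT', h3]
    have hres : ∀ x, ((rel (restr c H x)).card : ℤ) ≤ K * (poly c x₀ - restr c H x ∅) := by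
      intro x
      obtain ⟨y, hy⟩ := hK U (restr c H x) (hdeg x)
      refine hy.trans (mul_le_mul_of_nonneg_left ?_ (by positivity))
      rw [poly_restr]
      linarith [hx₀ (fun u => if u ∈ H then x u else y u) (mem_univ _)]
    have hsum : ∑ x, ((rel (restr c H x)).card : ℤ) ≤
        2 ^ Fintype.card U * (K * (poly c x₀ - c ∅)) := by
      refine (Finset.sum_le_sum fun x _ => hres x).trans (le_of_eq ?_)
      rw [← Finset.mul_sum, Finset.sum_sub_distrib, sum_restr_empty]
      simp
      ring
    -- The coordinates that survive the assignments are counted in two ways.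
    have hlow : 2 ^ Fintype.card U * (rel c \ H).card ≤
        2 ^ (d + 1) * ∑ x, (rel (restr c H x)).card := by
      have h1 : ∑ x, (rel (restr c H x)).card =
          ∑ u, (univ.filter fun x => u ∈ rel (restr c H x)).card := by
        simp_rw [Finset.card_filter]
        rw [Finset.sum_comm]
        refine Finset.sum_congr rfl fun x _ => ?_
        rw [← Finset.card_filter]
        congr 1
        ext u; simp
      rw [h1, Finset.mul_sum, mul_comm]
      calc (rel c \ H).card * 2 ^ Fintype.card U
          = ∑ u ∈ rel c \ H, 2 ^ Fintype.card U := by simp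
        _ ≤ ∑ u ∈ rel c \ H, 2 ^ (d + 1) *
            (univ.filter fun x => u ∈ rel (restr c H x)).card :=
          Finset.sum_le_sum fun u hu => card_rel_restr (d + 1) c hc H u
            (mem_sdiff.1 hu).1 (mem_sdiff.1 hu).2
        _ ≤ _ := Finset.sum_le_sum_of_subset (Finset.subset_univ _)
    have hlow' : (2 : ℤ) ^ Fintype.card U * ((rel c \ H).card : ℤ) ≤
        2 ^ (d + 1) * ∑ x, ((rel (restr c H x)).card : ℤ) := by exact_mod_cast hlow
    have h5 : (0 : ℤ) < 2 ^ Fintype.card U := by positivity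
    have h6 : ((rel c \ H).card : ℤ) ≤ 2 ^ (d + 1) * (K * (poly c x₀ - c ∅)) := by
      have h7 := hlow'.trans (mul_le_mul_of_nonneg_left hsum (by positivity : (0 : ℤ) ≤ 2 ^ (d + 1)))
      refine le_of_mul_le_mul_left (h7.trans (le_of_eq ?_)) h5
      ring
    have h8 : ((rel c).card : ℤ) ≤ (rel c \ H).card + H.card := by
      have : (rel c).card ≤ (rel c \ H).card + H.card := by
        have h9 := Finset.card_le_card (Finset.subset_union_left (s₁ := rel c) (s₂ := H))
        rw [← Finset.sdiff_union_self_eq_union] at h9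
        exact h9.trans (Finset.card_union_le _ _)
      exact_mod_cast this
    have h10 : (H.card : ℤ) ≤ (d + 1) * F.card := by exact_mod_cast hHcard
    have h11 : ((d : ℤ) + 1) * F.card ≤ (d + 1) * (poly c x₀ - c ∅) :=
      mul_le_mul_of_nonneg_left hq (by positivity)
    push_cast
    linarith

end Walsh

/-! ### Orders given by keys -/

namespace PermCSP

variable {c n : ℕ}

/-- The constraint is satisfied by every assignment that orders the variables of its scope like
the keys `κ`. -/
def Constraint.SatKey (C : Constraint c n) (κ : Fin n → ℕ) : Prop :=
  ∃ π : Equiv.Perm (Fin C.arity),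
    (∀ i j : Fin C.arity, π i < π j ↔ κ (C.scope i) < κ (C.scope j)) ∧ C.pred π = true

theorem Constraint.satKey_congr (C : Constraint c n) {κ κ' : Fin n → ℕ}
    (h : ∀ i j, κ (C.scope i) < κ (C.scope j) ↔ κ' (C.scope i) < κ' (C.scope j)) :
    C.SatKey κ ↔ C.SatKey κ' := by
  simp only [SatKey, h]

open Classical in
/-- The weight of a constraint if it is satisfied by the order of the keys, and `0` otherwise. -/
noncomputable def Constraint.gain (C : Constraint c n) (κ : Fin n → ℕ) : ℕ :=
  if C.SatKey κ then C.weight else 0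

theorem Constraint.gain_congr (C : Constraint c n) {κ κ' : Fin n → ℕ}
    (h : ∀ i j, κ (C.scope i) < κ (C.scope j) ↔ κ' (C.scope i) < κ' (C.scope j)) :
    C.gain κ = C.gain κ' := by
  classical
  unfold gain
  exact if_congr (C.satKey_congr h) rfl rfl

/-- The weight of the order given by the keys `κ`. -/
noncomputable def Instance.keyWeight (I : Instance c) (κ : Fin I.n → ℕ) : ℕ :=
  (I.constraints.map fun C => C.gain κ).sum

theorem Instance.weight_eq_keyWeight (I : Instance c) (φ : Equiv.Perm (Fin I.n)) :
    I.weight φ = I.keyWeight fun i => φ i := by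
  unfold Instance.weight Instance.keyWeight
  congr 1
  refine List.map_congr_left fun C _ => ?_
  unfold Constraint.gain
  have : C.Satisfied φ ↔ C.SatKey fun i => φ i := Iff.rfl
  by_cases h : C.Satisfied φ
  · rw [if_pos h, if_pos (this.1 h)]
  · rw [if_neg h, if_neg fun h' => h (this.2 h')]

/-- `κ` and `κ'` order all pairs in the same way, except perhaps pairs inside `X`. -/
def AgreeOff (X : Set (Fin n)) (κ κ' : Fin n → ℕ) : Prop :=
  ∀ i j, ¬ (i ∈ X ∧ j ∈ X) → (κ i < κ j ↔ κ' i < κ' j)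

theorem Instance.keyWeight_congr (I : Instance c) {κ κ' : Fin I.n → ℕ}
    (h : ∀ i j, κ i < κ j ↔ κ' i < κ' j) : I.keyWeight κ = I.keyWeight κ' := by
  unfold Instance.keyWeight
  congr 1
  exact List.map_congr_left fun C _ => C.gain_congr fun i j => h _ _

theorem sum_map_add_eq {α : Type*} (l : List α) (f₁ f₂ f₃ f₄ : α → ℕ)
    (h : ∀ a ∈ l, f₁ a + f₄ a = f₂ a + f₃ a) :
    (l.map f₁).sum + (l.map f₄).sum = (l.map f₂).sum + (l.map f₃).sum := by
  rw [← List.sum_map_add, ← List.sum_map_add, List.map_congr_left h]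

/-- The locality principle: a scope of at most three variables cannot contain both a pair inside
`X` and a pair inside the complement of `X`. So rearranging `X` changes the weight by an amount
that does not depend on the arrangement of the complement. -/
theorem Instance.keyWeight_four (I : Instance c) (hc : c ≤ 3) (X : Set (Fin I.n))
    {κ₁ κ₂ κ₃ κ₄ : Fin I.n → ℕ} (h₁₂ : AgreeOff X κ₁ κ₂) (h₃₄ : AgreeOff X κ₃ κ₄)
    (h₁₃ : AgreeOff Xᶜ κ₁ κ₃) (h₂₄ : AgreeOff Xᶜ κ₂ κ₄) :
    I.keyWeight κ₁ + I.keyWeight κ₄ = I.keyWeight κ₂ + I.keyWeight κ₃ := by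
  unfold Instance.keyWeight
  refine sum_map_add_eq _ _ _ _ _ fun C _ => ?_
  by_cases hX : ∀ i j, C.scope i ∈ X → C.scope j ∈ X → i = j
  · have key : ∀ {κ κ' : Fin I.n → ℕ}, AgreeOff X κ κ' → C.gain κ = C.gain κ' := by
      intro κ κ' h
      refine C.gain_congr fun i j => ?_
      by_cases hij : C.scope i ∈ X ∧ C.scope j ∈ X
      · rw [hX i j hij.1 hij.2]; simp
      · exact h _ _ hij
    rw [key h₁₂, key h₃₄]
  · push Not at hX
    obtain ⟨i₀, j₀, hi₀, hj₀, hne⟩ := hX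
    have key : ∀ {κ κ' : Fin I.n → ℕ}, AgreeOff Xᶜ κ κ' → C.gain κ = C.gain κ' := by
      intro κ κ' h
      refine C.gain_congr fun i j => ?_
      by_cases hij : C.scope i ∈ Xᶜ ∧ C.scope j ∈ Xᶜ
      · have : i = j := by
          by_contra hij'
          have h1 : i ≠ i₀ := fun e => hij.1 (e ▸ hi₀)
          have h2 : i ≠ j₀ := fun e => hij.1 (e ▸ hj₀)
          have h3 : j ≠ i₀ := fun e => hij.2 (e ▸ hi₀)
          have h4 : j ≠ j₀ := fun e => hij.2 (e ▸ hj₀)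
          have h5 := C.arity_le
          have h6 := i.isLt
          have h7 := j.isLt
          have h8 := i₀.isLt
          have h9 := j₀.isLt
          simp only [ne_eq, Fin.ext_iff] at *
          omega
        rw [this]; simp
      · exact h _ _ hij
    rw [key h₁₃, key h₂₄, add_comm]

theorem exists_perm_of_injective {m : ℕ} (κ : Fin m → ℕ) (hκ : Function.Injective κ) :
    ∃ φ : Equiv.Perm (Fin m), ∀ i j, φ i < φ j ↔ κ i < κ j := by
  refine ⟨(Tuple.sort κ)⁻¹, fun i j => ?_⟩
  have h : StrictMono (κ ∘ Tuple.sort κ) :=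
    (Tuple.monotone_sort κ).strictMono_of_injective (hκ.comp (Tuple.sort κ).injective)
  rw [← h.lt_iff_lt]
  simp

/-- The keys that order the variables by their labels, ties being broken by `ψ`. -/
def labelKey (g : Fin n → ℕ) (ψ : Equiv.Perm (Fin n)) : Fin n → ℕ := fun i => g i * n + ψ i

theorem labelKey_lt (g : Fin n → ℕ) (ψ : Equiv.Perm (Fin n)) (i j : Fin n) :
    labelKey g ψ i < labelKey g ψ j ↔ g i < g j ∨ g i = g j ∧ (ψ i : ℕ) < ψ j := by
  unfold labelKey
  have hi := (ψ i).isLt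
  have hj := (ψ j).isLt
  rcases lt_trichotomy (g i) (g j) with h | h | h
  · have := Nat.mul_le_mul_right n (Nat.succ_le_of_lt h)
    rw [Nat.succ_mul] at this
    simp only [h, true_or, iff_true]
    omega
  · simp [h]
  · have := Nat.mul_le_mul_right n (Nat.succ_le_of_lt h)
    rw [Nat.succ_mul] at this
    constructor
    · intro; omega
    · rintro (h' | ⟨h', -⟩) <;> omega

theorem labelKey_injective (g : Fin n → ℕ) (ψ : Equiv.Perm (Fin n)) :
    Function.Injective (labelKey g ψ) := by
  intro i j h
  have h1 := labelKey_lt g ψ i j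
  have h2 := labelKey_lt g ψ j i
  rw [h] at h1 h2
  simp only [lt_irrefl, false_iff, not_or, not_and, not_lt] at h1 h2
  have h3 : g i = g j := by omega
  refine ψ.injective (Fin.ext ?_)
  have := h1.2 h3
  have := h2.2 h3.symm
  omega

/-! ### Irrelevant variables -/

/-- The labels of a test order: the variable `v` next to the variable `u`, before it for `t = 1`
and after it for `t = 3`, with the variables of `A` behind them and all others in front. -/
def testLabel (v u : Fin n) (A : Finset (Fin n)) (t : ℕ) : Fin n → ℕ :=
  fun i => if i = v then t else if i = u then 2 else if i ∈ A then 4 else 0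

namespace Instance

variable (I : Instance c)

/-- The weight of a test order. -/
noncomputable def testWeight (v u : Fin I.n) (A : Finset (Fin I.n)) (t : ℕ) : ℕ :=
  I.keyWeight (labelKey (testLabel v u A t) 1)

/-- A variable is relevant if a transposition with some neighbour `u` changes the weight, in a
test order with at most one variable behind the two. -/
def Relevant (v : Fin I.n) : Prop :=
  ∃ u x, I.testWeight v u {x} 1 ≠ I.testWeight v u {x} 3

/-- The effect of a transposition of neighbours is an affine function of the (indicator of the)
set `A` of variables behind them. -/
theorem testWeight_insert (hc : c ≤ 3) (v u x : Fin I.n) (A : Finset (Fin I.n)) (huv : u ≠ v)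
    (hxA : x ∉ A) (hv : v ∉ insert x A) (hu : u ∉ insert x A) :
    (I.testWeight v u (insert x A) 1 + I.testWeight v u A 3) +
        (I.testWeight v u {x} 3 + I.testWeight v u ∅ 1) =
      (I.testWeight v u (insert x A) 3 + I.testWeight v u A 1) +
        (I.testWeight v u {x} 1 + I.testWeight v u ∅ 3) := by
  unfold testWeight keyWeight
  simp only [← List.sum_map_add]
  congr 1
  refine List.map_congr_left fun C _ => ?_
  have hxv : x ≠ v := fun h => hv (by simp [h])
  have hxu : x ≠ u := fun h => hu (by simp [h])
  have hvA : v ∉ A := fun h => hv (by simp [h])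
  have huA : u ∉ A := fun h => hu (by simp [h])
  have key : ∀ {g g' : Fin I.n → ℕ}, (∀ i, g (C.scope i) = g' (C.scope i)) →
      C.gain (labelKey g 1) = C.gain (labelKey g' 1) := by
    intro g g' h
    refine C.gain_congr fun i j => ?_
    rw [labelKey_lt, labelKey_lt, h, h]
  by_cases hx : ∃ i, C.scope i = x
  · by_cases hv' : ∃ i, C.scope i = v
    · by_cases hu' : ∃ i, C.scope i = u
      · obtain ⟨a, ha⟩ := hx
        obtain ⟨b, hb⟩ := hv'
        obtain ⟨d, hd⟩ := hu'
        -- The scope is exhausted by `v`, `u` and `x`, so that `A` is not seen.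
        have hA : ∀ i, C.scope i ∉ A := by
          intro i hi
          have h1 : i ≠ a := fun e => hxA (by rw [← ha, ← e]; exact hi)
          have h2 : i ≠ b := fun e => hvA (by rw [← hb, ← e]; exact hi)
          have h3 : i ≠ d := fun e => huA (by rw [← hd, ← e]; exact hi)
          have h4 : a ≠ b := fun e => hxv (by rw [← ha, ← hb, e])
          have h5 : a ≠ d := fun e => hxu (by rw [← ha, ← hd, e])
          have h6 : d ≠ b := fun e => huv (by rw [← hb, ← hd, e])
          have := C.arity_le
          have := i.isLt
          have := a.isLt
          have := b.isLt
          have := d.isLt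
          simp only [ne_eq, Fin.ext_iff] at *
          omega
        have e1 : ∀ t, C.gain (labelKey (testLabel v u (insert x A) t) 1) =
            C.gain (labelKey (testLabel v u {x} t) 1) :=
          fun t => key fun i => by simp [testLabel, hA i]
        have e2 : ∀ t, C.gain (labelKey (testLabel v u A t) 1) =
            C.gain (labelKey (testLabel v u ∅ t) 1) :=
          fun t => key fun i => by simp [testLabel, hA i]
        simp only [e1, e2]
        ring
      · push Not at hu'
        have e : ∀ B, C.gain (labelKey (testLabel v u B 1) 1) =
            C.gain (labelKey (testLabel v u B 3) 1) := by
          intro B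
          refine C.gain_congr fun i j => ?_
          rw [labelKey_lt, labelKey_lt]
          simp only [testLabel, hu', if_false]
          split_ifs <;> simp
        simp only [e]
    · push Not at hv'
      have e : ∀ B, C.gain (labelKey (testLabel v u B 1) 1) =
          C.gain (labelKey (testLabel v u B 3) 1) :=
        fun B => key fun i => by simp [testLabel, hv']
      simp only [e]
  · push Not at hx
    have e1 : ∀ t, C.gain (labelKey (testLabel v u (insert x A) t) 1) =
        C.gain (labelKey (testLabel v u A t) 1) :=
      fun t => key fun i => by simp [testLabel, hx]
    have e2 : ∀ t, C.gain (labelKey (testLabel v u {x} t) 1) =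
        C.gain (labelKey (testLabel v u ∅ t) 1) :=
      fun t => key fun i => by simp [testLabel, hx]
    simp only [e1, e2]
    ring

/-- For an irrelevant variable, the affine function that gives the effect of a transposition vanishes
identically, as it vanishes on all sets with at most one element. -/
theorem testWeight_eq_of_not_relevant (hc : c ≤ 3) {v : Fin I.n} (hv : ¬ I.Relevant v)
    (u : Fin I.n) (huv : u ≠ v) (A : Finset (Fin I.n)) :
    I.testWeight v u A 1 = I.testWeight v u A 3 := by
  have hv' : ∀ u x, I.testWeight v u {x} 1 = I.testWeight v u {x} 3 := by
    simpa [Relevant] using hv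
  have hins : ∀ (B : Finset (Fin I.n)) (x t), x = v ∨ x = u →
      I.testWeight v u (insert x B) t = I.testWeight v u B t := by
    intro B x t hx
    have : testLabel v u (insert x B) t = testLabel v u B t := by
      funext i
      unfold testLabel
      rcases hx with rfl | rfl <;> split_ifs <;> simp_all
    unfold testWeight
    rw [this]
  have h0 : I.testWeight v u ∅ 1 = I.testWeight v u ∅ 3 := by
    have := hv' u v
    rwa [← insert_empty_eq, hins _ _ _ (Or.inl rfl), hins _ _ _ (Or.inl rfl)] at this
  suffices h : ∀ B : Finset (Fin I.n), v ∉ B → u ∉ B →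
      I.testWeight v u B 1 = I.testWeight v u B 3 by
    have hB := h ((A.erase v).erase u) (by simp) (by simp)
    have : testLabel v u ((A.erase v).erase u) = testLabel v u A := by
      funext t i
      unfold testLabel
      split_ifs <;> simp_all
    unfold testWeight at hB ⊢
    rwa [this] at hB
  intro B
  induction B using Finset.induction_on with
  | empty => exact fun _ _ => h0
  | insert x B hx ih =>
    intro hvB huB
    have h1 := ih (fun h => hvB (by simp [h])) (fun h => huB (by simp [h]))
    have h2 := I.testWeight_insert hc v u x B huv hx hvB huB
    have h3 := hv' u x
    omega

/-- The effect of a transposition of neighbours depends only on the set `A` of variables behind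
them. -/
theorem keyWeight_eq_test (hc : c ≤ 3) (κ κ' : Fin I.n → ℕ) (u v : Fin I.n)
    (A : Finset (Fin I.n)) (h : AgreeOff {u, v} κ κ')
    (h₁ : AgreeOff {u, v}ᶜ κ (labelKey (testLabel v u A 1) 1))
    (h₂ : AgreeOff {u, v}ᶜ κ' (labelKey (testLabel v u A 3) 1)) :
    I.keyWeight κ + I.testWeight v u A 3 = I.keyWeight κ' + I.testWeight v u A 1 := by
  refine I.keyWeight_four hc {u, v} h ?_ h₁ h₂
  intro i j hij
  rw [labelKey_lt, labelKey_lt]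
  simp only [testLabel, Set.mem_insert_iff, Set.mem_singleton_iff] at hij ⊢
  split_ifs <;> simp_all

/-- An irrelevant variable can be moved to the end without changing the weight. -/
theorem keyWeight_update_of_not_relevant (hc : c ≤ 3) {v : Fin I.n} (hv : ¬ I.Relevant v)
    (κ : Fin I.n → ℕ) (hκ : Function.Injective κ) (b : ℕ) (hb : ∀ i, κ i < b) :
    I.keyWeight κ = I.keyWeight (Function.update κ v b) := by
  -- Induction on the number of variables behind `v`.
  obtain ⟨m, hm⟩ : ∃ m, (Finset.univ.filter fun i => κ v < κ i).card = m := ⟨_, rfl⟩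
  induction m using Nat.strong_induction_on generalizing κ with
  | _ m ih =>
    by_cases hne : (Finset.univ.filter fun i => κ v < κ i).Nonempty
    · obtain ⟨u, hu, hmin⟩ := Finset.exists_min_image _ κ hne
      have hvu : κ v < κ u := by simpa using hu
      have hmin' : ∀ i, κ v < κ i → κ u ≤ κ i := fun i hi => hmin i (by simpa using hi)
      have huv : u ≠ v := by rintro rfl; exact lt_irrefl _ hvu
      -- Exchange `v` with its successor `u`.
      set κ' : Fin I.n → ℕ := fun i => κ (Equiv.swap u v i) with hκ'
      have hκ'u : κ' u = κ v := by simp [hκ']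
      have hκ'v : κ' v = κ u := by simp [hκ']
      have hκ'o : ∀ i, i ≠ u → i ≠ v → κ' i = κ i := by
        intro i h1 h2
        simp [hκ', Equiv.swap_apply_of_ne_of_ne h1 h2]
      have hcmp : ∀ i, i ≠ u → i ≠ v → (κ i < κ v ∧ κ i < κ u) ∨ (κ v < κ i ∧ κ u < κ i) := by
        intro i h1 h2
        rcases lt_trichotomy (κ i) (κ v) with h | h | h
        · exact Or.inl ⟨h, h.trans hvu⟩
        · exact absurd (hκ h) h2
        · exact Or.inr ⟨h, lt_of_le_of_ne (hmin' i h) fun h' => h1 (hκ h').symm⟩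
      have hlab : ∀ t, testLabel v u (Finset.univ.filter fun i => κ u < κ i) t v = t ∧
          testLabel v u (Finset.univ.filter fun i => κ u < κ i) t u = 2 ∧
          ∀ i, i ≠ u → i ≠ v →
          (κ i < κ v ∧ κ i < κ u ∧
            testLabel v u (Finset.univ.filter fun i => κ u < κ i) t i = 0) ∨
          (κ v < κ i ∧ κ u < κ i ∧
            testLabel v u (Finset.univ.filter fun i => κ u < κ i) t i = 4) := by
        intro t
        refine ⟨by simp [testLabel], by simp [testLabel, huv], fun i h1 h2 => ?_⟩
        rcases hcmp i h1 h2 with h | h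
        · exact Or.inl ⟨h.1, h.2, by simp [testLabel, h1, h2, h.2.le]⟩
        · exact Or.inr ⟨h.1, h.2, by simp [testLabel, h1, h2, h.2]⟩
      have hκ'inj : Function.Injective κ' := hκ.comp (Equiv.swap u v).injective
      have e1 : I.keyWeight κ = I.keyWeight κ' := by
        have h1 := I.keyWeight_eq_test hc κ κ' u v (Finset.univ.filter fun i => κ u < κ i) ?_ ?_ ?_
        · have h2 := I.testWeight_eq_of_not_relevant hc hv u huv
            (Finset.univ.filter fun i => κ u < κ i)
          omega
        · intro i j hij
          simp only [Set.mem_insert_iff, Set.mem_singleton_iff] at hij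
          by_cases hiu : i = u
          · subst hiu
            by_cases hjv : j = v
            · simp [hjv] at hij
            by_cases hji : j = i
            · simp [hji]
            rw [hκ'u, hκ'o j hji hjv]
            have := hcmp j hji hjv
            omega
          · by_cases hiv : i = v
            · subst hiv
              by_cases hju : j = u
              · simp [hju] at hij
              by_cases hji : j = i
              · simp [hji]
              rw [hκ'v, hκ'o j hju hji]
              have := hcmp j hju hji
              omega
            · rw [hκ'o i hiu hiv]
              have h3 := hcmp i hiu hiv
              by_cases hju : j = u
              · rw [hju, hκ'u]; omega
              · by_cases hjv : j = v
                · rw [hjv, hκ'v]; omega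
                · rw [hκ'o j hju hjv]
        · intro i j hij
          rw [labelKey_lt]
          simp only [Set.mem_compl_iff, Set.mem_insert_iff, Set.mem_singleton_iff] at hij
          have hl := hlab 1
          generalize testLabel v u _ 1 = L at hl
          obtain ⟨hLv, hLu, hL⟩ := hl
          have h3 := hL i
          have h4 := hL j
          by_cases hiu : i = u
          · subst hiu
            by_cases hju : j = i
            · simp [hju]
            by_cases hjv : j = v
            · subst hjv; omega
            · have := h4 hju hjv; omega
          · by_cases hiv : i = v
            · subst hiv
              by_cases hji : j = i
              · simp [hji]
              by_cases hju : j = u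
              · subst hju; omega
              · have := h4 hju hji; omega
            · have h3 := h3 hiu hiv
              by_cases hju : j = u
              · subst hju; omega
              · by_cases hjv : j = v
                · subst hjv; omega
                · exact absurd ⟨by simp [hiu, hiv], by simp [hju, hjv]⟩ hij
        · intro i j hij
          rw [labelKey_lt]
          simp only [Set.mem_compl_iff, Set.mem_insert_iff, Set.mem_singleton_iff] at hij
          have hl := hlab 3
          generalize testLabel v u _ 3 = L at hl
          obtain ⟨hLv, hLu, hL⟩ := hl
          have h3 := hL i
          have h4 := hL j
          have h5 := hκ'o i
          have h6 := hκ'o j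
          clear_value κ'
          by_cases hiu : i = u
          · subst hiu
            by_cases hju : j = i
            · simp [hju]
            by_cases hjv : j = v
            · subst hjv; omega
            · have := h4 hju hjv; have := h6 hju hjv; omega
          · by_cases hiv : i = v
            · subst hiv
              by_cases hji : j = i
              · simp [hji]
              by_cases hju : j = u
              · subst hju; omega
              · have := h4 hju hji; have := h6 hju hji; omega
            · have h3 := h3 hiu hiv
              have h5 := h5 hiu hiv
              by_cases hju : j = u
              · subst hju; omega
              · by_cases hjv : j = v
                · subst hjv; omega
                · exact absurd ⟨by simp [hiu, hiv], by simp [hju, hjv]⟩ hij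
      rw [e1]
      have e2 : I.keyWeight κ' = I.keyWeight (Function.update κ' v b) := by
        refine ih _ ?_ κ' hκ'inj (fun i => hb _) rfl
        rw [← hm]
        refine Finset.card_lt_card ⟨?_, ?_⟩
        · intro i hi
          simp only [Finset.mem_filter, Finset.mem_univ, true_and] at hi ⊢
          rw [hκ'v] at hi
          by_cases hiu : i = u
          · rw [hiu]; exact hvu
          · by_cases hiv : i = v
            · rw [hiv, hκ'v] at hi
              exact absurd hi (lt_irrefl _)
            · rw [hκ'o i hiu hiv] at hi
              omega
        · intro hsub
          have := hsub hu
          simp only [Finset.mem_filter, Finset.mem_univ, true_and, hκ'u, hκ'v] at this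
          omega
      rw [e2]
      refine I.keyWeight_congr fun i j => ?_
      have h3 := hcmp i
      have h4 := hcmp j
      have h5 := hκ'o i
      have h6 := hκ'o j
      have h7 := hb i
      have h8 := hb j
      have h9 := hb u
      have h10 := hb v
      clear hκ' hκ'o hκ'inj hcmp hmin' hb e1 e2 ih hlab
      clear_value κ'
      simp only [Function.update_apply]
      by_cases hiu : i = u <;> by_cases hiv : i = v <;> by_cases hju : j = u <;>
        by_cases hjv : j = v <;> simp_all <;> omega
    · rw [Finset.not_nonempty_iff_eq_empty] at hne
      refine I.keyWeight_congr fun i j => ?_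
      have hle : ∀ i, i ≠ v → κ i < κ v := by
        intro i hi
        have : ¬ κ v < κ i := fun h => by
          have : i ∈ Finset.univ.filter fun i => κ v < κ i := by simpa using h
          simp [hne] at this
        exact lt_of_le_of_ne (not_lt.1 this) fun h => hi (hκ h)
      simp only [Function.update_apply]
      have h1 := hle i
      have h2 := hle j
      have h3 := hb i
      have h4 := hb j
      clear hle hb ih
      split_ifs <;> simp_all <;> omega

/-- The weight depends only on the order of the relevant variables. -/
theorem keyWeight_eq_of_agreeOff (hc : c ≤ 3) (Z : Finset (Fin I.n))
    (hZ : ∀ v ∈ Z, ¬ I.Relevant v) : ∀ κ κ' : Fin I.n → ℕ, Function.Injective κ →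
    Function.Injective κ' → (∀ i j, i ∉ Z → j ∉ Z → (κ i < κ j ↔ κ' i < κ' j)) →
    I.keyWeight κ = I.keyWeight κ' := by
  induction Z using Finset.induction_on with
  | empty => exact fun κ κ' _ _ h => I.keyWeight_congr fun i j => h i j (by simp) (by simp)
  | insert z Z hz ih =>
    intro κ κ' hκ hκ' h
    have hbd : ∀ κ : Fin I.n → ℕ, ∃ b, ∀ i, κ i < b := fun κ =>
      ⟨Finset.univ.sup κ + 1, fun i => Nat.lt_succ_of_le (Finset.le_sup (Finset.mem_univ i))⟩
    obtain ⟨b, hb⟩ := hbd κ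
    obtain ⟨b', hb'⟩ := hbd κ'
    have hinj : ∀ (κ : Fin I.n → ℕ) (b : ℕ), Function.Injective κ → (∀ i, κ i < b) →
        Function.Injective (Function.update κ z b) := by
      intro κ b hκ hb i j hij
      simp only [Function.update_apply] at hij
      have h1 := hb i
      have h2 := hb j
      split_ifs at hij with h3 h4 h4
      · rw [h3, h4]
      · omega
      · omega
      · exact hκ hij
    rw [I.keyWeight_update_of_not_relevant hc (hZ z (by simp)) κ hκ b hb,
      I.keyWeight_update_of_not_relevant hc (hZ z (by simp)) κ' hκ' b' hb']
    refine ih (fun v hv => hZ v (by simp [hv])) _ _ (hinj κ b hκ hb) (hinj κ' b' hκ' hb') ?_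
    intro i j hi hj
    have h1 := h i j
    have h2 := hb i
    have h3 := hb j
    have h4 := hb' i
    have h5 := hb' j
    simp only [Finset.mem_insert, not_or] at h1
    simp only [Function.update_apply]
    clear hb hb' h ih hbd
    split_ifs <;> simp_all
    all_goals omega

/-- Whatever the order that breaks ties, some change of the label of a relevant variable alone
changes the weight. -/
theorem exists_label_of_relevant (hc : c ≤ 3) {v : Fin I.n} (hv : I.Relevant v)
    (ψ : Equiv.Perm (Fin I.n)) : ∃ g g' : Fin I.n → ℕ, (∀ i, g i < 8) ∧ (∀ i, g' i < 8) ∧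
      (∀ i, i ≠ v → g i = g' i) ∧ I.keyWeight (labelKey g ψ) ≠ I.keyWeight (labelKey g' ψ) := by
  obtain ⟨u, x, hne⟩ := hv
  refine ⟨testLabel v u {x} 1, testLabel v u {x} 3, ?_, ?_, ?_, ?_⟩
  · intro i; unfold testLabel; split_ifs <;> norm_num
  · intro i; unfold testLabel; split_ifs <;> norm_num
  · intro i hi; simp [testLabel, hi]
  · have h := I.keyWeight_eq_test hc (labelKey (testLabel v u {x} 1) ψ)
      (labelKey (testLabel v u {x} 3) ψ) u v {x} ?_ ?_ ?_
    · omega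
    · intro i j hij
      rw [labelKey_lt, labelKey_lt]
      simp only [testLabel, Set.mem_insert_iff, Set.mem_singleton_iff] at hij ⊢
      split_ifs <;> simp_all
    all_goals
      intro i j hij
      rw [labelKey_lt, labelKey_lt]
      by_cases hij' : i = j
      · simp [hij']
      simp only [testLabel, Set.mem_compl_iff, Set.mem_insert_iff, Set.mem_singleton_iff] at hij ⊢
      split_ifs <;> simp_all

end Instance

end PermCSP

/-! ### The mean -/

namespace PermCSP

variable {c n : ℕ}

theorem perm_eq_of_lt_iff {m : ℕ} {π π' : Equiv.Perm (Fin m)}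
    (h : ∀ i j, π i < π j ↔ π' i < π' j) : π = π' := by
  have h1 : StrictMono (π' ∘ π.symm) := fun i j hij => by
    simpa using (h (π.symm i) (π.symm j)).1 (by simpa using hij)
  have h2 : π' ∘ π.symm = id := by
    have := Subsingleton.elim (h1.orderIsoOfSurjective _
      (π'.surjective.comp π.symm.surjective)) (OrderIso.refl (Fin m))
    exact congrArg (fun e : Fin m ≃o Fin m => (e : Fin m → Fin m)) this
  ext i
  have := congrFun h2 (π i)
  simp at this
  rw [this]

/-- The number of local permutations that the predicate of a constraint accepts. -/
def Constraint.accepted (C : Constraint c n) : ℕ :=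
  (Finset.univ.filter fun π => C.pred π = true).card

/-- Over any family of orders that is invariant under renaming the variables, the local
permutation of a constraint is uniformly distributed. -/
theorem Constraint.sum_gain (C : Constraint c n) {X : Type*} [Fintype X] (κ : X → Fin n → ℕ)
    (hκ : ∀ x, Function.Injective (κ x)) (act : Equiv.Perm (Fin n) → X ≃ X)
    (hact : ∀ τ x, κ (act τ x) = κ x ∘ τ) :
    (∑ x, C.gain (κ x)) * C.arity.factorial = Fintype.card X * (C.weight * C.accepted) := by
  classical
  choose pat hpat using fun x => exists_perm_of_injective (κ x ∘ C.scope)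
    ((hκ x).comp C.scope.injective)
  have hgain : ∀ x (τ : Equiv.Perm (Fin C.arity)),
      C.gain (κ (act (τ.viaFintypeEmbedding C.scope) x)) =
        if C.pred (pat x * τ) = true then C.weight else 0 := by
    intro x τ
    unfold Constraint.gain
    refine if_congr ?_ rfl rfl
    have hord : ∀ i j, (pat x * τ) i < (pat x * τ) j ↔
        κ (act (τ.viaFintypeEmbedding C.scope) x) (C.scope i) <
          κ (act (τ.viaFintypeEmbedding C.scope) x) (C.scope j) := by
      intro i j
      rw [hact, Equiv.Perm.mul_apply, Equiv.Perm.mul_apply, hpat]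
      simp only [Function.comp_apply, Equiv.Perm.viaFintypeEmbedding_apply_image]
    constructor
    · rintro ⟨π, hπ, hp⟩
      have : π = pat x * τ := perm_eq_of_lt_iff fun i j => by rw [hπ, hord]
      rwa [← this]
    · exact fun hp => ⟨_, hord, hp⟩
  have h1 : ∑ x, ∑ τ : Equiv.Perm (Fin C.arity),
      C.gain (κ (act (τ.viaFintypeEmbedding C.scope) x)) =
        Fintype.card X * (C.weight * C.accepted) := by
    have : ∀ x, ∑ τ : Equiv.Perm (Fin C.arity),
        C.gain (κ (act (τ.viaFintypeEmbedding C.scope) x)) = C.weight * C.accepted := by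
      intro x
      simp_rw [hgain]
      rw [Fintype.sum_equiv (Equiv.mulLeft (pat x))
        (fun τ => if C.pred (pat x * τ) = true then C.weight else 0)
        (fun π => if C.pred π = true then C.weight else 0) fun τ => rfl,
        ← Finset.sum_filter, Finset.sum_const, smul_eq_mul, mul_comm]
      rfl
    simp [this]
  rw [Finset.sum_comm] at h1
  have h2 : ∀ τ : Equiv.Perm (Fin C.arity),
      ∑ x, C.gain (κ (act (τ.viaFintypeEmbedding C.scope) x)) = ∑ x, C.gain (κ x) :=
    fun τ => Fintype.sum_equiv (act _) _ _ fun x => rfl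
  simp only [h2, Finset.sum_const, Finset.card_univ, Fintype.card_perm, Fintype.card_fin,
    smul_eq_mul] at h1
  rw [← h1, mul_comm]

namespace Instance

/-- The mean weight of an assignment. -/
def mean (I : Instance c) : ℚ :=
  (I.constraints.map fun C => (C.weight * C.accepted : ℚ) / C.arity.factorial).sum

theorem sum_keyWeight (I : Instance c) {X : Type*} [Fintype X] (κ : X → Fin I.n → ℕ)
    (hκ : ∀ x, Function.Injective (κ x)) (act : Equiv.Perm (Fin I.n) → X ≃ X)
    (hact : ∀ τ x, κ (act τ x) = κ x ∘ τ) :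
    ((∑ x, I.keyWeight (κ x) : ℕ) : ℚ) = Fintype.card X * I.mean := by
  unfold keyWeight mean
  induction I.constraints with
  | nil => simp
  | cons C l ih =>
    simp only [List.map_cons, List.sum_cons, Finset.sum_add_distrib]
    push_cast at ih ⊢
    rw [ih, mul_add]
    congr 1
    have h := C.sum_gain κ hκ act hact
    have h' : ((∑ x, C.gain (κ x) : ℕ) : ℚ) * C.arity.factorial =
        Fintype.card X * (C.weight * C.accepted) := by exact_mod_cast h
    have h0 : (C.arity.factorial : ℚ) ≠ 0 := by positivity
    rw [← mul_div_assoc, eq_div_iff h0, ← h']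
    push_cast
    rfl

theorem weight_le_totalWeight (I : Instance c) (φ : Equiv.Perm (Fin I.n)) :
    I.weight φ ≤ I.totalWeight := by
  unfold weight totalWeight
  refine List.sum_le_sum fun C _ => ?_
  split_ifs <;> simp

theorem rho_mul_totalWeight (I : Instance c) : I.rho * I.totalWeight = I.mean := by
  have h := I.sum_keyWeight (X := Equiv.Perm (Fin I.n)) (fun φ i => φ i)
    (fun φ i j h => φ.injective (Fin.ext h)) (fun τ => Equiv.mulRight τ) (fun τ φ => rfl)
  simp only [← weight_eq_keyWeight] at h
  have h0 : (Fintype.card (Equiv.Perm (Fin I.n)) : ℚ) ≠ 0 := by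
    exact_mod_cast Fintype.card_ne_zero
  unfold rho
  rw [← Finset.sum_div]
  by_cases hW : (I.totalWeight : ℚ) = 0
  · rw [hW]
    have hW' : I.totalWeight = 0 := by exact_mod_cast hW
    have hz : ∀ φ, I.weight φ = 0 := fun φ => by
      have := I.weight_le_totalWeight φ
      omega
    simp only [hz, Finset.sum_const_zero, Nat.cast_zero] at h
    have := (mul_eq_zero.1 h.symm).resolve_left h0
    simp [this]
  · have h' : ∑ φ : Equiv.Perm (Fin I.n), (I.weight φ : ℚ) =
        Fintype.card (Equiv.Perm (Fin I.n)) * I.mean := by exact_mod_cast h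
    rw [h']
    field_simp

end Instance

end PermCSP

/-! ### Relevant variables raise the maximum above the mean -/

namespace Walsh

open Finset

/-- The Fourier expansion of a function of the coordinates in `S`. -/
theorem exists_poly_of_junta {U : Type*} [Fintype U] [DecidableEq U] (S : Finset U)
    (h : (U → ℤˣ) → ℤ) (hS : ∀ x y, (∀ u ∈ S, x u = y u) → h x = h y) :
    ∃ c : Finset U → ℤ, (∀ T, c T ≠ 0 → T ⊆ S) ∧ ∀ x, 2 ^ S.card * h x = poly c x := by
  refine ⟨fun T => if T ⊆ S then ∑ Z ∈ S.powerset, h (flip Z) * chi T (flip Z) else 0,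
    fun T hT => by by_contra hc; simp [hc] at hT, fun x => ?_⟩
  have h1 : poly (fun T => if T ⊆ S then ∑ Z ∈ S.powerset, h (flip Z) * chi T (flip Z) else 0) x =
      ∑ Z ∈ S.powerset, h (flip Z) * ∏ u ∈ S, (1 + ((flip Z * x) u : ℤ)) := by
    simp_rw [Finset.prod_one_add, Finset.mul_sum]
    rw [Finset.sum_comm, poly]
    simp_rw [ite_mul, zero_mul]
    rw [← Finset.sum_filter]
    have : (univ.filter fun T => T ⊆ S) = S.powerset := by ext; simp
    rw [this]
    refine Finset.sum_congr rfl fun T _ => ?_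
    rw [Finset.sum_mul]
    refine Finset.sum_congr rfl fun Z _ => ?_
    rw [mul_assoc, ← chi_mul_point]
    rfl
  rw [h1, Finset.sum_eq_single (S.filter fun u => x u = -1)]
  · rw [hS (flip (S.filter fun u => x u = -1)) x, Finset.prod_congr rfl (g := fun _ => (2 : ℤ))]
    · simp [mul_comm]
    · intro u hu
      rcases Int.units_eq_one_or (x u) with h | h <;> simp [flip, hu, h]
    · intro u hu
      rcases Int.units_eq_one_or (x u) with h | h <;> simp [flip, hu, h]
  · intro Z hZ hne
    rw [mem_powerset] at hZ
    have : ∃ u ∈ S, ¬ (u ∈ Z ↔ x u = -1) := by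
      by_contra! hc
      refine hne (Finset.ext fun u => ?_)
      rw [mem_filter]
      exact ⟨fun hu => ⟨hZ hu, (hc u (hZ hu)).1 hu⟩, fun hu => (hc u hu.1).2 hu.2⟩
    obtain ⟨u, hu, hux⟩ := this
    rw [Finset.prod_eq_zero hu, mul_zero]
    rcases Int.units_eq_one_or (x u) with h | h <;> by_cases h' : u ∈ Z <;>
      simp [flip, h, h'] at hux ⊢
  · intro h
    exact absurd (mem_powerset.2 (Finset.filter_subset _ _)) h

theorem poly_add {U : Type*} [Fintype U] (c c' : Finset U → ℤ) (x : U → ℤˣ) :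
    poly (c + c') x = poly c x + poly c' x := by
  simp [poly, add_mul, Finset.sum_add_distrib]

theorem poly_smul {U : Type*} [Fintype U] (a : ℤ) (c : Finset U → ℤ) (x : U → ℤˣ) :
    poly (a • c) x = a * poly c x := by
  simp [poly, Finset.mul_sum, mul_assoc]

theorem exists_mem_rel {U : Type*} [Fintype U] [DecidableEq U] (c : Finset U → ℤ) (x y : U → ℤˣ)
    (h : poly c x ≠ poly c y) : ∃ u ∈ rel c, x u ≠ y u := by
  by_contra! hc
  refine h (Finset.sum_congr rfl fun T _ => ?_)
  by_cases hT : c T = 0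
  · simp [hT]
  · congr 1
    refine Finset.prod_congr rfl fun u hu => ?_
    rw [hc u (by simp only [rel, mem_filter, mem_univ, true_and]; exact ⟨T, hu, hT⟩)]

end Walsh

namespace PermCSP

open Walsh

variable {c n : ℕ}

/-- The label below `8` that is written in three bits. -/
def bitLabel (x : Fin n × Fin 3 → ℤˣ) : Fin n → ℕ := fun i =>
  (if x (i, 0) = -1 then 1 else 0) + 2 * (if x (i, 1) = -1 then 1 else 0) +
    4 * (if x (i, 2) = -1 then 1 else 0)

/-- The bits of labels below `8`. -/
def labelBits (g : Fin n → ℕ) : Fin n × Fin 3 → ℤˣ := fun p =>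
  if (g p.1).testBit p.2 then -1 else 1

theorem bitLabel_labelBits (g : Fin n → ℕ) (hg : ∀ i, g i < 8) : bitLabel (labelBits g) = g := by
  funext i
  have key : ∀ a < 8, (if (if Nat.testBit a 0 then (-1 : ℤˣ) else 1) = -1 then 1 else 0) +
      2 * (if (if Nat.testBit a 1 then (-1 : ℤˣ) else 1) = -1 then 1 else 0) +
      4 * (if (if Nat.testBit a 2 then (-1 : ℤˣ) else 1) = -1 then 1 else 0) = a := by
    decide
  exact key (g i) (hg i)

/-- For a fixed order that breaks ties, the weight is a polynomial of degree at most `9` in the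
bits of the labels. -/
theorem Instance.exists_poly (I : Instance c) (hc : c ≤ 3) (ψ : Equiv.Perm (Fin I.n)) :
    ∃ e : Finset (Fin I.n × Fin 3) → ℤ, (∀ T, e T ≠ 0 → T.card ≤ 9) ∧
      ∀ x, 2 ^ 9 * (I.keyWeight (labelKey (bitLabel x) ψ) : ℤ) = poly e x := by
  unfold Instance.keyWeight
  induction I.constraints with
  | nil => exact ⟨0, by simp, by simp [poly]⟩
  | cons C l ih =>
    obtain ⟨e, he, hex⟩ := ih
    set S : Finset (Fin I.n × Fin 3) := (Finset.univ.map C.scope) ×ˢ Finset.univ with hS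
    have hScard : S.card = C.arity * 3 := by simp [hS]
    have hS9 : S.card ≤ 9 := by
      have := C.arity_le
      omega
    obtain ⟨e', he', hex'⟩ := exists_poly_of_junta S
      (fun x => (C.gain (labelKey (bitLabel x) ψ) : ℤ)) (by
        intro x y hxy
        simp only [Nat.cast_inj]
        have : ∀ i, bitLabel x (C.scope i) = bitLabel y (C.scope i) := by
          intro i
          have h : ∀ k, x (C.scope i, k) = y (C.scope i, k) := fun k => hxy _ (by simp [hS])
          simp only [bitLabel, h]
        exact C.gain_congr fun i j => by rw [labelKey_lt, labelKey_lt, this, this])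
    refine ⟨(2 : ℤ) ^ (9 - S.card) • e' + e, ?_, ?_⟩
    · intro T hT
      by_cases h : e T = 0
      · have : e' T ≠ 0 := by
          rintro h'
          simp [h, h'] at hT
        exact (Finset.card_le_card (he' T this)).trans hS9
      · exact he T h
    · intro x
      rw [poly_add, poly_smul, ← hex, ← hex', ← mul_assoc, ← pow_add, Nat.sub_add_cancel hS9]
      simp [mul_add]

/-- The maximum exceeds the mean by an amount linear in the number of relevant variables. -/
theorem exists_card_relevant_le : ∃ K : ℕ, ∀ c ≤ 3, ∀ (I : Instance c) (R : Finset (Fin I.n)),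
    (∀ v ∈ R, I.Relevant v) → ∃ φ, (R.card : ℚ) ≤ K * (I.weight φ - I.mean) := by
  classical
  obtain ⟨K, hK⟩ := exists_card_rel_le 9
  refine ⟨K * 2 ^ 9, fun c hc I R hR => ?_⟩
  obtain ⟨φ, -, hφ⟩ := Finset.exists_max_image (Finset.univ : Finset (Equiv.Perm (Fin I.n)))
    I.weight ⟨1, Finset.mem_univ _⟩
  refine ⟨φ, ?_⟩
  have hmax : ∀ κ : Fin I.n → ℕ, Function.Injective κ → I.keyWeight κ ≤ I.weight φ := by
    intro κ hκ
    obtain ⟨φ', hφ'⟩ := exists_perm_of_injective κ hκ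
    rw [← I.keyWeight_congr (κ := fun i => φ' i) fun i j => by rw [← hφ']; rfl,
      ← I.weight_eq_keyWeight]
    exact hφ φ' (Finset.mem_univ _)
  set N := 2 ^ Fintype.card (Fin I.n × Fin 3) with hN
  -- For a fixed order that breaks ties, the maximum exceeds the mean over the labels.
  have hψ : ∀ ψ : Equiv.Perm (Fin I.n), (N : ℤ) * R.card ≤
      K * 2 ^ 9 * (N * I.weight φ - ∑ x, (I.keyWeight (labelKey (bitLabel x) ψ) : ℤ)) := by
    intro ψ
    obtain ⟨e, he, hex⟩ := I.exists_poly hc ψ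
    obtain ⟨x, hx⟩ := hK _ e he
    have h1 : R.card ≤ (rel e).card := by
      have : R ⊆ (rel e).image Prod.fst := by
        intro v hv
        obtain ⟨g, g', hg, hg', hgg', hne⟩ := I.exists_label_of_relevant hc (hR v hv) ψ
        obtain ⟨⟨u, k⟩, hu, hu'⟩ := exists_mem_rel e (labelBits g) (labelBits g') (by
          rw [← hex, ← hex, bitLabel_labelBits g hg, bitLabel_labelBits g' hg']
          intro h
          exact hne (by exact_mod_cast mul_left_cancel₀ (by norm_num) h))
        have : u = v := by
          by_contra huv
          exact hu' (by simp [labelBits, hgg' u huv])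
        exact Finset.mem_image.2 ⟨(u, k), hu, this⟩
      exact (Finset.card_le_card this).trans Finset.card_image_le
    have h2 := sum_poly e
    simp_rw [← hex] at h2
    rw [← Finset.mul_sum] at h2
    rw [← hex] at hx
    have h3 : (I.keyWeight (labelKey (bitLabel x) ψ) : ℤ) ≤ I.weight φ := by
      exact_mod_cast hmax _ (labelKey_injective _ _)
    have h4 : (R.card : ℤ) ≤ (rel e).card := by exact_mod_cast h1
    have h5 : (R.card : ℤ) ≤ K * (2 ^ 9 * I.weight φ - e ∅) :=
      h4.trans (hx.trans (mul_le_mul_of_nonneg_left (by linarith) (by positivity)))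
    have h6 := mul_le_mul_of_nonneg_left h5 (by positivity : (0 : ℤ) ≤ N)
    have h7 : (N : ℤ) * e ∅ = 2 ^ 9 * ∑ x, (I.keyWeight (labelKey (bitLabel x) ψ) : ℤ) := by
      rw [h2, hN]; push_cast; ring
    calc (N : ℤ) * R.card ≤ N * (K * (2 ^ 9 * I.weight φ - e ∅)) := h6
      _ = K * (2 ^ 9 * (N * I.weight φ) - N * e ∅) := by ring
      _ = _ := by rw [h7]; ring
  have hsum := Finset.sum_le_sum fun ψ (_ : ψ ∈ (Finset.univ : Finset (Equiv.Perm (Fin I.n)))) =>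
    hψ ψ
  rw [← Finset.mul_sum, ← Finset.mul_sum, Finset.sum_sub_distrib, Finset.sum_const,
    Finset.sum_const, Finset.sum_comm] at hsum
  have hmean := I.sum_keyWeight (X := (Fin I.n × Fin 3 → ℤˣ) × Equiv.Perm (Fin I.n))
    (fun p => labelKey (bitLabel p.1) p.2) (fun p => labelKey_injective _ _)
    (fun τ => Equiv.prodCongr
      (Equiv.arrowCongr (Equiv.prodCongr τ.symm (Equiv.refl _)) (Equiv.refl _)) (Equiv.mulRight τ))
    (fun τ p => by
      funext i
      simp [labelKey, bitLabel])
  rw [Fintype.sum_prod_type, Fintype.card_prod] at hmean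
  have hN' : Fintype.card (Fin I.n × Fin 3 → ℤˣ) = N := by
    rw [Fintype.card_fun, Fintype.card_units_int]
  rw [hN'] at hmean
  set P := Fintype.card (Equiv.Perm (Fin I.n)) with hP
  have hsum' : (P : ℚ) * (N * R.card) ≤ K * 2 ^ 9 * (P * (N * I.weight φ) -
      ((∑ x, ∑ ψ, I.keyWeight (labelKey (bitLabel x) ψ) : ℕ) : ℚ)) := by
    have : ((Finset.univ : Finset (Equiv.Perm (Fin I.n))).card) = P := by
      rw [hP, Finset.card_univ]
    rw [this] at hsum
    simp only [nsmul_eq_mul] at hsum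
    have hsum2 : (P : ℤ) * (N * R.card) ≤ K * 2 ^ 9 * (P * (N * I.weight φ) -
        ((∑ x, ∑ ψ, I.keyWeight (labelKey (bitLabel x) ψ) : ℕ) : ℤ)) := by
      push_cast
      linarith
    exact_mod_cast hsum2
  have hpos : (0 : ℚ) < P * N := by
    have h1 : 0 < P := Fintype.card_pos
    have h2 : 0 < N := by positivity
    exact_mod_cast Nat.mul_pos h1 h2
  refine le_of_mul_le_mul_left ?_ hpos
  calc (P * N : ℚ) * R.card = P * (N * R.card) := by ring
    _ ≤ _ := hsum'
    _ = _ := by rw [hmean]; push_cast; ring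

end PermCSP

/-! ### Dynamic programming over sets of variables -/

namespace PermCSP

namespace Instance

variable {c : ℕ} (I : Instance c)

/-- The keys that put the variables of `S` at the end, in the order `φ`, and the others in front,
in their natural order. -/
def setKey {n : ℕ} (S : Finset (Fin n)) (φ : Equiv.Perm (Fin n)) : Fin n → ℕ :=
  fun i => if i ∈ S then n + φ i else i

/-- The maximal weight of an order that puts the variables of `S` at the end and the others in
front, in their natural order. -/
noncomputable def maxWeight (S : Finset (Fin I.n)) : ℕ :=
  Finset.univ.sup fun φ : Equiv.Perm (Fin I.n) => I.keyWeight (setKey S φ)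

/-- The labels `0` (not in `S`), `t` (for `v`) and `2` (in `S`, but not `v`). -/
def stepLabel {n : ℕ} (S : Finset (Fin n)) (v : Fin n) (t : ℕ) : Fin n → ℕ :=
  fun i => if i = v then t else if i ∈ S then 2 else 0

theorem setKey_injective {n : ℕ} (S : Finset (Fin n)) (φ : Equiv.Perm (Fin n)) :
    Function.Injective (setKey S φ) := by
  intro i j h
  simp only [setKey] at h
  have := i.isLt
  have := j.isLt
  split_ifs at h
  · exact φ.injective (Fin.ext (by omega))
  · omega
  · omega
  · exact Fin.ext h

theorem le_maxWeight (S : Finset (Fin I.n)) (φ : Equiv.Perm (Fin I.n)) :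
    I.keyWeight (setKey S φ) ≤ I.maxWeight S :=
  Finset.le_sup (f := fun φ : Equiv.Perm (Fin I.n) => I.keyWeight (setKey S φ))
    (Finset.mem_univ φ)

theorem exists_eq_maxWeight (S : Finset (Fin I.n)) :
    ∃ φ, I.keyWeight (setKey S φ) = I.maxWeight S := by
  obtain ⟨φ, -, h⟩ := Finset.exists_mem_eq_sup (Finset.univ : Finset (Equiv.Perm (Fin I.n)))
    ⟨1, Finset.mem_univ _⟩ (fun φ => I.keyWeight (setKey S φ))
  exact ⟨φ, h.symm⟩

theorem maxWeight_empty : I.maxWeight ∅ = I.keyWeight (labelKey (fun _ => 0) 1) := by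
  obtain ⟨φ, h⟩ := I.exists_eq_maxWeight ∅
  rw [← h]
  refine I.keyWeight_congr fun i j => ?_
  rw [labelKey_lt]
  simp [setKey]

/-- If `v` is the first variable of `S`, then the gain from moving `v` in front of the rest of `S`
depends only on the set `S`. -/
theorem keyWeight_setKey_erase (hc : c ≤ 3) {S : Finset (Fin I.n)} {v : Fin I.n} (hv : v ∈ S)
    (φ : Equiv.Perm (Fin I.n)) (hφ : ∀ i ∈ S, i ≠ v → φ v < φ i) :
    I.keyWeight (setKey S φ) + I.keyWeight (labelKey (stepLabel S v 0) 1) =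
      I.keyWeight (setKey (S.erase v) φ) + I.keyWeight (labelKey (stepLabel S v 1) 1) := by
  refine I.keyWeight_four hc {i | i ∉ S.erase v} ?_ ?_ ?_ ?_
  all_goals
    intro i j hij
    try rw [labelKey_lt]
    try rw [labelKey_lt]
    have hi := i.isLt
    have hj := j.isLt
    have h1 := hφ i
    have h2 := hφ j
    rw [Fin.lt_def] at h1 h2
    simp only [Finset.mem_erase, Set.mem_ofPred_eq, Set.mem_compl_iff, not_and_or, not_not] at hij
    simp only [setKey, stepLabel, Finset.mem_erase, Equiv.Perm.one_apply]
    by_cases hiv : i = v <;> by_cases hjv : j = v <;> by_cases hiS : i ∈ S <;>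
      by_cases hjS : j ∈ S <;> simp [hiv, hjv, hiS, hjS, hv] at h1 h2 hij ⊢ <;> omega

theorem maxWeight_erase_le (hc : c ≤ 3) {S : Finset (Fin I.n)} {v : Fin I.n} (hv : v ∈ S) :
    I.maxWeight (S.erase v) + I.keyWeight (labelKey (stepLabel S v 1) 1) ≤
      I.maxWeight S + I.keyWeight (labelKey (stepLabel S v 0) 1) := by
  obtain ⟨φ, hφ⟩ := I.exists_eq_maxWeight (S.erase v)
  obtain ⟨φ', hφ'⟩ := exists_perm_of_injective (fun i => if i = v then 0 else (φ i : ℕ) + 1) (by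
    intro i j h
    simp only at h
    split_ifs at h with h1 h2 h2
    · rw [h1, h2]
    · exact φ.injective (Fin.ext (by omega)))
  have h1 := I.keyWeight_setKey_erase hc hv φ' (fun i _ hi => by rw [hφ']; simp [hi])
  have h2 : I.keyWeight (setKey (S.erase v) φ') = I.keyWeight (setKey (S.erase v) φ) := by
    refine I.keyWeight_congr fun i j => ?_
    have h3 := hφ' i j
    rw [Fin.lt_def] at h3
    have := i.isLt
    have := j.isLt
    simp only [setKey, Finset.mem_erase]
    by_cases hiv : i = v <;> by_cases hjv : j = v <;> by_cases hiS : i ∈ S <;>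
      by_cases hjS : j ∈ S <;> simp [hiv, hjv, hiS, hjS] at h3 ⊢ <;> omega
  have h3 := I.le_maxWeight S φ'
  omega

theorem exists_maxWeight_le (hc : c ≤ 3) {S : Finset (Fin I.n)} (hS : S.Nonempty) :
    ∃ v ∈ S, I.maxWeight S + I.keyWeight (labelKey (stepLabel S v 0) 1) ≤
      I.maxWeight (S.erase v) + I.keyWeight (labelKey (stepLabel S v 1) 1) := by
  obtain ⟨φ, hφ⟩ := I.exists_eq_maxWeight S
  obtain ⟨v, hv, hmin⟩ := Finset.exists_min_image S φ hS
  refine ⟨v, hv, ?_⟩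
  have h1 := I.keyWeight_setKey_erase hc hv φ
    (fun i hi hne => lt_of_le_of_ne (hmin i hi) fun h => hne (φ.injective h).symm)
  have h2 := I.le_maxWeight (S.erase v) φ
  omega

/-- All irrelevant variables may be put in front. -/
theorem weight_le_maxWeight (hc : c ≤ 3) (S : Finset (Fin I.n)) (hS : ∀ v ∉ S, ¬ I.Relevant v)
    (φ : Equiv.Perm (Fin I.n)) : I.weight φ ≤ I.maxWeight S := by
  refine le_trans (le_of_eq ?_) (I.le_maxWeight S φ)
  rw [weight_eq_keyWeight]
  refine I.keyWeight_eq_of_agreeOff hc (Finset.univ \ S) (fun v hv => hS v (by simpa using hv)) _ _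
    (fun i j h => φ.injective (Fin.ext h)) (setKey_injective S φ) fun i j hi hj => ?_
  have hi' : i ∈ S := by simpa using hi
  have hj' : j ∈ S := by simpa using hj
  simp [setKey, hi', hj']

theorem exists_weight_eq_maxWeight (S : Finset (Fin I.n)) : ∃ φ, I.weight φ = I.maxWeight S := by
  obtain ⟨φ, hφ⟩ := I.exists_eq_maxWeight S
  obtain ⟨φ', hφ'⟩ := exists_perm_of_injective (setKey S φ) (setKey_injective S φ)
  refine ⟨φ', ?_⟩
  rw [← hφ, weight_eq_keyWeight]
  exact I.keyWeight_congr fun i j => hφ' i j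

end Instance

end PermCSP

/-! ### Step counting for programs on bounded memory -/

namespace RAM

instance : Add Expr := ⟨Expr.add⟩
instance : Sub Expr := ⟨Expr.sub⟩
instance : Mul Expr := ⟨Expr.mul⟩
instance : Div Expr := ⟨Expr.div⟩
instance (k : ℕ) : OfNat Expr k := ⟨Expr.const k⟩

namespace Expr

variable (σ : Mem)

@[simp] theorem eval_add (e f : Expr) : (e + f).eval σ = e.eval σ + f.eval σ := rfl
@[simp] theorem eval_sub (e f : Expr) : (e - f).eval σ = e.eval σ - f.eval σ := rfl
@[simp] theorem eval_mul (e f : Expr) : (e * f).eval σ = e.eval σ * f.eval σ := rfl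
@[simp] theorem eval_div (e f : Expr) : (e / f).eval σ = e.eval σ / f.eval σ := rfl
@[simp] theorem eval_const (k : ℕ) : (const k).eval σ = k := rfl
@[simp] theorem eval_ofNat (k : ℕ) : (ofNat(k) : Expr).eval σ = OfNat.ofNat k := rfl
@[simp] theorem eval_read (a : ℕ) (e : Expr) : (read a e).eval σ = σ a (e.eval σ) := rfl

/-- A factor by which the bit length of the value of an expression can exceed the bit length of the
memory cells. -/
def growth : Expr → ℕ
  | const k => k.size
  | read _ _ => 1
  | add e f => e.growth + f.growth + 1
  | sub e _ => e.growth
  | mul e f => e.growth + f.growth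
  | div e _ => e.growth

/-- A factor by which the cost of an expression can exceed the bit length of the memory cells. -/
def unit : Expr → ℕ
  | const k => k.size + 1
  | read _ i => i.unit + i.growth + 2
  | add e f => e.unit + f.unit + e.growth + f.growth + 1
  | sub e f => e.unit + f.unit + e.growth + f.growth + 1
  | mul e f => e.unit + f.unit + e.growth + f.growth + 1
  | div e f => e.unit + f.unit + e.growth + f.growth + 1

theorem size_add_le (x y : ℕ) : (x + y).size ≤ x.size + y.size + 1 := by
  rw [Nat.size_le]
  have h1 := Nat.lt_size_self x
  have h2 := Nat.lt_size_self y
  have h3 := Nat.pow_le_pow_right (n := 2) (by norm_num) (Nat.le_add_right x.size y.size)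
  have h4 := Nat.pow_le_pow_right (n := 2) (by norm_num) (Nat.le_add_left y.size x.size)
  rw [pow_succ]
  omega

theorem size_mul_le (x y : ℕ) : (x * y).size ≤ x.size + y.size := by
  rw [Nat.size_le, pow_add]
  exact Nat.mul_lt_mul'' (Nat.lt_size_self x) (Nat.lt_size_self y)

variable {σ} {B : ℕ}

theorem size_eval_le (hσ : ∀ a i, σ a i < 2 ^ B) (e : Expr) :
    (e.eval σ).size ≤ e.growth * (B + 1) := by
  induction e with
  | const k => exact Nat.le_mul_of_pos_right _ (Nat.succ_pos _)
  | read a i _ =>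
    have := Nat.size_le.2 (hσ a (i.eval σ))
    simp only [eval_read, growth]
    omega
  | add e f he hf =>
    refine (size_add_le _ _).trans ?_
    simp only [growth, add_mul]
    omega
  | sub e f he _ => exact (Nat.size_le_size (Nat.sub_le _ _)).trans he
  | mul e f he hf =>
    refine (size_mul_le _ _).trans ?_
    simp only [growth, add_mul]
    omega
  | div e f he _ => exact (Nat.size_le_size (Nat.div_le_self _ _)).trans he

theorem cost_le (hσ : ∀ a i, σ a i < 2 ^ B) (e : Expr) : e.cost σ ≤ e.unit * (B + 1) := by
  induction e with
  | const k => exact Nat.le_mul_of_pos_right _ (Nat.succ_pos _)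
  | read a i hi =>
    have h1 := Nat.size_le.2 (hσ a (i.eval σ))
    have h2 := size_eval_le hσ i
    simp only [cost, unit, add_mul]
    omega
  | add e f he hf | sub e f he hf | mul e f he hf | div e f he hf =>
    have h1 := size_eval_le hσ e
    have h2 := size_eval_le hσ f
    simp only [cost, unit, add_mul]
    omega

end Expr

/-- Executions that never store a number of more than `B` bits; instead of the logarithmic cost,
the rules that are applied are counted. -/
inductive BExec (B : ℕ) : Prog → Mem → ℕ → Mem → Prop
  | skip (σ : Mem) : BExec B .skip σ 1 σ
  | write (a : ℕ) (i e : Expr) (σ : Mem) : e.eval σ < 2 ^ B →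
      BExec B (.write a i e) σ 1 (σ.store a (i.eval σ) (e.eval σ))
  | seq {p q : Prog} {σ σ' σ'' : Mem} {s s' : ℕ} :
      BExec B p σ s σ' → BExec B q σ' s' σ'' → BExec B (.seq p q) σ (s + s' + 1) σ''
  | branch_true {b : Expr} {p q : Prog} {σ σ' : Mem} {s : ℕ} :
      b.eval σ ≠ 0 → BExec B p σ s σ' → BExec B (.branch b p q) σ (s + 1) σ'
  | branch_false {b : Expr} {p q : Prog} {σ σ' : Mem} {s : ℕ} :
      b.eval σ = 0 → BExec B q σ s σ' → BExec B (.branch b p q) σ (s + 1) σ'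
  | loop_true {b : Expr} {p : Prog} {σ σ' σ'' : Mem} {s s' : ℕ} :
      b.eval σ ≠ 0 → BExec B p σ s σ' → BExec B (.loop b p) σ' s' σ'' →
        BExec B (.loop b p) σ (s + s' + 1) σ''
  | loop_false {b : Expr} {p : Prog} {σ : Mem} : b.eval σ = 0 → BExec B (.loop b p) σ 1 σ

namespace Prog

/-- A factor by which the cost of one step of a program can exceed the bit length of the memory
cells. -/
def unit : Prog → ℕ
  | skip => 1
  | write _ i e => i.unit + e.unit + i.growth + e.growth + 1
  | seq p q => p.unit + q.unit + 1
  | branch b p q => b.unit + p.unit + q.unit + 1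
  | loop b p => b.unit + p.unit + 1

/-- The arrays that a program can change. -/
def writes : Prog → List ℕ
  | skip => []
  | write a _ _ => [a]
  | seq p q => p.writes ++ q.writes
  | branch _ p q => p.writes ++ q.writes
  | loop _ p => p.writes

end Prog

theorem Mem.store_apply (σ : Mem) (a i v a' i' : ℕ) :
    σ.store a i v a' i' = if a' = a ∧ i' = i then v else σ a' i' := rfl

theorem Mem.store_of_ne (σ : Mem) {a a' : ℕ} (i v : ℕ) (h : a' ≠ a) : σ.store a i v a' = σ a' := by
  funext i'
  simp [Mem.store, h]

variable {B : ℕ}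

theorem BExec.frame {p : Prog} {σ σ' : Mem} {s : ℕ} (h : BExec B p σ s σ') :
    ∀ a ∉ p.writes, σ' a = σ a := by
  induction h with
  | skip | loop_false => exact fun _ _ => rfl
  | write a i e σ _ => exact fun a' ha' => σ.store_of_ne _ _ (by simpa [Prog.writes] using ha')
  | seq _ _ ih ih' =>
    intro a ha
    simp only [Prog.writes, List.mem_append, not_or] at ha
    rw [ih' a ha.2, ih a ha.1]
  | branch_true _ _ ih =>
    intro a ha
    simp only [Prog.writes, List.mem_append, not_or] at ha
    exact ih a ha.1
  | branch_false _ _ ih =>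
    intro a ha
    simp only [Prog.writes, List.mem_append, not_or] at ha
    exact ih a ha.2
  | loop_true _ _ _ ih ih' =>
    intro a ha
    rw [ih' a ha, ih a ha]

/-- On memory of `B` bit cells, a step costs at most `B + 1` times a constant of the program. -/
theorem BExec.exec {p : Prog} {σ σ' : Mem} {s : ℕ} (h : BExec B p σ s σ')
    (hσ : ∀ a i, σ a i < 2 ^ B) :
    (∃ t, Exec p σ t σ' ∧ t ≤ p.unit * (B + 1) * s) ∧ ∀ a i, σ' a i < 2 ^ B := by
  induction h with
  | skip σ => exact ⟨⟨1, .skip σ, by simp [Prog.unit]⟩, hσ⟩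
  | write a i e σ he =>
    refine ⟨⟨_, .write a i e σ, ?_⟩, fun a' i' => ?_⟩
    · have h1 := Expr.cost_le hσ i
      have h2 := Expr.cost_le hσ e
      have h3 := Expr.size_eval_le hσ i
      have h4 := Expr.size_eval_le hσ e
      simp only [Prog.unit, add_mul, mul_one]
      omega
    · rw [Mem.store_apply]
      split_ifs
      · exact he
      · exact hσ _ _
  | @seq p q _ _ _ s s' _ _ ih ih' =>
    obtain ⟨⟨t, ht, hts⟩, hσ'⟩ := ih hσ
    obtain ⟨⟨t', ht', hts'⟩, hσ''⟩ := ih' hσ'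
    refine ⟨⟨_, .seq ht ht', ?_⟩, hσ''⟩
    simp only [Prog.unit]
    nlinarith [Nat.zero_le (p.unit * (B + 1)), Nat.zero_le (q.unit * (B + 1) * s),
      Nat.zero_le (p.unit * (B + 1) * s'), Nat.zero_le (q.unit * (B + 1)),
      Nat.zero_le ((B + 1) * s), Nat.zero_le ((B + 1) * s')]
  | @branch_true b p q σ _ s hb _ ih =>
    obtain ⟨⟨t, ht, hts⟩, hσ'⟩ := ih hσ
    refine ⟨⟨_, .branch_true hb ht, ?_⟩, hσ'⟩
    have := Expr.cost_le hσ b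
    simp only [Prog.unit]
    nlinarith [Nat.zero_le (p.unit * (B + 1)), Nat.zero_le (q.unit * (B + 1) * s),
      Nat.zero_le (q.unit * (B + 1)), Nat.zero_le ((B + 1) * s),
      Nat.zero_le (b.unit * (B + 1) * s)]
  | @branch_false b p q σ _ s hb _ ih =>
    obtain ⟨⟨t, ht, hts⟩, hσ'⟩ := ih hσ
    refine ⟨⟨_, .branch_false hb ht, ?_⟩, hσ'⟩
    have := Expr.cost_le hσ b
    simp only [Prog.unit]
    nlinarith [Nat.zero_le (q.unit * (B + 1)), Nat.zero_le (p.unit * (B + 1) * s),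
      Nat.zero_le (p.unit * (B + 1)), Nat.zero_le ((B + 1) * s),
      Nat.zero_le (b.unit * (B + 1) * s)]
  | @loop_true b p σ _ _ s s' hb _ _ ih ih' =>
    obtain ⟨⟨t, ht, hts⟩, hσ'⟩ := ih hσ
    obtain ⟨⟨t', ht', hts'⟩, hσ''⟩ := ih' hσ'
    refine ⟨⟨_, .loop_true hb ht ht', ?_⟩, hσ''⟩
    have := Expr.cost_le hσ b
    simp only [Prog.unit] at hts' ⊢
    nlinarith [Nat.zero_le (p.unit * (B + 1)), Nat.zero_le (b.unit * (B + 1) * s),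
      Nat.zero_le ((B + 1) * s)]
  | @loop_false b p σ hb =>
    refine ⟨⟨_, .loop_false hb, ?_⟩, hσ⟩
    have := Expr.cost_le hσ b
    simp only [Prog.unit, add_mul, mul_one]
    omega

/-- The program halts, without storing a number of more than `B` bits, and the number of steps
and the final memory satisfy `Q`. -/
def WP (B : ℕ) (p : Prog) (Q : ℕ → Mem → Prop) (σ : Mem) : Prop :=
  ∃ s σ', BExec B p σ s σ' ∧ Q s σ'

namespace WP

variable {p q : Prog} {Q Q' : ℕ → Mem → Prop} {σ : Mem} {b : Expr}

theorem mono (h : WP B p Q σ)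
    (hQ : ∀ s σ', (∀ a ∉ p.writes, σ' a = σ a) → Q s σ' → Q' s σ') : WP B p Q' σ := by
  obtain ⟨s, σ', he, hq⟩ := h
  exact ⟨s, σ', he, hQ s σ' he.frame hq⟩

theorem skip (h : Q 1 σ) : WP B .skip Q σ := ⟨1, σ, .skip σ, h⟩

theorem write {a : ℕ} {i e : Expr} (he : e.eval σ < 2 ^ B)
    (h : Q 1 (σ.store a (i.eval σ) (e.eval σ))) : WP B (.write a i e) Q σ :=
  ⟨1, _, .write a i e σ he, h⟩

theorem seq (h : WP B p (fun s σ' => WP B q (fun s' σ'' => Q (s + s' + 1) σ'') σ') σ) :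
    WP B (.seq p q) Q σ := by
  obtain ⟨s, σ', hp, s', σ'', hq, h⟩ := h
  exact ⟨_, _, .seq hp hq, h⟩

theorem branch (h₁ : b.eval σ ≠ 0 → WP B p (fun s σ' => Q (s + 1) σ') σ)
    (h₂ : b.eval σ = 0 → WP B q (fun s σ' => Q (s + 1) σ') σ) : WP B (.branch b p q) Q σ := by
  by_cases hb : b.eval σ = 0
  · obtain ⟨s, σ', h, hQ⟩ := h₂ hb
    exact ⟨_, _, .branch_false hb h, hQ⟩
  · obtain ⟨s, σ', h, hQ⟩ := h₁ hb
    exact ⟨_, _, .branch_true hb h, hQ⟩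

/-- A loop that makes `N` iterations of at most `K` steps each, with an invariant indexed by the
number of iterations made. -/
theorem loop (Inv : ℕ → Mem → Prop) (N K : ℕ) (h₀ : Inv 0 σ)
    (hstep : ∀ j < N, ∀ σ', (∀ a ∉ p.writes, σ' a = σ a) → Inv j σ' →
      b.eval σ' ≠ 0 ∧ WP B p (fun s σ'' => s ≤ K ∧ Inv (j + 1) σ'') σ')
    (hend : ∀ σ', (∀ a ∉ p.writes, σ' a = σ a) → Inv N σ' → b.eval σ' = 0)
    (hQ : ∀ s σ', s ≤ N * (K + 1) + 1 → (∀ a ∉ p.writes, σ' a = σ a) → Inv N σ' → Q s σ') :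
    WP B (.loop b p) Q σ := by
  have key : ∀ r j, j + r = N → ∀ σ', (∀ a ∉ p.writes, σ' a = σ a) → Inv j σ' →
      ∃ s σ'', BExec B (.loop b p) σ' s σ'' ∧ s ≤ r * (K + 1) + 1 ∧ Inv N σ'' := by
    intro r
    induction r with
    | zero =>
      intro j hj σ' hf hI
      rw [add_zero] at hj
      subst hj
      exact ⟨1, σ', .loop_false (hend σ' hf hI), by omega, hI⟩
    | succ r ih =>
      intro j hj σ' hf hI
      obtain ⟨hb, s, σ'', he, hs, hI'⟩ := hstep j (by omega) σ' hf hI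
      obtain ⟨s', σ₃, he', hs', hI''⟩ := ih (j + 1) (by omega) σ''
        (fun a ha => by rw [he.frame a ha, hf a ha]) hI'
      refine ⟨_, _, .loop_true hb he he', ?_, hI''⟩
      rw [Nat.succ_mul]
      omega
  obtain ⟨s, σ', he, hs, hI⟩ := key N 0 (by omega) σ (fun _ _ => rfl) h₀
  exact ⟨s, σ', he, hQ s σ' hs he.frame hI⟩

end WP

end RAM

/-! ### Reading an encoded instance -/

namespace PermCSP

/-- The word `l` is stored in `A` from position `p` on. -/
def StoredAt (A : ℕ → ℕ) (p : ℕ) (l : List ℕ) : Prop :=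
  ∀ i < l.length, A (p + i) = l.getD i 0

theorem StoredAt.append {A : ℕ → ℕ} {p : ℕ} {l l' : List ℕ} (h : StoredAt A p (l ++ l')) :
    StoredAt A p l ∧ StoredAt A (p + l.length) l' := by
  constructor
  · intro i hi
    rw [h i (by rw [List.length_append]; omega), List.getD_append _ _ _ _ hi]
  · intro i hi
    rw [add_assoc, h _ (by rw [List.length_append]; omega),
      List.getD_append_right _ _ _ _ (by omega)]
    congr 1
    omega

theorem StoredAt.flatMap {α : Type*} {A : ℕ → ℕ} {p : ℕ} {l : List α} {f : α → List ℕ}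
    (h : StoredAt A p (l.flatMap f)) (j : ℕ) (hj : j < l.length) :
    StoredAt A (p + ((l.take j).flatMap f).length) (f l[j]) := by
  have h1 : l.flatMap f = (l.take j).flatMap f ++ (f l[j] ++ (l.drop (j + 1)).flatMap f) := by
    conv_lhs => rw [← List.take_append_drop j l, List.drop_eq_getElem_cons hj]
    rw [List.flatMap_append, List.flatMap_cons]
  rw [h1] at h
  exact h.append.2.append.1

section

variable {c n : ℕ}

theorem Constraint.length_satisfyingPerms (C : Constraint c n) :
    (Instance.satisfyingPerms C.pred).length = C.accepted := by
  unfold Instance.satisfyingPerms Constraint.accepted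
  rw [← List.toFinset_card_of_nodup
    ((nodup_permsOfList (List.nodup_finRange _)).filter _)]
  congr 1
  ext π
  simp [mem_permsOfList_iff]

theorem Constraint.accepted_le (C : Constraint c n) : C.accepted ≤ C.arity.factorial := by
  unfold Constraint.accepted
  refine (Finset.card_le_univ _).trans (le_of_eq ?_)
  rw [Fintype.card_perm, Fintype.card_fin]

theorem Constraint.satKey_iff (C : Constraint c n) (κ : Fin n → ℕ) :
    C.SatKey κ ↔ ∃ t, ∃ h : t < (Instance.satisfyingPerms C.pred).length, ∀ i j,
      (Instance.satisfyingPerms C.pred)[t] i < (Instance.satisfyingPerms C.pred)[t] j ↔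
        κ (C.scope i) < κ (C.scope j) := by
  have hmem : ∀ π, π ∈ Instance.satisfyingPerms C.pred ↔ C.pred π = true := by
    intro π
    simp [Instance.satisfyingPerms, mem_permsOfList_iff]
  constructor
  · rintro ⟨π, hπ, hp⟩
    obtain ⟨t, ht, rfl⟩ := List.mem_iff_getElem.1 ((hmem π).2 hp)
    exact ⟨t, ht, hπ⟩
  · rintro ⟨t, ht, h⟩
    exact ⟨_, h, (hmem _).1 (List.getElem_mem ht)⟩

theorem length_encodePerm {r : ℕ} (π : Equiv.Perm (Fin r)) :
    (Instance.encodePerm π).length = r := by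
  simp [Instance.encodePerm]

theorem length_flatMap_encodePerm {r : ℕ} (l : List (Equiv.Perm (Fin r))) :
    (l.flatMap Instance.encodePerm).length = r * l.length := by
  induction l with
  | nil => simp
  | cons π l ih =>
    rw [List.flatMap_cons, List.length_append, ih, length_encodePerm, List.length_cons]
    ring

theorem Constraint.length_encode (C : Constraint c n) :
    (Instance.encodeConstraint C).length = 3 + C.arity + C.arity * C.accepted := by
  simp only [Instance.encodeConstraint, List.length_append, length_flatMap_encodePerm,
    length_satisfyingPerms]
  simp
  omega

theorem StoredAt.constraint {A : ℕ → ℕ} {p : ℕ} {C : Constraint c n}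
    (h : StoredAt A p (Instance.encodeConstraint C)) :
    A p = C.weight ∧ A (p + 1) = C.arity ∧ (∀ i : Fin C.arity, A (p + 2 + i) = C.scope i) ∧
      A (p + 2 + C.arity) = C.accepted ∧
      ∀ t, ∀ ht : t < (Instance.satisfyingPerms C.pred).length, ∀ i : Fin C.arity,
        A (p + 3 + C.arity + C.arity * t + i) = (Instance.satisfyingPerms C.pred)[t] i := by
  unfold Instance.encodeConstraint at h
  obtain ⟨h, h4⟩ := h.append
  obtain ⟨h, h3⟩ := h.append
  obtain ⟨h1, h2⟩ := h.append
  simp only [List.length_append, List.length_cons, List.length_nil, List.length_map,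
    List.length_finRange] at h2 h3 h4
  refine ⟨?_, ?_, ?_, ?_, ?_⟩
  · simpa using h1 0 (by simp)
  · simpa using h1 1 (by simp)
  · intro i
    have := h2 i (by simp)
    rw [List.getD_eq_getElem _ _ (by simp)] at this
    simpa using this
  · have := h3 0 (by simp)
    rw [← C.length_satisfyingPerms]
    simp only [List.getD_cons_zero] at this
    rw [← this]
    congr 1
    omega
  · intro t ht i
    have := h4.flatMap t ht
    rw [length_flatMap_encodePerm, List.length_take, min_eq_left ht.le] at this
    have := this i (by simp [length_encodePerm])
    rw [List.getD_eq_getElem _ _ (by simp [length_encodePerm])] at this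
    simp only [Instance.encodePerm, List.getElem_map, List.getElem_finRange] at this
    rw [show p + 3 + C.arity + C.arity * t + (i : ℕ) =
      p + (0 + 1 + 1 + C.arity + (0 + 1)) + C.arity * t + i by omega, this]
    simp

end

namespace Instance

variable {c : ℕ} (I : Instance c)

/-- The encoding of an instance as the content of an array. -/
def input : ℕ → ℕ := fun i => I.encode.getD i 0

/-- The position of the encoding of constraint number `j`. -/
def offset (j : ℕ) : ℕ := 3 + ((I.constraints.take j).flatMap encodeConstraint).length

theorem storedAt_input : StoredAt I.input 0 I.encode := by
  intro i _
  simp [input]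

theorem input_zero : I.input 0 = I.n := by simp [input, encode]

theorem input_one : I.input 1 = I.k := by simp [input, encode]

theorem input_two : I.input 2 = I.constraints.length := by simp [input, encode]

theorem storedAt_constraint (j : ℕ) (hj : j < I.constraints.length) :
    StoredAt I.input (I.offset j) (encodeConstraint I.constraints[j]) := by
  have h := I.storedAt_input
  unfold encode at h
  have h2 := h.append.2.flatMap j hj
  simpa [offset] using h2

theorem offset_zero : I.offset 0 = 3 := by simp [offset]

theorem offset_succ (j : ℕ) (hj : j < I.constraints.length) :
    I.offset (j + 1) = I.offset j + 3 + I.constraints[j].arity +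
      I.constraints[j].arity * I.constraints[j].accepted := by
  unfold offset
  rw [List.take_succ_eq_append_getElem hj, List.flatMap_append, List.length_append,
    List.flatMap_singleton, Constraint.length_encode]
  omega

theorem offset_length : I.offset I.constraints.length = I.encode.length := by
  unfold offset encode
  rw [List.take_length, List.length_append]
  simp

theorem offset_le (j : ℕ) : I.offset j ≤ I.encode.length := by
  rw [← offset_length]
  unfold offset
  have : I.constraints.flatMap encodeConstraint = (I.constraints.take j).flatMap encodeConstraint ++
      (I.constraints.drop j).flatMap encodeConstraint := by
    rw [← List.flatMap_append, List.take_append_drop]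
  rw [List.take_length, this, List.length_append]
  omega

theorem three_mul_length_le : 3 * I.constraints.length + 3 ≤ I.encode.length := by
  suffices h : ∀ j ≤ I.constraints.length, 3 * j + 3 ≤ I.offset j by
    have := h _ le_rfl
    rwa [offset_length] at this
  intro j hj
  induction j with
  | zero => simp [offset_zero]
  | succ j ih =>
    have := ih (by omega)
    rw [offset_succ I j (by omega)]
    omega

theorem sum_add_length_le_two_pow (l : List ℕ) : l.sum + l.length ≤ 2 ^ RAM.inputSize l := by
  induction l with
  | nil => simp
  | cons x l ih =>
    have h1 : RAM.inputSize (x :: l) = x.size + RAM.inputSize l + 1 := by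
      simp [RAM.inputSize]
      omega
    have h2 := Nat.lt_size_self x
    have h3 := Nat.pow_le_pow_right (n := 2) (by norm_num) (Nat.le_add_right x.size (RAM.inputSize l))
    have h4 := Nat.pow_le_pow_right (n := 2) (by norm_num) (Nat.le_add_left (RAM.inputSize l) x.size)
    rw [h1, pow_succ, List.sum_cons, List.length_cons]
    omega

theorem length_le_size : I.encode.length ≤ I.size := by
  unfold size RAM.inputSize
  induction I.encode with
  | nil => simp
  | cons x l ih =>
    simp only [List.map_cons, List.sum_cons, List.length_cons]
    omega

theorem sum_add_length_encode_le : I.encode.sum + I.encode.length ≤ 2 ^ I.size :=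
  sum_add_length_le_two_pow _

theorem input_lt (i : ℕ) : I.input i < 2 ^ I.size := by
  have h := I.sum_add_length_encode_le
  have h3 := I.three_mul_length_le
  unfold input
  by_cases hi : i < I.encode.length
  · rw [List.getD_eq_getElem _ _ hi]
    have := List.le_sum_of_mem (List.getElem_mem hi)
    omega
  · rw [List.getD_eq_default _ _ (by omega)]
    positivity

theorem totalWeight_le : I.totalWeight ≤ I.encode.sum := by
  unfold totalWeight encode
  rw [List.sum_append]
  refine le_trans ?_ (Nat.le_add_left _ _)
  induction I.constraints with
  | nil => simp
  | cons C l ih =>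
    rw [List.map_cons, List.sum_cons, List.flatMap_cons, List.sum_append]
    refine Nat.add_le_add ?_ ih
    unfold encodeConstraint
    simp only [List.sum_append, List.sum_cons]
    omega

theorem totalWeight_lt : I.totalWeight < 2 ^ I.size := by
  have h1 := I.totalWeight_le
  have h2 := I.sum_add_length_encode_le
  have h3 := I.three_mul_length_le
  omega

theorem keyWeight_le (κ : Fin I.n → ℕ) : I.keyWeight κ ≤ I.totalWeight := by
  unfold keyWeight totalWeight
  refine List.sum_le_sum fun C _ => ?_
  unfold Constraint.gain
  split_ifs <;> simp

/-- Six times the mean weight of an assignment. -/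
def mean6 : ℕ := (I.constraints.map fun C => C.weight * C.accepted * (6 / C.arity.factorial)).sum

theorem cast_mean6 (hc : c ≤ 3) : (I.mean6 : ℚ) = 6 * I.mean := by
  unfold mean6 mean
  induction I.constraints with
  | nil => simp
  | cons C l ih =>
    simp only [List.map_cons, List.sum_cons]
    push_cast at ih ⊢
    rw [ih, mul_add]
    congr 1
    have h := C.arity_le.trans hc
    have h2 : ((6 / C.arity.factorial : ℕ) : ℚ) = 6 / C.arity.factorial := by
      generalize C.arity = a at h
      interval_cases a <;> norm_num [Nat.factorial]
    rw [h2]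
    ring

theorem gain6_le (C : Constraint c I.n) :
    C.weight * C.accepted * (6 / C.arity.factorial) ≤ 6 * C.weight := by
  have h1 := C.accepted_le
  have h2 : C.accepted * (6 / C.arity.factorial) ≤ 6 :=
    (Nat.mul_le_mul_right _ h1).trans (Nat.mul_div_le _ _)
  rw [mul_assoc, mul_comm]
  exact Nat.mul_le_mul_right _ h2

end Instance

end PermCSP

/-! ### A program that evaluates the weight of an order -/

namespace RAM

instance : Append Prog := ⟨Prog.seq⟩

/-- The register `r`. -/
abbrev reg (r : ℕ) : Expr := .read r 0

/-- The input number at a computed position. -/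
abbrev inp (e : Expr) : Expr := .read 0 e

/-- Assignment to a register. -/
def set (r : ℕ) (e : Expr) : Prog := .write r 0 e

theorem WP.set {B r : ℕ} {e : Expr} {Q : ℕ → Mem → Prop} {σ : Mem} (he : e.eval σ < 2 ^ B)
    (h : Q 1 (σ.store r 0 (e.eval σ))) : WP B (set r e) Q σ :=
  .write he h

theorem WP.append {B : ℕ} {p q : Prog} {Q : ℕ → Mem → Prop} {σ : Mem}
    (h : WP B p (fun s σ' => WP B q (fun s' σ'' => Q (s + s' + 1) σ'') σ') σ) :
    WP B (p ++ q) Q σ :=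
  .seq h

/-- The key of a variable: its label, in array `30`, and its name, combined into one number. -/
def keyExpr (s : Expr) : Expr := .read 30 s * inp 0 + s

/-- The word of a local permutation is in register `7` (its position) and the constraint in
register `2`. Register `9` is left `0` if the keys of the scope are in the order of the word. -/
def comparePairs : Prog :=
  set 8 0 ++ set 9 0 ++
    .loop (inp (reg 2 + 1) * inp (reg 2 + 1) - reg 8)
      (.branch (inp (reg 7 + (reg 8 - inp (reg 2 + 1) * (reg 8 / inp (reg 2 + 1)))) -
          inp (reg 7 + reg 8 / inp (reg 2 + 1)))
        (.branch
          (keyExpr (inp (reg 2 + 2 + (reg 8 - inp (reg 2 + 1) * (reg 8 / inp (reg 2 + 1))))) -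
            keyExpr (inp (reg 2 + 2 + reg 8 / inp (reg 2 + 1)))) .skip (set 9 1))
        (.branch
          (keyExpr (inp (reg 2 + 2 + (reg 8 - inp (reg 2 + 1) * (reg 8 / inp (reg 2 + 1))))) -
            keyExpr (inp (reg 2 + 2 + reg 8 / inp (reg 2 + 1)))) (set 9 1) .skip) ++
        set 8 (reg 8 + 1))

theorem comparePairs_spec {B : ℕ} (hB : 4 ≤ B) (σ : Mem) (a : ℕ) (ha : σ 0 (σ 2 0 + 1) = a)
    (ha3 : a ≤ 3) :
    WP B comparePairs (fun s σ' => s ≤ 100 ∧ (σ' 9 0 = 0 ↔ ∀ d < a * a,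
      (σ 0 (σ 7 0 + d / a) < σ 0 (σ 7 0 + d % a) ↔
        σ 30 (σ 0 (σ 2 0 + 2 + d / a)) * σ 0 0 + σ 0 (σ 2 0 + 2 + d / a) <
          σ 30 (σ 0 (σ 2 0 + 2 + d % a)) * σ 0 0 + σ 0 (σ 2 0 + 2 + d % a)))) σ := by
  have hB' : 2 ^ 4 ≤ 2 ^ B := Nat.pow_le_pow_right (by norm_num) hB
  have hB'' : 0 < 2 ^ B := by positivity
  have ha9 : a * a ≤ 9 := by nlinarith
  set good : ℕ → Prop := fun d => (σ 0 (σ 7 0 + d / a) < σ 0 (σ 7 0 + d % a) ↔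
        σ 30 (σ 0 (σ 2 0 + 2 + d / a)) * σ 0 0 + σ 0 (σ 2 0 + 2 + d / a) <
          σ 30 (σ 0 (σ 2 0 + 2 + d % a)) * σ 0 0 + σ 0 (σ 2 0 + 2 + d % a)) with hgood
  refine WP.append (WP.append (WP.set ?_ (WP.set ?_ ?_)))
  · simp
  · simp
  refine WP.loop (fun j σ' => σ' 8 0 = j ∧ (σ' 9 0 = 0 ↔ ∀ d < j, good d)) (a * a) 8 ?_ ?_ ?_ ?_
  · simp [Mem.store_apply]
  · rintro d hd σ' hf ⟨h8, h9⟩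
    have e0 : σ' 0 = σ 0 := by rw [hf 0 (by decide)]; rfl
    have e2 : σ' 2 = σ 2 := by rw [hf 2 (by decide)]; rfl
    have e7 : σ' 7 = σ 7 := by rw [hf 7 (by decide)]; rfl
    have e30 : σ' 30 = σ 30 := by rw [hf 30 (by decide)]; rfl
    have hmod : d - a * (d / a) = d % a := (Nat.mod_eq_sub_mul_div).symm
    have hlast : ∀ P : Prop, (∀ d' < d + 1, good d') ↔ (∀ d' < d, good d') ∧ good d := by
      intro _
      constructor
      · exact fun h => ⟨fun d' hd' => h d' (by omega), h d (by omega)⟩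
      · rintro ⟨h, h'⟩ d' hd'
        rcases Nat.lt_succ_iff_lt_or_eq.1 hd' with h1 | rfl
        · exact h d' h1
        · exact h'
    refine ⟨?_, WP.append ?_⟩
    · simp only [Expr.eval_sub, Expr.eval_mul, Expr.eval_read, Expr.eval_add, Expr.eval_ofNat, e0,
        e2, ha, h8]
      omega
    · have hinc : ∀ σ'' : Mem, σ'' 8 0 = d → (σ'' 9 0 = 0 ↔ ∀ d' < d + 1, good d') → ∀ s ≤ 5,
          WP B (RAM.set 8 (reg 8 + 1)) (fun s' σ₃ => s + s' + 1 ≤ 8 ∧ σ₃ 8 0 = d + 1 ∧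
            (σ₃ 9 0 = 0 ↔ ∀ d' < d + 1, good d')) σ'' := by
        intro σ'' h8' h9' s hs
        refine WP.set ?_ ?_
        · simp only [Expr.eval_add, Expr.eval_read, Expr.eval_ofNat, h8']
          omega
        · refine ⟨by omega, ?_, ?_⟩
          · simp [Mem.store_apply, h8']
          · simpa [Mem.store_apply] using h9'
      refine WP.branch (fun hb => WP.branch (fun hb' => ?_) (fun hb' => ?_))
        (fun hb => WP.branch (fun hb' => ?_) (fun hb' => ?_))
      all_goals
        simp only [keyExpr, Expr.eval_sub, Expr.eval_mul, Expr.eval_read, Expr.eval_add,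
          Expr.eval_div, Expr.eval_ofNat, e0, e2, e7, e30, ha, h8, hmod] at hb hb'
      · refine WP.skip (hinc _ h8 ?_ _ (by norm_num))
        rw [h9, hlast True]
        simp only [iff_self_and, hgood]
        intro _
        omega
      · refine WP.set (by simp; omega) (hinc _ ?_ ?_ _ (by norm_num))
        · simpa [Mem.store_apply] using h8
        · rw [hlast True]
          simp only [hgood, Mem.store_apply, Expr.eval_ofNat]
          simp
          intro _
          omega
      · refine WP.set (by simp; omega) (hinc _ ?_ ?_ _ (by norm_num))
        · simpa [Mem.store_apply] using h8
        · rw [hlast True]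
          simp only [hgood, Mem.store_apply, Expr.eval_ofNat]
          simp
          intro _
          omega
      · refine WP.skip (hinc _ h8 ?_ _ (by norm_num))
        rw [h9, hlast True]
        simp only [iff_self_and, hgood]
        intro _
        omega
  · rintro σ' hf ⟨h8, h9⟩
    have e0 : σ' 0 = σ 0 := by rw [hf 0 (by decide)]; rfl
    have e2 : σ' 2 = σ 2 := by rw [hf 2 (by decide)]; rfl
    simp only [Expr.eval_sub, Expr.eval_mul, Expr.eval_read, Expr.eval_add, Expr.eval_ofNat, e0,
        e2, ha, h8]
    omega
  · rintro s σ' hs hf ⟨h8, h9⟩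
    exact ⟨by omega, h9⟩

/-- The constraint at the position in register `2` is checked against the order of the keys, with
the result in register `10`. -/
def checkConstraint : Prog :=
  set 10 0 ++ set 6 0 ++ set 7 (reg 2 + 3 + inp (reg 2 + 1)) ++
    .loop (inp (reg 2 + 2 + inp (reg 2 + 1)) - reg 6)
      (comparePairs ++ .branch (reg 9) .skip (set 10 1) ++ set 6 (reg 6 + 1) ++
        set 7 (reg 7 + inp (reg 2 + 1)))

/-- The weight of the order of the keys is computed in register `3`, six times the mean weight in
register `4`, and the length of the input in register `2`. The factorial of an arity `a ≤ 3` is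
computed as `a (a - 1)`, or as `1` if this product is `0`. -/
def evalOrder : Prog :=
  set 2 3 ++ set 3 0 ++ set 4 0 ++ set 5 0 ++
    .loop (inp 2 - reg 5)
      (checkConstraint ++ set 3 (reg 3 + inp (reg 2) * reg 10) ++
        set 4 (reg 4 + inp (reg 2) * inp (reg 2 + 2 + inp (reg 2 + 1)) *
          (6 / (inp (reg 2 + 1) * (inp (reg 2 + 1) - 1) +
            (1 - inp (reg 2 + 1) * (inp (reg 2 + 1) - 1))))) ++
        set 2 (reg 2 + 3 + inp (reg 2 + 1) +
          inp (reg 2 + 1) * inp (reg 2 + 2 + inp (reg 2 + 1))) ++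
        set 5 (reg 5 + 1))

end RAM

namespace PermCSP

open RAM

variable {c : ℕ}

/-- The order of the variables by the labels in an array, ties being broken by the names. -/
abbrev arrayKey {n : ℕ} (g : ℕ → ℕ) : Fin n → ℕ := labelKey (fun i : Fin n => g i) 1

theorem Constraint.words_iff {n : ℕ} (C : Constraint c n) {A : ℕ → ℕ} {p : ℕ}
    (h : StoredAt A p (Instance.encodeConstraint C)) (g : ℕ → ℕ) (t : ℕ)
    (ht : t < (Instance.satisfyingPerms C.pred).length) :
    (∀ d < C.arity * C.arity,
      (A (p + 3 + C.arity + C.arity * t + d / C.arity) <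
          A (p + 3 + C.arity + C.arity * t + d % C.arity) ↔
        g (A (p + 2 + d / C.arity)) * n + A (p + 2 + d / C.arity) <
          g (A (p + 2 + d % C.arity)) * n + A (p + 2 + d % C.arity))) ↔
    ∀ i j, (Instance.satisfyingPerms C.pred)[t] i < (Instance.satisfyingPerms C.pred)[t] j ↔
        arrayKey g (C.scope i) < arrayKey g (C.scope j) := by
  obtain ⟨-, -, hs, -, hw⟩ := h.constraint
  constructor
  · intro h i j
    have ha : 0 < C.arity := i.pos
    have h1 := h (C.arity * i + j) (by
      have := Nat.mul_le_mul_left C.arity (Nat.succ_le_of_lt i.isLt)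
      have := j.isLt
      rw [Nat.mul_succ] at *
      omega)
    rw [Nat.mul_add_div ha, Nat.div_eq_of_lt j.isLt, add_zero, Nat.mul_add_mod,
      Nat.mod_eq_of_lt j.isLt, hw t ht i, hw t ht j, hs, hs] at h1
    rw [Fin.lt_def, h1]
    rfl
  · intro h d hd
    have ha : 0 < C.arity := Nat.pos_of_ne_zero fun h0 => by simp [h0] at hd
    have h1 := h ⟨d / C.arity, Nat.div_lt_of_lt_mul hd⟩ ⟨d % C.arity, Nat.mod_lt _ ha⟩
    rw [Fin.lt_def, ← hw t ht, ← hw t ht] at h1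
    have e : ∀ i, arrayKey g (C.scope i) = g (A (p + 2 + i)) * n + A (p + 2 + i) := by
      intro i
      rw [hs]
      rfl
    rw [h1, e, e]

namespace Instance

variable (I : Instance c)

open Classical in
theorem checkConstraint_spec (hc : c ≤ 3) {B : ℕ} (hB : I.size + 4 ≤ B) (σ : Mem)
    (h0 : σ 0 = I.input) (j : ℕ) (hj : j < I.constraints.length) (h2 : σ 2 0 = I.offset j) :
    WP B checkConstraint (fun s σ' => s ≤ 700 ∧
      σ' 10 0 = if I.constraints[j].SatKey (arrayKey (σ 30)) then 1 else 0) σ := by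
  have hB0 : 0 < 2 ^ B := by positivity
  have hB1 : 2 ^ (I.size + 4) ≤ 2 ^ B := Nat.pow_le_pow_right (by norm_num) (by omega)
  rw [pow_add] at hB1
  have hB2 : 2 ^ 4 ≤ 2 ^ B := Nat.pow_le_pow_right (by norm_num) (by omega)
  have hL := I.sum_add_length_encode_le
  have hst := I.storedAt_constraint j hj
  have hoff := I.offset_succ j hj
  have hoff' := I.offset_le (j + 1)
  generalize I.constraints[j] = C at *
  obtain ⟨hw, ha, hs, hcnt, hwords⟩ := hst.constraint
  have ha3 : C.arity ≤ 3 := C.arity_le.trans hc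
  have hcnt6 : C.accepted ≤ 6 :=
    C.accepted_le.trans ((Nat.factorial_le ha3).trans (by norm_num [Nat.factorial]))
  have hlen := C.length_satisfyingPerms
  set g := σ 30 with hg
  refine WP.append (WP.append (WP.append (WP.set ?_ (WP.set ?_ (WP.set ?_ ?_)))))
  · simp
  · simp
  · simp [Mem.store_apply, h0, h2, ha]
    omega
  refine WP.loop (fun t σ' => σ' 6 0 = t ∧
    σ' 7 0 = I.offset j + 3 + C.arity + C.arity * t ∧ σ' 10 0 ≤ 1 ∧
      (σ' 10 0 ≠ 0 ↔ ∃ t' < t, ∃ h : t' < (satisfyingPerms C.pred).length, ∀ i k,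
        (satisfyingPerms C.pred)[t'] i < (satisfyingPerms C.pred)[t'] k ↔
          arrayKey g (C.scope i) < arrayKey g (C.scope k))) C.accepted 110 ?_ ?_ ?_ ?_
  · simp [Mem.store_apply, h0, h2, ha]
  · rintro t ht σ' hf ⟨h6, h7, h10, h10'⟩
    have e0 : σ' 0 = I.input := by rw [hf 0 (by decide), ← h0]; rfl
    have e2 : σ' 2 0 = I.offset j := by rw [hf 2 (by decide), ← h2]; rfl
    have e30 : σ' 30 = g := by rw [hf 30 (by decide)]; rfl
    refine ⟨?_, ?_⟩
    · simp [e0, e2, ha, hcnt, h6]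
      omega
    refine WP.append (WP.append (WP.append ((comparePairs_spec (by omega) σ' C.arity
      (by rw [e0, e2, ha]) ha3).mono ?_)))
    rintro s σ₁ hf₁ ⟨hs100, h9⟩
    rw [h7, e0, e2, e30, I.input_zero, C.words_iff hst g t (by omega)] at h9
    have f0 : σ₁ 0 = I.input := by rw [hf₁ 0 (by decide), e0]
    have f2 : σ₁ 2 0 = I.offset j := by rw [hf₁ 2 (by decide), e2]
    have f6 : σ₁ 6 0 = t := by rw [hf₁ 6 (by decide), h6]
    have f7 : σ₁ 7 0 = I.offset j + 3 + C.arity + C.arity * t := by rw [hf₁ 7 (by decide), h7]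
    have f10 : σ₁ 10 = σ' 10 := by rw [hf₁ 10 (by decide)]
    have hword : C.arity * (t + 1) ≤ C.arity * C.accepted := Nat.mul_le_mul_left _ ht
    have hfin : ∀ σ₂ : Mem, σ₂ 0 = I.input → σ₂ 2 0 = I.offset j → σ₂ 6 0 = t →
        σ₂ 7 0 = I.offset j + 3 + C.arity + C.arity * t → σ₂ 10 0 ≤ 1 →
        (σ₂ 10 0 ≠ 0 ↔ ∃ t' < t + 1, ∃ h : t' < (satisfyingPerms C.pred).length, ∀ i k,
          (satisfyingPerms C.pred)[t'] i < (satisfyingPerms C.pred)[t'] k ↔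
            arrayKey g (C.scope i) < arrayKey g (C.scope k)) → ∀ s' ≤ 104,
        WP B (RAM.set 6 (reg 6 + 1)) (fun s₁ σ₃ =>
          WP B (RAM.set 7 (reg 7 + inp (reg 2 + 1))) (fun s₂ σ₄ => s' + s₁ + 1 + s₂ + 1 ≤ 110 ∧
            σ₄ 6 0 = t + 1 ∧ σ₄ 7 0 = I.offset j + 3 + C.arity + C.arity * (t + 1) ∧
            σ₄ 10 0 ≤ 1 ∧ (σ₄ 10 0 ≠ 0 ↔ ∃ t' < t + 1,
              ∃ h : t' < (satisfyingPerms C.pred).length, ∀ i k,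
              (satisfyingPerms C.pred)[t'] i < (satisfyingPerms C.pred)[t'] k ↔
                arrayKey g (C.scope i) < arrayKey g (C.scope k))) σ₃) σ₂ := by
      intro σ₂ g0 g2 g6 g7 g10 g10' s' hs'
      refine WP.set ?_ (WP.set ?_ ?_)
      · simp [g6]
        omega
      · simp [Mem.store_apply, g0, g2, g7, ha]
        rw [Nat.mul_succ] at hword
        omega
      · refine ⟨by omega, ?_, ?_, ?_, ?_⟩
        · simp [Mem.store_apply, g6]
        · simp [Mem.store_apply, g0, g2, g7, ha]
          ring
        · simpa [Mem.store_apply] using g10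
        · simpa [Mem.store_apply] using g10'
    have hlast : (∃ t' < t + 1, ∃ h : t' < (satisfyingPerms C.pred).length, ∀ i k,
          (satisfyingPerms C.pred)[t'] i < (satisfyingPerms C.pred)[t'] k ↔
            arrayKey g (C.scope i) < arrayKey g (C.scope k)) ↔ σ₁ 10 0 ≠ 0 ∨ σ₁ 9 0 = 0 := by
      rw [f10, h10', h9]
      constructor
      · rintro ⟨t', ht', h, h'⟩
        rcases Nat.lt_succ_iff_lt_or_eq.1 ht' with h1 | rfl
        · exact Or.inl ⟨t', h1, h, h'⟩
        · exact Or.inr h'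
      · rintro (⟨t', ht', h, h'⟩ | h')
        · exact ⟨t', by omega, h, h'⟩
        · exact ⟨t, by omega, by omega, h'⟩
    refine WP.branch (fun hb => ?_) (fun hb => ?_)
    · simp only [Expr.eval_read, Expr.eval_ofNat] at hb
      refine WP.skip (hfin σ₁ f0 f2 f6 f7 (by rw [f10]; exact h10) ?_ _ (by omega))
      rw [hlast]
      simp [show σ₁ 9 0 ≠ 0 from hb]
    · simp only [Expr.eval_read, Expr.eval_ofNat] at hb
      refine WP.set ?_ (hfin _ ?_ ?_ ?_ ?_ ?_ ?_ _ (by omega))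
      · simp
        omega
      · rw [Mem.store_of_ne _ _ _ (by norm_num), f0]
      · rw [Mem.store_of_ne _ _ _ (by norm_num), f2]
      · rw [Mem.store_of_ne _ _ _ (by norm_num), f6]
      · rw [Mem.store_of_ne _ _ _ (by norm_num), f7]
      · simp [Mem.store_apply]
      · rw [hlast]
        simp [Mem.store_apply, show σ₁ 9 0 = 0 from hb]
  · rintro σ' hf ⟨h6, -⟩
    have e0 : σ' 0 = I.input := by rw [hf 0 (by decide), ← h0]; rfl
    have e2 : σ' 2 0 = I.offset j := by rw [hf 2 (by decide), ← h2]; rfl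
    simp [e0, e2, ha, hcnt, h6]
  · rintro s σ' hs hf ⟨h6, h7, h10, h10'⟩
    refine ⟨by omega, ?_⟩
    have hsat : C.SatKey (arrayKey g) ↔ σ' 10 0 ≠ 0 := by
      rw [h10', C.satKey_iff]
      constructor
      · rintro ⟨t, h, h'⟩
        exact ⟨t, by omega, h, h'⟩
      · rintro ⟨t, -, h, h'⟩
        exact ⟨t, h, h'⟩
    rw [hsat]
    split_ifs with h <;> omega

theorem evalOrder_spec (hc : c ≤ 3) {B : ℕ} (hB : I.size + 4 ≤ B) (σ : Mem)
    (h0 : σ 0 = I.input) :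
    WP B evalOrder (fun s σ' => s ≤ 730 * I.encode.length ∧
      σ' 3 0 = I.keyWeight (arrayKey (σ 30)) ∧ σ' 4 0 = I.mean6 ∧
      σ' 2 0 = I.encode.length) σ := by
  classical
  have hB1 : 2 ^ (I.size + 4) ≤ 2 ^ B := Nat.pow_le_pow_right (by norm_num) (by omega)
  rw [pow_add] at hB1
  have hB2 : 2 ^ 4 ≤ 2 ^ B := Nat.pow_le_pow_right (by norm_num) (by omega)
  have hL := I.sum_add_length_encode_le
  have hL3 := I.three_mul_length_le
  have hW := I.totalWeight_lt
  set g := σ 30 with hg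
  set gains : ℕ → ℕ := fun j => ((I.constraints.take j).map fun C => C.gain (arrayKey g)).sum
    with hgains
  set means : ℕ → ℕ := fun j => ((I.constraints.take j).map fun C =>
    C.weight * C.accepted * (6 / C.arity.factorial)).sum with hmeans
  have hpart : ∀ j (f : Constraint c I.n → ℕ),
      ((I.constraints.take j).map f).sum ≤ (I.constraints.map f).sum := by
    intro j f
    conv_rhs => rw [← List.take_append_drop j I.constraints, List.map_append, List.sum_append]
    omega
  have hgle : ∀ j, gains j ≤ I.totalWeight := fun j =>
    (hpart j fun C => C.gain (arrayKey g)).trans (I.keyWeight_le _)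
  have hmle : ∀ j, means j ≤ 6 * I.totalWeight := by
    intro j
    refine (hpart j _).trans ?_
    unfold totalWeight
    rw [← List.sum_map_mul_left]
    exact List.sum_le_sum fun C _ => I.gain6_le C
  have hgs : ∀ j (hj : j < I.constraints.length),
      gains (j + 1) = gains j + I.constraints[j].gain (arrayKey g) := by
    intro j hj
    simp only [hgains, List.take_succ_eq_append_getElem hj, List.map_append, List.sum_append,
      List.map_singleton, List.sum_singleton]
  have hms : ∀ j (hj : j < I.constraints.length), means (j + 1) = means j +
      I.constraints[j].weight * I.constraints[j].accepted *
        (6 / I.constraints[j].arity.factorial) := by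
    intro j hj
    simp only [hmeans, List.take_succ_eq_append_getElem hj, List.map_append, List.sum_append,
      List.map_singleton, List.sum_singleton]
  refine WP.append (WP.append (WP.append (WP.append (WP.set ?_ (WP.set ?_ (WP.set ?_
    (WP.set ?_ ?_)))))))
  · simp
    omega
  · simp
  · simp
  · simp
  refine WP.loop (fun j σ' => σ' 5 0 = j ∧ σ' 3 0 = gains j ∧ σ' 4 0 = means j ∧
    σ' 2 0 = I.offset j) I.constraints.length 720 ?_ ?_ ?_ ?_
  · simp [Mem.store_apply, hgains, hmeans, offset_zero]
  · rintro j hj σ' hf ⟨h5, h3, h4, h2⟩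
    have e0 : σ' 0 = I.input := by rw [hf 0 (by decide), ← h0]; rfl
    have e30 : σ' 30 = g := by rw [hf 30 (by decide)]; rfl
    refine ⟨?_, ?_⟩
    · simp [e0, h5, I.input_two]
      omega
    refine WP.append (WP.append (WP.append (WP.append ((I.checkConstraint_spec hc hB σ' e0 j hj
      h2).mono ?_))))
    rintro s σ₁ hf₁ ⟨hs, h10⟩
    rw [e30] at h10
    have f0 : σ₁ 0 = I.input := by rw [hf₁ 0 (by decide), e0]
    have f2 : σ₁ 2 0 = I.offset j := by rw [hf₁ 2 (by decide), h2]
    have f3 : σ₁ 3 0 = gains j := by rw [hf₁ 3 (by decide), h3]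
    have f4 : σ₁ 4 0 = means j := by rw [hf₁ 4 (by decide), h4]
    have f5 : σ₁ 5 0 = j := by rw [hf₁ 5 (by decide), h5]
    have hst := I.storedAt_constraint j hj
    have hoff := I.offset_succ j hj
    have hoff' := I.offset_le (j + 1)
    have hgs' := hgs j hj
    have hms' := hms j hj
    have hgl := hgle (j + 1)
    have hml := hmle (j + 1)
    generalize I.constraints[j] = C at *
    obtain ⟨hw, ha, -, hcnt, -⟩ := hst.constraint
    have hgain : C.weight * σ₁ 10 0 = C.gain (arrayKey g) := by
      rw [h10]
      unfold Constraint.gain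
      split_ifs <;> simp
    have hfact : 6 / (C.arity * (C.arity - 1) + (1 - C.arity * (C.arity - 1))) =
        6 / C.arity.factorial := by
      have ha3 : C.arity ≤ 3 := C.arity_le.trans hc
      generalize C.arity = a at ha3
      interval_cases a <;> rfl
    refine WP.set ?_ (WP.set ?_ (WP.set ?_ (WP.set ?_ ?_)))
    · simp [f0, f2, f3, hw, hgain, ← hgs']
      omega
    · simp [Mem.store_apply, f0, f2, f4, hw, ha, hcnt, hfact, ← hms']
      omega
    · simp [Mem.store_apply, f0, f2, ha, hcnt, ← hoff]
      omega
    · simp [Mem.store_apply, f5]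
      omega
    · refine ⟨by omega, ?_, ?_, ?_, ?_⟩
      · simp [Mem.store_apply, f5]
      · simp [Mem.store_apply, f0, f2, f3, hw, hgain, ← hgs']
      · simp [Mem.store_apply, f0, f2, f4, hw, ha, hcnt, hfact, ← hms']
      · simp [Mem.store_apply, f0, f2, ha, hcnt, ← hoff]
  · rintro σ' hf ⟨h5, -⟩
    have e0 : σ' 0 = I.input := by rw [hf 0 (by decide), ← h0]; rfl
    simp [e0, h5, I.input_two]
  · rintro s σ' hs hf ⟨h5, h3, h4, h2⟩
    refine ⟨by omega, ?_, ?_, ?_⟩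
    · rw [h3, hgains]
      simp only [List.take_length]
      rfl
    · rw [h4, hmeans]
      simp only [List.take_length]
      rfl
    · rw [h2, offset_length]

end Instance

end PermCSP

/-! ### Finding the relevant variables -/

namespace PermCSP

namespace Instance

variable {c : ℕ} (I : Instance c)

/-- The labels of a test order, with `x` as the only variable behind `v` and `u`. All names are
numbers, which need not be names of variables. -/
def natLabel (v u x t : ℕ) : ℕ → ℕ :=
  fun i => if i = v then t else if i = u then 2 else if i = x then 4 else 0

/-- The transposition of `v` and `u` in front of `x` changes the weight. -/
def Differs (v u x : ℕ) : Prop :=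
  I.keyWeight (arrayKey (natLabel v u x 1)) ≠ I.keyWeight (arrayKey (natLabel v u x 3))

/-- The variable occurs in some constraint. -/
def Occurs (v : Fin I.n) : Prop := ∃ C ∈ I.constraints, ∃ i, C.scope i = v

theorem keyWeight_congr_of_occurs {κ κ' : Fin I.n → ℕ}
    (h : ∀ i j, I.Occurs i → I.Occurs j → (κ i < κ j ↔ κ' i < κ' j)) :
    I.keyWeight κ = I.keyWeight κ' := by
  unfold keyWeight
  congr 1
  exact List.map_congr_left fun C hC =>
    C.gain_congr fun i j => h _ _ ⟨C, hC, i, rfl⟩ ⟨C, hC, j, rfl⟩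

theorem exists_input_eq_of_occurs {v : Fin I.n} (hv : I.Occurs v) :
    ∃ p < I.encode.length, I.input p = v := by
  obtain ⟨C, hC, i, rfl⟩ := hv
  obtain ⟨j, hj, rfl⟩ := List.mem_iff_getElem.1 hC
  refine ⟨I.offset j + 2 + i, ?_, (I.storedAt_constraint j hj).constraint.2.2.1 i⟩
  have h1 := I.offset_succ j hj
  have h2 := I.offset_le (j + 1)
  have h3 := i.isLt
  omega

theorem arrayKey_natLabel (v u x : Fin I.n) (t : ℕ) :
    (arrayKey (natLabel v u x t) : Fin I.n → ℕ) = labelKey (testLabel v u {x} t) 1 := by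
  unfold arrayKey
  congr 1
  funext i
  simp [natLabel, testLabel, Fin.ext_iff]

theorem not_differs_of_forall {v u x : ℕ}
    (h : (∀ i : Fin I.n, I.Occurs i → (i : ℕ) ≠ v) ∨ (∀ i : Fin I.n, I.Occurs i → (i : ℕ) ≠ u)) :
    ¬ I.Differs v u x := by
  unfold Differs
  rw [not_not]
  refine I.keyWeight_congr_of_occurs fun i j hi hj => ?_
  unfold arrayKey
  rw [labelKey_lt, labelKey_lt]
  rcases h with h | h
  · have h1 := h i hi
    have h2 := h j hj
    simp [natLabel, h1, h2]
  · have h1 := h i hi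
    have h2 := h j hj
    simp only [natLabel, h1, h2, if_false]
    split_ifs <;> simp

theorem differs_congr {v u x : ℕ} (hx : ∀ i : Fin I.n, I.Occurs i → (i : ℕ) ≠ x) :
    I.Differs v u x ↔ I.Differs v u u := by
  have : ∀ t, I.keyWeight (arrayKey (natLabel v u x t)) =
      I.keyWeight (arrayKey (natLabel v u u t)) := by
    intro t
    refine I.keyWeight_congr_of_occurs fun i j hi hj => ?_
    have h1 := hx i hi
    have h2 := hx j hj
    unfold arrayKey
    rw [labelKey_lt, labelKey_lt]
    have e : ∀ k : Fin I.n, (k : ℕ) ≠ x → natLabel v u x t k = natLabel v u u t k := by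
      intro k hk
      simp only [natLabel, hk, if_false]
      split_ifs <;> rfl
    rw [e i h1, e j h2]
  unfold Differs
  rw [this, this]

/-- The relevant variables are found by trying all numbers of the input in place of the three
variables of a test. -/
theorem relevant_iff (y : ℕ) : (∃ h : y < I.n, I.Relevant ⟨y, h⟩) ↔
    ∃ p < I.encode.length, ∃ q < I.encode.length, ∃ r < I.encode.length,
      I.input p = y ∧ I.Differs (I.input p) (I.input q) (I.input r) := by
  have hocc : ∀ z : ℕ, (¬ ∀ i : Fin I.n, I.Occurs i → (i : ℕ) ≠ z) →
      (∃ p < I.encode.length, I.input p = z) ∧ z < I.n := by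
    intro z hz
    push Not at hz
    obtain ⟨i, hi, rfl⟩ := hz
    exact ⟨I.exists_input_eq_of_occurs hi, i.isLt⟩
  constructor
  · rintro ⟨h, u, x, hne⟩
    have hd : I.Differs y u x := by
      unfold testWeight at hne
      rw [← arrayKey_natLabel, ← arrayKey_natLabel] at hne
      exact hne
    have h1 := mt (fun h => I.not_differs_of_forall (x := (x : ℕ)) (u := (u : ℕ)) (Or.inl h))
      (not_not.2 hd)
    have h2 := mt (fun h => I.not_differs_of_forall (x := (x : ℕ)) (v := y) (Or.inr h))
      (not_not.2 hd)
    obtain ⟨⟨p, hp, hp'⟩, -⟩ := hocc _ h1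
    obtain ⟨⟨q, hq, hq'⟩, -⟩ := hocc _ h2
    by_cases hx : ∀ i : Fin I.n, I.Occurs i → (i : ℕ) ≠ x
    · refine ⟨p, hp, q, hq, q, hq, hp', ?_⟩
      rw [hp', hq']
      exact (I.differs_congr hx).1 hd
    · obtain ⟨⟨r, hr, hr'⟩, -⟩ := hocc _ hx
      refine ⟨p, hp, q, hq, r, hr, hp', ?_⟩
      rw [hp', hq', hr']
      exact hd
  · rintro ⟨p, -, q, -, r, -, rfl, hd⟩
    have h1 := mt (fun h => I.not_differs_of_forall (u := I.input q) (x := I.input r) (Or.inl h))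
      (not_not.2 hd)
    have h2 := mt (fun h => I.not_differs_of_forall (v := I.input p) (x := I.input r) (Or.inr h))
      (not_not.2 hd)
    obtain ⟨-, hv⟩ := hocc _ h1
    obtain ⟨-, hu⟩ := hocc _ h2
    have key : ∀ x (hx : x < I.n), I.Differs (I.input p) (I.input q) x →
        I.Relevant ⟨I.input p, hv⟩ := by
      intro x hx hd'
      refine ⟨⟨I.input q, hu⟩, ⟨x, hx⟩, ?_⟩
      unfold testWeight
      rw [← arrayKey_natLabel, ← arrayKey_natLabel]
      exact hd'
    refine ⟨hv, ?_⟩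
    by_cases hx : ∀ i : Fin I.n, I.Occurs i → (i : ℕ) ≠ I.input r
    · exact key _ hu ((I.differs_congr hx).1 hd)
    · exact key _ (hocc _ hx).2 hd

end Instance

end PermCSP

namespace RAM

/-- The variables in the registers `13`, `14` and `15` are tested. The weights of the two test
orders are left in the registers `17` and `3`, and all labels are left `0`. -/
def testTriple : Prog :=
  .write 30 (reg 15) 4 ++ .write 30 (reg 14) 2 ++ .write 30 (reg 13) 1 ++ evalOrder ++
    set 17 (reg 3) ++ .write 30 (reg 13) 3 ++ evalOrder ++
    .write 30 (reg 15) 0 ++ .write 30 (reg 14) 0 ++ .write 30 (reg 13) 0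

/-- The number in register `13` is added to the list in array `32` (of length register `16`) and
marked in array `31`, unless it is already there. -/
def record : Prog :=
  .branch (.read 31 (reg 13)) .skip
    (.write 31 (reg 13) 1 ++ .write 32 (reg 16) (reg 13) ++ set 16 (reg 16 + 1))

/-- The test number `d` (register `12`): the digits of `d` in base `L` (register `11`) are the
positions of the three variables in the input. -/
def tryTriple : Prog :=
  set 13 (inp (reg 12 / (reg 11 * reg 11))) ++
    set 14 (inp (reg 12 / reg 11 - reg 11 * (reg 12 / reg 11 / reg 11))) ++
    set 15 (inp (reg 12 - reg 11 * (reg 12 / reg 11))) ++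
    testTriple ++
    .branch ((reg 17 - reg 3) + (reg 3 - reg 17)) record .skip

/-- The relevant variables are listed in array `32`, their number is left in register `16`. -/
def findRelevant : Prog :=
  evalOrder ++ set 11 (reg 2) ++ set 12 0 ++
    .loop (reg 11 * reg 11 * reg 11 - reg 12) (tryTriple ++ set 12 (reg 12 + 1))

end RAM

namespace PermCSP

open RAM

namespace Instance

variable {c : ℕ} (I : Instance c)

theorem testTriple_spec (hc : c ≤ 3) {B : ℕ} (hB : I.size + 4 ≤ B) (σ : Mem)
    (h0 : σ 0 = I.input) (h30 : σ 30 = fun _ => 0) :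
    WP B testTriple (fun s σ' => s ≤ 1470 * I.encode.length ∧ (σ' 30 = fun _ => 0) ∧
      (σ' 17 0 ≠ σ' 3 0 ↔ I.Differs (σ 13 0) (σ 14 0) (σ 15 0))) σ := by
  have hB1 : 2 ^ I.size ≤ 2 ^ B := Nat.pow_le_pow_right (by norm_num) (by omega)
  have hB2 : 2 ^ 4 ≤ 2 ^ B := Nat.pow_le_pow_right (by norm_num) (by omega)
  have hW := I.totalWeight_lt
  have hL := I.three_mul_length_le
  set v := σ 13 0 with hv
  set u := σ 14 0 with hu
  set x := σ 15 0 with hx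
  refine WP.append (WP.append (WP.append (WP.append (WP.append (WP.append (WP.append (WP.append
    (WP.append (WP.write ?_ (WP.write ?_ (WP.write ?_ ?_)))))))))))
  · simp; omega
  · simp; omega
  · simp; omega
  refine (I.evalOrder_spec hc hB _ ?_).mono ?_
  · rw [Mem.store_of_ne _ _ _ (by norm_num), Mem.store_of_ne _ _ _ (by norm_num),
      Mem.store_of_ne _ _ _ (by norm_num), h0]
  rintro s₁ σ₁ hf₁ ⟨hs₁, h3, -, -⟩
  have e30 : σ₁ 30 = natLabel v u x 1 := by
    rw [hf₁ 30 (by decide)]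
    funext i
    simp [Mem.store_apply, natLabel, h30, ← hv, ← hu, ← hx]
  rw [← hf₁ 30 (by decide), e30] at h3
  have e0 : σ₁ 0 = I.input := by rw [hf₁ 0 (by decide), ← h0]; rfl
  have e13 : σ₁ 13 0 = v := by rw [hf₁ 13 (by decide), hv]; rfl
  have e14 : σ₁ 14 0 = u := by rw [hf₁ 14 (by decide), hu]; rfl
  have e15 : σ₁ 15 0 = x := by rw [hf₁ 15 (by decide), hx]; rfl
  have hk := I.keyWeight_le (arrayKey (natLabel v u x 1))
  refine WP.set ?_ (WP.write ?_ ?_)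
  · simp [h3]; omega
  · simp; omega
  refine (I.evalOrder_spec hc hB _ ?_).mono ?_
  · rw [Mem.store_of_ne _ _ _ (by norm_num), Mem.store_of_ne _ _ _ (by norm_num), e0]
  rintro s₂ σ₂ hf₂ ⟨hs₂, h3', -, -⟩
  have g30 : σ₂ 30 = natLabel v u x 3 := by
    rw [hf₂ 30 (by decide)]
    funext i
    simp [Mem.store_apply, e30, e13]
    simp only [natLabel]
    split_ifs <;> rfl
  rw [← hf₂ 30 (by decide), g30] at h3'
  have g13 : σ₂ 13 0 = v := by rw [hf₂ 13 (by decide), ← e13]; rfl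
  have g14 : σ₂ 14 0 = u := by rw [hf₂ 14 (by decide), ← e14]; rfl
  have g15 : σ₂ 15 0 = x := by rw [hf₂ 15 (by decide), ← e15]; rfl
  have g17 : σ₂ 17 0 = I.keyWeight (arrayKey (natLabel v u x 1)) := by
    rw [hf₂ 17 (by decide), ← h3]; rfl
  refine WP.write ?_ (WP.write ?_ (WP.write ?_ ?_))
  · simp
  · simp
  · simp
  refine ⟨by omega, ?_, ?_⟩
  · funext i
    simp [Mem.store_apply, g30, g13, g14, g15]
    simp only [natLabel]
    split_ifs <;> simp_all
  · simp [Mem.store_apply, g17, h3', Differs]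

/-- The number `y` lies in the variable part of the test with number `d`, and the test shows a
difference. -/
def Found (d y : ℕ) : Prop :=
  I.input (d / (I.encode.length * I.encode.length)) = y ∧
    I.Differs y (I.input (d / I.encode.length % I.encode.length))
      (I.input (d % I.encode.length))

theorem relevant_iff_found (y : ℕ) : (∃ h : y < I.n, I.Relevant ⟨y, h⟩) ↔
    ∃ d < I.encode.length * I.encode.length * I.encode.length, I.Found d y := by
  rw [relevant_iff]
  generalize hL : I.encode.length = L
  constructor
  · rintro ⟨p, hp, q, hq, r, hr, rfl, hd⟩
    have h1 : (p * (L * L) + (q * L + r)) / (L * L) = p := by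
      have : q * L + r < L * L := by nlinarith
      rw [mul_comm, Nat.mul_add_div (by nlinarith), Nat.div_eq_of_lt this, add_zero]
    have h2 : (p * (L * L) + (q * L + r)) / L % L = q := by
      rw [show p * (L * L) + (q * L + r) = L * (L * p + q) + r by ring,
        Nat.mul_add_div (by omega), Nat.div_eq_of_lt hr, add_zero, Nat.mul_add_mod,
        Nat.mod_eq_of_lt hq]
    have h3 : (p * (L * L) + (q * L + r)) % L = r := by
      rw [show p * (L * L) + (q * L + r) = L * (L * p + q) + r by ring, Nat.mul_add_mod,
        Nat.mod_eq_of_lt hr]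
    refine ⟨p * (L * L) + (q * L + r), ?_, ?_⟩
    · have h4 : q * L + r < L * L := by nlinarith
      have h5 := Nat.mul_le_mul_right (L * L) (Nat.succ_le_of_lt hp)
      rw [Nat.succ_mul] at h5
      rw [mul_assoc]
      omega
    · unfold Found
      rw [hL, h1, h2, h3]
      exact ⟨rfl, hd⟩
  · rintro ⟨d, hd, h⟩
    have hL0 : 0 < L := Nat.pos_of_ne_zero (by rintro rfl; simp at hd)
    unfold Found at h
    rw [hL] at h
    refine ⟨d / (L * L), Nat.div_lt_of_lt_mul (by rwa [mul_assoc] at hd ⊢), _,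
      Nat.mod_lt (d / L) hL0, _, Nat.mod_lt d hL0, h.1, ?_⟩
    rw [h.1]
    exact h.2

/-- The array `32` holds the duplicate-free list `l`, and the array `31` its marks. -/
def Listed (l : List ℕ) (σ : Mem) : Prop :=
  l.Nodup ∧ σ 16 0 = l.length ∧ (∀ i, ∀ h : i < l.length, σ 32 i = l[i]) ∧
    ∀ y, σ 31 y ≠ 0 ↔ y ∈ l

theorem listed_congr {l : List ℕ} {σ σ' : Mem} (h : Listed l σ) (h16 : σ' 16 = σ 16)
    (h31 : σ' 31 = σ 31) (h32 : σ' 32 = σ 32) : Listed l σ' := by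
  unfold Listed
  rw [h16, h31, h32]
  exact h

theorem record_spec {B : ℕ} (hB : 4 ≤ B) (σ : Mem) (l : List ℕ) (hl : Listed l σ)
    (h13 : σ 13 0 < 2 ^ B) (hlen : l.length + 1 < 2 ^ B) :
    WP B record (fun s σ' => s ≤ 10 ∧ ∃ l', Listed l' σ' ∧ ∀ y, y ∈ l' ↔ y ∈ l ∨ y = σ 13 0)
      σ := by
  have hB2 : 2 ^ 4 ≤ 2 ^ B := Nat.pow_le_pow_right (by norm_num) hB
  obtain ⟨hnd, h16, h32, h31⟩ := hl
  refine WP.branch (fun hb => WP.skip ?_) (fun hb => ?_)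
  · simp only [Expr.eval_read, Expr.eval_ofNat] at hb
    refine ⟨by omega, l, ⟨hnd, h16, h32, h31⟩, fun y => ⟨Or.inl, fun h => h.elim id ?_⟩⟩
    rintro rfl
    exact (h31 _).1 hb
  · simp only [Expr.eval_read, Expr.eval_ofNat] at hb
    have hnl : σ 13 0 ∉ l := by
      rw [← h31]
      simpa using hb
    refine WP.append (WP.append (WP.write ?_ (WP.write ?_ (WP.set ?_ ?_))))
    · simp; omega
    · simpa [Mem.store_apply] using h13
    · simpa [Mem.store_apply, h16] using hlen
    · refine ⟨by omega, l ++ [σ 13 0], ⟨?_, ?_, ?_, ?_⟩, ?_⟩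
      · rw [List.nodup_append]
        refine ⟨hnd, by simp, ?_⟩
        rintro a ha b hb rfl
        rw [List.mem_singleton] at hb
        exact hnl (hb ▸ ha)
      · simp [Mem.store_apply, h16]
      · intro i hi
        simp only [List.length_append, List.length_singleton] at hi
        rcases Nat.lt_succ_iff_lt_or_eq.1 hi with h | rfl
        · rw [List.getElem_append_left h, ← h32 i h]
          simp [Mem.store_apply, h16, h.ne]
        · simp [Mem.store_apply, h16]
      · intro y
        rw [List.mem_append, List.mem_singleton, ← h31]
        simp only [Mem.store_apply]
        by_cases h : y = σ 13 0 <;> simp [h]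
      · intro y
        rw [List.mem_append, List.mem_singleton]

theorem length_le_of_found {l : List ℕ} (hl : l.Nodup) {d : ℕ}
    (hd : d ≤ I.encode.length * I.encode.length * I.encode.length)
    (h : ∀ y ∈ l, ∃ d' < d, I.Found d' y) : l.length ≤ I.encode.length := by
  refine (List.subperm_of_subset hl fun y hy => ?_).length_le
  obtain ⟨d', hd', hy', -⟩ := h y hy
  have hlt : d' / (I.encode.length * I.encode.length) < I.encode.length :=
    Nat.div_lt_of_lt_mul (by omega)
  rw [← hy', input, List.getD_eq_getElem _ _ hlt]
  exact List.getElem_mem _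

theorem tryTriple_spec (hc : c ≤ 3) {B : ℕ} (hB : 3 * I.size + 4 ≤ B) (σ : Mem) (d : ℕ)
    (l : List ℕ) (h0 : σ 0 = I.input) (h30 : σ 30 = fun _ => 0) (h11 : σ 11 0 = I.encode.length)
    (h12 : σ 12 0 = d) (hl : Listed l σ) (hlen : l.length ≤ I.encode.length) :
    WP B tryTriple (fun s σ' => s ≤ 1490 * I.encode.length ∧ (σ' 30 = fun _ => 0) ∧
      ∃ l', Listed l' σ' ∧ ∀ y, y ∈ l' ↔ y ∈ l ∨ I.Found d y) σ := by
  have hB1 : 2 ^ (I.size + 4) ≤ 2 ^ B := Nat.pow_le_pow_right (by norm_num) (by omega)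
  rw [pow_add] at hB1
  have hL := I.three_mul_length_le
  have hLs := I.sum_add_length_encode_le
  have hin : ∀ i, I.input i < 2 ^ B := fun i => by
    have := I.input_lt i
    omega
  refine WP.append (WP.append (WP.append (WP.append (WP.set ?_ (WP.set ?_ (WP.set ?_ ?_))))))
  · simp [h0, hin]
  · simp [Mem.store_apply, h0, hin]
  · simp [Mem.store_apply, h0, hin]
  refine (I.testTriple_spec hc (by omega) _ ?_ ?_).mono ?_
  · rw [Mem.store_of_ne _ _ _ (by norm_num), Mem.store_of_ne _ _ _ (by norm_num),
      Mem.store_of_ne _ _ _ (by norm_num), h0]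
  · rw [Mem.store_of_ne _ _ _ (by norm_num), Mem.store_of_ne _ _ _ (by norm_num),
      Mem.store_of_ne _ _ _ (by norm_num), h30]
  rintro s₁ σ₁ hf₁ ⟨hs₁, g30, hdiff⟩
  have m1 : d / I.encode.length - I.encode.length * (d / I.encode.length / I.encode.length) =
      d / I.encode.length % I.encode.length := (Nat.mod_eq_sub_mul_div).symm
  have m2 : d - I.encode.length * (d / I.encode.length) = d % I.encode.length :=
    (Nat.mod_eq_sub_mul_div).symm
  simp [Mem.store_apply, h0, h11, h12, m1, m2] at hdiff
  have g13 : σ₁ 13 0 = I.input (d / (I.encode.length * I.encode.length)) := by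
    rw [hf₁ 13 (by decide)]
    simp [Mem.store_apply, h0, h11, h12]
  have hl₁ : Listed l σ₁ := by
    refine listed_congr hl ?_ ?_ ?_
    all_goals
      rw [hf₁ _ (by decide), Mem.store_of_ne _ _ _ (by norm_num),
        Mem.store_of_ne _ _ _ (by norm_num), Mem.store_of_ne _ _ _ (by norm_num)]
  have hfound : ∀ y, I.Found d y ↔ y = σ₁ 13 0 ∧ σ₁ 17 0 ≠ σ₁ 3 0 := by
    intro y
    rw [g13, ne_eq, hdiff]
    constructor
    · rintro ⟨rfl, h⟩
      exact ⟨rfl, h⟩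
    · rintro ⟨rfl, h⟩
      exact ⟨rfl, h⟩
  refine WP.branch (fun hb => ?_) (fun hb => WP.skip ?_)
  · simp only [Expr.eval_read, Expr.eval_ofNat, Expr.eval_add, Expr.eval_sub] at hb
    refine (record_spec (by omega) σ₁ l hl₁ (by rw [g13]; exact hin _) (by omega)).mono ?_
    rintro s₂ σ₂ hf₂ ⟨hs₂, l', hl', hmem⟩
    refine ⟨by omega, by rw [hf₂ 30 (by decide), g30], l', hl', fun y => ?_⟩
    have : σ₁ 17 0 ≠ σ₁ 3 0 := by omega
    rw [hmem, hfound]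
    tauto
  · simp only [Expr.eval_read, Expr.eval_ofNat, Expr.eval_add, Expr.eval_sub] at hb
    refine ⟨by omega, g30, l, hl₁, fun y => ⟨Or.inl, fun h => h.elim id fun h => ?_⟩⟩
    exact absurd (by omega) ((hfound y).1 h).2

theorem findRelevant_spec (hc : c ≤ 3) {B : ℕ} (hB : 3 * I.size + 4 ≤ B) (σ : Mem)
    (h0 : σ 0 = I.input) (h30 : σ 30 = fun _ => 0) (h31 : σ 31 = fun _ => 0) (h16 : σ 16 0 = 0) :
    WP B findRelevant (fun s σ' => s ≤ 1700 * I.encode.length ^ 4 ∧ (σ' 30 = fun _ => 0) ∧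
      ∃ l, Listed l σ' ∧ l.length ≤ I.encode.length ∧
        ∀ y, y ∈ l ↔ ∃ h : y < I.n, I.Relevant ⟨y, h⟩) σ := by
  have hB3 : 2 ^ (3 * I.size + 4) ≤ 2 ^ B := Nat.pow_le_pow_right (by norm_num) hB
  have hL := I.three_mul_length_le
  have hLs := I.sum_add_length_encode_le
  set L := I.encode.length with hLdef
  have hL3 : L * L * L < 2 ^ B := by
    have h1 : L * L * L ≤ 2 ^ I.size * 2 ^ I.size * 2 ^ I.size :=
      Nat.mul_le_mul (Nat.mul_le_mul (by omega) (by omega)) (by omega)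
    have h2 : 2 ^ (3 * I.size + 4) = 2 ^ I.size * 2 ^ I.size * 2 ^ I.size * 16 := by ring
    have h3 : 0 < 2 ^ I.size * 2 ^ I.size * 2 ^ I.size := by positivity
    omega
  have hLL : L ≤ L * L * L := by
    have : 1 ≤ L * L := by nlinarith
    exact Nat.le_mul_of_pos_left L this
  refine WP.append (WP.append (WP.append ((I.evalOrder_spec hc (by omega) σ h0).mono ?_)))
  rintro s₀ σ₀ hf₀ ⟨hs₀, -, -, h2⟩
  rw [← hLdef] at h2 hs₀
  have hl₀ : Listed [] ((σ₀.store 11 0 ((reg 2).eval σ₀)).store 12 0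
      (Expr.eval (σ₀.store 11 0 ((reg 2).eval σ₀)) 0)) := by
    refine ⟨by simp, ?_, by simp, ?_⟩
    · rw [Mem.store_of_ne _ _ _ (by norm_num), Mem.store_of_ne _ _ _ (by norm_num),
        hf₀ 16 (by decide), h16]
      rfl
    · rw [Mem.store_of_ne _ _ _ (by norm_num), Mem.store_of_ne _ _ _ (by norm_num),
        hf₀ 31 (by decide), h31]
      simp
  refine WP.set ?_ (WP.set ?_ ?_)
  · simp [h2]; omega
  · simp
  refine WP.loop (fun d σ' => σ' 12 0 = d ∧ (σ' 30 = fun _ => 0) ∧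
    ∃ l, Listed l σ' ∧ ∀ y, y ∈ l ↔ ∃ d' < d, I.Found d' y) (L * L * L) (1500 * L) ?_ ?_ ?_ ?_
  · refine ⟨by simp [Mem.store_apply], ?_, [], hl₀, by simp⟩
    rw [Mem.store_of_ne _ _ _ (by norm_num), Mem.store_of_ne _ _ _ (by norm_num),
      hf₀ 30 (by decide), h30]
  · rintro d hd σ' hf ⟨h12, h30', l, hl, hmem⟩
    have e0 : σ' 0 = I.input := by
      rw [hf 0 (by decide), Mem.store_of_ne _ _ _ (by norm_num), Mem.store_of_ne _ _ _ (by norm_num),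
        hf₀ 0 (by decide), h0]
    have e11 : σ' 11 0 = L := by
      rw [hf 11 (by decide), Mem.store_of_ne _ _ _ (by norm_num)]
      simp [Mem.store_apply, h2]
    refine ⟨?_, WP.append ?_⟩
    · simp [e11, h12]
      omega
    have hlen := I.length_le_of_found hl.1 (d := d) (by rw [← hLdef]; omega)
      fun y hy => (hmem y).1 hy
    refine (I.tryTriple_spec hc hB σ' d l e0 h30' e11 h12 hl hlen).mono ?_
    rintro s σ₁ hf₁ ⟨hs, g30, l', hl', hmem'⟩
    have g12 : σ₁ 12 0 = d := by rw [hf₁ 12 (by decide), h12]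
    refine WP.set ?_ ⟨by omega, ?_, ?_, l', listed_congr hl' ?_ ?_ ?_, fun y => ?_⟩
    · simp [g12]; omega
    · simp [Mem.store_apply, g12]
    · rw [Mem.store_of_ne _ _ _ (by norm_num), g30]
    · rw [Mem.store_of_ne _ _ _ (by norm_num)]
    · rw [Mem.store_of_ne _ _ _ (by norm_num)]
    · rw [Mem.store_of_ne _ _ _ (by norm_num)]
    · rw [hmem', hmem]
      constructor
      · rintro (⟨d', hd', h⟩ | h)
        · exact ⟨d', by omega, h⟩
        · exact ⟨d, by omega, h⟩
      · rintro ⟨d', hd', h⟩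
        rcases Nat.lt_succ_iff_lt_or_eq.1 hd' with h1 | rfl
        · exact Or.inl ⟨d', h1, h⟩
        · exact Or.inr h
  · rintro σ' hf ⟨h12, -⟩
    have e11 : σ' 11 0 = L := by
      rw [hf 11 (by decide), Mem.store_of_ne _ _ _ (by norm_num)]
      simp [Mem.store_apply, h2]
    simp [e11, h12]
  · rintro s σ' hs hf ⟨-, h30', l, hl, hl'⟩
    refine ⟨?_, h30', l, hl, ?_, fun y => ?_⟩
    · have h1 : L ^ 4 = L * L * L * L := by ring
      have h2 : L * L * L * (1500 * L + 1) = 1500 * (L * L * L * L) + L * L * L := by ring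
      have h3 : L * L * L * 3 ≤ L * L * L * L := Nat.mul_le_mul_left _ (by omega)
      have h4 : 9 * L ≤ L * L * L := Nat.mul_le_mul_right _ (by nlinarith)
      rw [h1]
      rw [h2] at hs
      omega
    · exact I.length_le_of_found hl.1 le_rfl fun y hy => (hl' y).1 hy
    · rw [hl', relevant_iff_found]

end Instance

end PermCSP

/-! ### Dynamic programming over the subsets of a list -/

namespace PermCSP

/-- The label `2` for the members of the list `l` at the places of the binary digits `1` of `m`,
and the label `0` for all other names. -/
def maskLabel (l : List ℕ) (m : ℕ) : ℕ → ℕ :=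
  fun y => if y ∈ l ∧ m.testBit (l.idxOf y) then 2 else 0

/-- The set of the variables in the list `l` at the places of the binary digits `1` of `m`. -/
def maskSet (n : ℕ) (l : List ℕ) (m : ℕ) : Finset (Fin n) :=
  Finset.univ.filter fun v => (v : ℕ) ∈ l ∧ m.testBit (l.idxOf (v : ℕ))

theorem mem_maskSet {n : ℕ} {l : List ℕ} {m : ℕ} {v : Fin n} :
    v ∈ maskSet n l m ↔ (v : ℕ) ∈ l ∧ m.testBit (l.idxOf (v : ℕ)) := by
  simp [maskSet]

theorem testBit_sub_two_pow {m i : ℕ} (h : m.testBit i) (j : ℕ) :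
    (m - 2 ^ i).testBit j = (m.testBit j && decide (j ≠ i)) := by
  have h1 : m / 2 ^ i % 2 = 1 := by
    rw [Nat.testBit_eq_decide_div_mod_eq] at h
    simpa using h
  have h2 := Nat.div_add_mod m (2 ^ i)
  have h3 : m % 2 ^ i < 2 ^ i := Nat.mod_lt _ (by positivity)
  have h4 : m / 2 ^ i = 2 * (m / 2 ^ i / 2) + 1 := by omega
  generalize m / 2 ^ i / 2 = a at h4
  generalize m % 2 ^ i = b at h2 h3
  rw [h4] at h2
  have h5 : m - 2 ^ i = 2 ^ i * (2 * a) + b := by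
    rw [← h2, Nat.mul_succ]
    omega
  rw [h5, ← h2, Nat.testBit_two_pow_mul_add _ h3, Nat.testBit_two_pow_mul_add _ h3]
  rcases lt_trichotomy j i with hj | rfl | hj
  · simp [hj, hj.ne]
  · simp
  · obtain ⟨k, rfl⟩ := Nat.exists_eq_add_of_lt hj
    have e : i + k + 1 - i = k + 1 := by omega
    have e' : ¬ i + k + 1 < i := by omega
    have e'' : (2 * a + 1) / 2 = a := by omega
    simp [e, e', Nat.testBit_succ, e'']
    exact fun _ => by omega

theorem maskSet_sub {n : ℕ} {l : List ℕ} {m i : ℕ} (hl : l.Nodup) (hi : i < l.length)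
    (hin : l[i] < n) (h : m.testBit i) :
    maskSet n l (m - 2 ^ i) = (maskSet n l m).erase ⟨l[i], hin⟩ := by
  ext v
  rw [Finset.mem_erase, mem_maskSet, mem_maskSet, testBit_sub_two_pow h, Bool.and_eq_true,
    decide_eq_true_iff]
  have : (v : ℕ) ∈ l → (l.idxOf (v : ℕ) ≠ i ↔ v ≠ ⟨l[i], hin⟩) := by
    intro hv
    rw [not_iff_not, Fin.ext_iff]
    constructor
    · intro e
      subst e
      simp
    · intro e
      simp only at e
      rw [e, hl.idxOf_getElem]
  tauto

theorem mem_maskSet_getElem {n : ℕ} {l : List ℕ} {m i : ℕ} (hl : l.Nodup) (hi : i < l.length)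
    (hin : l[i] < n) : (⟨l[i], hin⟩ : Fin n) ∈ maskSet n l m ↔ m.testBit i := by
  rw [mem_maskSet]
  simp [hl.idxOf_getElem]

theorem maskSet_zero (n : ℕ) (l : List ℕ) : maskSet n l 0 = ∅ := by
  ext v
  simp [mem_maskSet]

theorem mem_maskSet_full {n : ℕ} {l : List ℕ} {v : Fin n} :
    v ∈ maskSet n l (2 ^ l.length - 1) ↔ (v : ℕ) ∈ l := by
  rw [mem_maskSet]
  simp [Nat.testBit_two_pow_sub_one, List.idxOf_lt_length_iff]

namespace Instance

variable {c : ℕ} (I : Instance c)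

/-- The candidate for the maximal weight of the set `m` in which the variable at place `i` of the
list comes first, where `M` holds the maximal weights of the smaller sets. -/
noncomputable def candidate (l : List ℕ) (M : ℕ → ℕ) (m i : ℕ) : ℕ :=
  M (m - 2 ^ i) + I.keyWeight (arrayKey (Function.update (maskLabel l m) (l.getD i 0) 1)) -
    I.keyWeight (arrayKey (Function.update (maskLabel l m) (l.getD i 0) 0))

/-- The largest candidate among the first `i` places. -/
noncomputable def best (l : List ℕ) (M : ℕ → ℕ) (m i : ℕ) : ℕ :=
  (Finset.range i).sup fun j => if m.testBit j then I.candidate l M m j else 0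

theorem best_succ (l : List ℕ) (M : ℕ → ℕ) (m i : ℕ) : I.best l M m (i + 1) =
    if m.testBit i then max (I.best l M m i) (I.candidate l M m i) else I.best l M m i := by
  unfold best
  rw [Finset.range_add_one, Finset.sup_insert]
  split_ifs
  · exact max_comm _ _
  · exact Nat.zero_max _

theorem arrayKey_update_maskLabel {n : ℕ} (l : List ℕ) (m : ℕ) (v : Fin n) (t : ℕ) :
    (arrayKey (Function.update (maskLabel l m) v t) : Fin n → ℕ) =
      labelKey (stepLabel (maskSet n l m) v t) 1 := by
  unfold arrayKey
  congr 1
  funext i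
  simp only [Function.update_apply, stepLabel, maskLabel, mem_maskSet, Fin.ext_iff]

/-- The recursion of the dynamic program: a best order of the set has a first variable, and the
gain from moving it in front of the rest depends only on the set. Truncated subtraction in the
candidates is harmless, since a candidate for a suitable first variable attains the maximum. -/
theorem best_eq_maxWeight (hc : c ≤ 3) {l : List ℕ} (hl : l.Nodup) (hn : ∀ y ∈ l, y < I.n)
    {M : ℕ → ℕ} {m : ℕ} (hm0 : m ≠ 0) (hm : m < 2 ^ l.length)
    (hM : ∀ m' < m, M m' = I.maxWeight (maskSet I.n l m')) :
    I.best l M m l.length = I.maxWeight (maskSet I.n l m) := by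
  have hcand : ∀ i, ∀ hi : i < l.length, m.testBit i → I.candidate l M m i =
      I.maxWeight ((maskSet I.n l m).erase ⟨l[i], hn _ (List.getElem_mem hi)⟩) +
        I.keyWeight (labelKey (stepLabel (maskSet I.n l m)
          ⟨l[i], hn _ (List.getElem_mem hi)⟩ 1) 1) -
        I.keyWeight (labelKey (stepLabel (maskSet I.n l m)
          ⟨l[i], hn _ (List.getElem_mem hi)⟩ 0) 1) := by
    intro i hi hbit
    rw [candidate, hM _ (Nat.sub_lt (Nat.pos_of_ne_zero hm0) (by positivity)),
      maskSet_sub hl hi (hn _ (List.getElem_mem hi)) hbit, ← arrayKey_update_maskLabel,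
      ← arrayKey_update_maskLabel, List.getD_eq_getElem _ _ hi]
  apply le_antisymm
  · refine Finset.sup_le fun i hi => ?_
    rw [Finset.mem_range] at hi
    split_ifs with hbit
    · rw [hcand i hi hbit]
      have := I.maxWeight_erase_le hc ((mem_maskSet_getElem hl hi
        (hn _ (List.getElem_mem hi))).2 hbit)
      omega
    · exact Nat.zero_le _
  · have hne : (maskSet I.n l m).Nonempty := by
      obtain ⟨i, hi⟩ := Nat.exists_testBit_of_ne_zero hm0
      have hil : i < l.length := by
        by_contra h
        rw [Nat.testBit_lt_two_pow (hm.trans_le (Nat.pow_le_pow_right (by norm_num)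
          (not_lt.1 h)))] at hi
        exact absurd hi (by simp)
      exact ⟨_, (mem_maskSet_getElem hl hil (hn _ (List.getElem_mem hil))).2 hi⟩
    obtain ⟨⟨v, hvn⟩, hv, h⟩ := I.exists_maxWeight_le hc hne
    have hv' := mem_maskSet.1 hv
    simp only at hv'
    have hi := List.idxOf_lt_length_iff.2 hv'.1
    have e : l[l.idxOf v] = v := by simp
    have hle : I.candidate l M m (l.idxOf v) ≤ I.best l M m l.length := by
      have := Finset.le_sup (f := fun j => if m.testBit j then I.candidate l M m j else 0)
        (Finset.mem_range.2 hi)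
      simp only [hv'.2, if_true] at this
      exact this
    refine le_trans ?_ hle
    rw [hcand _ hi hv'.2]
    simp only [e]
    omega

end Instance

end PermCSP

namespace RAM

/-- The binary digit of the mask (register `18`) at the place that belongs to the power of two
`e`. -/
def digit (e : Expr) : Expr := reg 18 / e - 2 * (reg 18 / (2 * e))

/-- The labels are set to `2` for the listed variables in the mask and to `0` for the others. -/
def setLabels : Prog :=
  set 22 0 ++ set 23 1 ++
    .loop (reg 16 - reg 22)
      (.write 30 (.read 32 (reg 22)) (2 * digit (reg 23)) ++ set 22 (reg 22 + 1) ++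
        set 23 (reg 23 * 2))

/-- The variable in register `26` is tried as the first variable of the set (the mask in register
`18`), with the labels `1` and `0` in turn. Register `21` holds the power of two that belongs to the
variable, and the candidate is computed in register `24`. -/
def tryVariable : Prog :=
  .write 30 (reg 26) 1 ++ evalOrder ++ set 24 (.read 33 (reg 18 - reg 21) + reg 3) ++
    .write 30 (reg 26) 0 ++ evalOrder ++ set 24 (reg 24 - reg 3) ++ .write 30 (reg 26) 2 ++
    .branch (reg 24 - .read 33 (reg 18)) (.write 33 (reg 18) (reg 24)) .skip

/-- All variables of the set are tried as first variables. -/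
def tryAll : Prog :=
  set 20 0 ++ set 21 1 ++
    .loop (reg 16 - reg 20)
      (.branch (digit (reg 21)) (set 26 (.read 32 (reg 20)) ++ tryVariable) .skip ++
        set 20 (reg 20 + 1) ++ set 21 (reg 21 * 2))

/-- The power of two with exponent register `16` is computed in register `19`. -/
def powerOfTwo : Prog :=
  set 19 1 ++ set 20 0 ++
    .loop (reg 16 - reg 20) (set 19 (reg 19 * 2) ++ set 20 (reg 20 + 1))

/-- The maximal weights of all sets of listed variables are computed in array `33`. Six times the
mean weight is left in register `25`. -/
def allSets : Prog :=
  evalOrder ++ .write 33 0 (reg 3) ++ set 25 (reg 4) ++ powerOfTwo ++ set 18 1 ++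
    .loop (reg 19 - reg 18) (setLabels ++ tryAll ++ set 18 (reg 18 + 1))

theorem eval_digit (σ : Mem) (e : Expr) (i : ℕ) (he : e.eval σ = 2 ^ i) :
    (digit e).eval σ = if (σ 18 0).testBit i then 1 else 0 := by
  have h1 : σ 18 0 / (2 * 2 ^ i) = σ 18 0 / 2 ^ i / 2 := by
    rw [Nat.div_div_eq_div_mul, mul_comm]
  simp only [digit, Expr.eval_sub, Expr.eval_div, Expr.eval_mul, Expr.eval_read,
    Expr.eval_ofNat, he, h1, Nat.testBit_eq_decide_div_mod_eq, decide_eq_true_eq]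
  split_ifs <;> omega

end RAM

namespace PermCSP

open RAM

theorem powerOfTwo_spec {B r : ℕ} (σ : Mem) (h16 : σ 16 0 = r) (hr : r < B) :
    WP B powerOfTwo (fun s σ' => s ≤ 5 * r + 5 ∧ σ' 19 0 = 2 ^ r) σ := by
  have hB : 2 ^ (r + 1) ≤ 2 ^ B := Nat.pow_le_pow_right (by norm_num) hr
  have hlt : r < 2 ^ r := Nat.lt_two_pow_self
  rw [pow_succ] at hB
  refine WP.append (WP.append (WP.set ?_ (WP.set ?_ ?_)))
  · simp; omega
  · simp
  refine WP.loop (fun i σ' => σ' 20 0 = i ∧ σ' 19 0 = 2 ^ i) r 3 ?_ ?_ ?_ ?_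
  · simp [Mem.store_apply]
  · rintro i hi σ' hf ⟨h20, h19⟩
    have e16 : σ' 16 0 = r := by rw [hf 16 (by decide), ← h16]; rfl
    have hp : 2 ^ (i + 1) ≤ 2 ^ r := Nat.pow_le_pow_right (by norm_num) hi
    rw [pow_succ] at hp
    refine ⟨?_, WP.append (WP.set ?_ (WP.set ?_ ?_))⟩
    · simp [e16, h20]; omega
    · simp [h19]; omega
    · simp [Mem.store_apply, h20]; omega
    · simp [Mem.store_apply, h20, h19, pow_succ]
  · rintro σ' hf ⟨h20, -⟩
    have e16 : σ' 16 0 = r := by rw [hf 16 (by decide), ← h16]; rfl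
    simp [e16, h20]
  · rintro s σ' hs - ⟨-, h19⟩
    exact ⟨by omega, h19⟩

/-- The array `32` holds the list `l` and register `16` its length. -/
def HoldsList (l : List ℕ) (σ : Mem) : Prop :=
  σ 16 0 = l.length ∧ ∀ i, ∀ h : i < l.length, σ 32 i = l[i]

theorem holdsList_congr {l : List ℕ} {σ σ' : Mem} (h : HoldsList l σ) (h16 : σ' 16 = σ 16)
    (h32 : σ' 32 = σ 32) : HoldsList l σ' := by
  unfold HoldsList
  rw [h16, h32]
  exact h

theorem setLabels_spec {B m : ℕ} {l : List ℕ} (σ : Mem) (hl : l.Nodup) (h : HoldsList l σ)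
    (hB : l.length + 4 < B) (h18 : σ 18 0 = m) (h30 : ∀ y ∉ l, σ 30 y = 0) :
    WP B setLabels (fun s σ' => s ≤ 7 * l.length + 5 ∧ σ' 30 = maskLabel l m) σ := by
  have hB1 : 2 ^ (l.length + 4) ≤ 2 ^ B := Nat.pow_le_pow_right (by norm_num) hB.le
  have hlt : l.length < 2 ^ l.length := Nat.lt_two_pow_self
  rw [pow_add] at hB1
  refine WP.append (WP.append (WP.set ?_ (WP.set ?_ ?_)))
  · simp
  · simp; omega
  refine WP.loop (fun j σ' => σ' 22 0 = j ∧ σ' 23 0 = 2 ^ j ∧ (∀ y ∉ l, σ' 30 y = 0) ∧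
    ∀ y ∈ l, l.idxOf y < j → σ' 30 y = maskLabel l m y) l.length 5 ?_ ?_ ?_ ?_
  · refine ⟨by simp [Mem.store_apply], by simp [Mem.store_apply], ?_, by simp⟩
    rw [Mem.store_of_ne _ _ _ (by norm_num), Mem.store_of_ne _ _ _ (by norm_num)]
    exact h30
  · rintro j hj σ' hf ⟨h22, h23, h30', hdone⟩
    obtain ⟨g16, g32⟩ : HoldsList l σ' := by
      refine holdsList_congr h ?_ ?_
      all_goals
        rw [hf _ (by decide), Mem.store_of_ne _ _ _ (by norm_num),
          Mem.store_of_ne _ _ _ (by norm_num)]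
    have g18 : σ' 18 0 = m := by rw [hf 18 (by decide), ← h18]; rfl
    have hp : 2 ^ (j + 1) ≤ 2 ^ l.length := Nat.pow_le_pow_right (by norm_num) hj
    rw [pow_succ] at hp
    have hdig : (digit (reg 23)).eval σ' = if m.testBit j then 1 else 0 := by
      rw [eval_digit σ' _ j (by simpa using h23), g18]
    have hval : 2 * (if m.testBit j then 1 else 0) = maskLabel l m l[j] := by
      unfold maskLabel
      rw [hl.idxOf_getElem]
      simp
    have h2 : maskLabel l m l[j] ≤ 2 := by
      unfold maskLabel
      split_ifs <;> omega
    refine ⟨?_, WP.append (WP.append (WP.write ?_ (WP.set ?_ (WP.set ?_ ?_))))⟩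
    · simp [g16, h22]; omega
    · simp only [Expr.eval_mul, hdig, Expr.eval_ofNat, hval]
      omega
    · simp [Mem.store_apply, h22]; omega
    · simp [Mem.store_apply, h23]; omega
    · have e : ∀ y, (Mem.store (Mem.store (σ'.store 30 ((Expr.read 32 (reg 22)).eval σ')
          ((2 * digit (reg 23)).eval σ')) 22 0 ((reg 22 + 1).eval (σ'.store 30
          ((Expr.read 32 (reg 22)).eval σ') ((2 * digit (reg 23)).eval σ')))) 23 0
          ((reg 23 * 2).eval (Mem.store (σ'.store 30 ((Expr.read 32 (reg 22)).eval σ')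
          ((2 * digit (reg 23)).eval σ')) 22 0 ((reg 22 + 1).eval (σ'.store 30
          ((Expr.read 32 (reg 22)).eval σ') ((2 * digit (reg 23)).eval σ')))))) 30 y =
            if y = l[j] then maskLabel l m l[j] else σ' 30 y := by
        intro y
        rw [Mem.store_of_ne _ _ _ (by norm_num), Mem.store_of_ne _ _ _ (by norm_num),
          Mem.store_apply]
        simp only [Expr.eval_mul, hdig, Expr.eval_ofNat, hval, Expr.eval_read, h22, g32 j hj,
          true_and]
      refine ⟨by omega, by simp [Mem.store_apply, h22],
        by simp [Mem.store_apply, h23, pow_succ], fun y hy => ?_, fun y hy hlt => ?_⟩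
      · rw [e, if_neg (by rintro rfl; exact hy (List.getElem_mem hj)), h30' y hy]
      · rw [e]
        split_ifs with hyj
        · rw [hyj]
        · refine hdone y hy (lt_of_le_of_ne (by omega) ?_)
          rintro rfl
          simp at hyj
  · rintro σ' hf ⟨h22, -⟩
    have e16 : σ' 16 0 = l.length := by rw [hf 16 (by decide), ← h.1]; rfl
    simp [e16, h22]
  · rintro s σ' hs - ⟨-, -, h30', hdone⟩
    refine ⟨by omega, funext fun y => ?_⟩
    by_cases hy : y ∈ l
    · exact hdone y hy (List.idxOf_lt_length_iff.2 hy)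
    · rw [h30' y hy]
      simp [maskLabel, hy]

namespace Instance

variable {c : ℕ} (I : Instance c)

theorem tryVariable_spec (hc : c ≤ 3) {B m p y : ℕ} (hB : I.size + 4 ≤ B) (σ : Mem)
    (h0 : σ 0 = I.input) (h18 : σ 18 0 = m) (h21 : σ 21 0 = p) (h26 : σ 26 0 = y)
    (hy : σ 30 y = 2) (hM : σ 33 (m - p) ≤ I.totalWeight) :
    WP B tryVariable (fun s σ' => s ≤ 1470 * I.encode.length ∧ σ' 30 = σ 30 ∧
      σ' 33 = Function.update (σ 33) m (max (σ 33 m)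
        (σ 33 (m - p) + I.keyWeight (arrayKey (Function.update (σ 30) y 1)) -
          I.keyWeight (arrayKey (Function.update (σ 30) y 0))))) σ := by
  have hB1 : 2 ^ (I.size + 4) ≤ 2 ^ B := Nat.pow_le_pow_right (by norm_num) hB
  rw [pow_add] at hB1
  have hB2 : 2 ^ 4 ≤ 2 ^ B := Nat.pow_le_pow_right (by norm_num) (by omega)
  have hW := I.totalWeight_lt
  have hL := I.three_mul_length_le
  set g := σ 30 with hg
  set M := σ 33 with hMdef
  refine WP.append (WP.append (WP.append (WP.append (WP.append (WP.append (WP.append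
    (WP.write ?_ ?_)))))))
  · simp; omega
  refine (I.evalOrder_spec hc hB _ ?_).mono ?_
  · rw [Mem.store_of_ne _ _ _ (by norm_num), h0]
  rintro s₁ σ₁ hf₁ ⟨hs₁, h3, -, -⟩
  have e30 : σ₁ 30 = Function.update g y 1 := by
    rw [hf₁ 30 (by decide)]
    funext i
    simp [Mem.store_apply, Function.update_apply, h26, ← hg]
  rw [← hf₁ 30 (by decide), e30] at h3
  have e0 : σ₁ 0 = I.input := by
    rw [hf₁ 0 (by decide), Mem.store_of_ne _ _ _ (by norm_num), h0]
  have e18 : σ₁ 18 0 = m := by rw [hf₁ 18 (by decide), ← h18]; rfl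
  have e21 : σ₁ 21 0 = p := by rw [hf₁ 21 (by decide), ← h21]; rfl
  have e26 : σ₁ 26 0 = y := by rw [hf₁ 26 (by decide), ← h26]; rfl
  have e33 : σ₁ 33 = M := by rw [hf₁ 33 (by decide), Mem.store_of_ne _ _ _ (by norm_num)]
  have hk := I.keyWeight_le (arrayKey (Function.update g y 1))
  refine WP.set ?_ (WP.write ?_ ?_)
  · simp [h3, e33, e18, e21]; omega
  · simp
  refine (I.evalOrder_spec hc hB _ ?_).mono ?_
  · rw [Mem.store_of_ne _ _ _ (by norm_num), Mem.store_of_ne _ _ _ (by norm_num), e0]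
  rintro s₂ σ₂ hf₂ ⟨hs₂, h3', -, -⟩
  have g30 : σ₂ 30 = Function.update g y 0 := by
    rw [hf₂ 30 (by decide)]
    funext i
    simp only [Mem.store_apply, e30, e26, Function.update_apply, Expr.eval_read,
      Expr.eval_ofNat]
    by_cases h : i = y <;> simp [h]
  rw [← hf₂ 30 (by decide), g30] at h3'
  have g18 : σ₂ 18 0 = m := by rw [hf₂ 18 (by decide), ← e18]; rfl
  have g26 : σ₂ 26 0 = y := by rw [hf₂ 26 (by decide), ← e26]; rfl
  have g33 : σ₂ 33 = M := by
    rw [hf₂ 33 (by decide), Mem.store_of_ne _ _ _ (by norm_num), Mem.store_of_ne _ _ _ (by norm_num),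
      e33]
  have g24 : σ₂ 24 0 = M (m - p) + I.keyWeight (arrayKey (Function.update g y 1)) := by
    rw [hf₂ 24 (by decide)]
    simp [Mem.store_apply, h3, e33, e18, e21]
  have hcand : M (m - p) + I.keyWeight (arrayKey (Function.update g y 1)) -
      I.keyWeight (arrayKey (Function.update g y 0)) < 2 ^ B := by omega
  have gback : ∀ i, (if i = y then 2 else Function.update g y 0 i) = g i := by
    intro i
    split_ifs with h
    · rw [h, hy]
    · rw [Function.update_of_ne h]
  refine WP.set ?_ (WP.write ?_ ?_)
  · simpa [g24, h3'] using hcand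
  · simp; omega
  refine WP.branch (fun hb => WP.write ?_ ⟨by omega, ?_, ?_⟩)
    (fun hb => WP.skip ⟨by omega, ?_, ?_⟩)
  · simpa [Mem.store_apply, g24, h3'] using hcand
  · rw [Mem.store_of_ne _ _ _ (by norm_num)]
    funext i
    simp only [Mem.store_apply, Expr.eval_read, Expr.eval_ofNat, g30, g26]
    simpa [g26] using gback i
  · simp [Mem.store_apply, g24, h3', g33, g18] at hb
    funext i
    simp [Mem.store_apply, g24, h3', g33, g18, Function.update_apply]
    rw [max_eq_right (by omega)]
  · funext i
    simp only [Mem.store_apply, Expr.eval_read, Expr.eval_ofNat, g30, g26]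
    simpa [g26] using gback i
  · simp [Mem.store_apply, g24, h3', g33, g18] at hb
    rw [Mem.store_of_ne _ _ _ (by norm_num), Mem.store_of_ne _ _ _ (by norm_num), g33,
      max_eq_left (by omega), Function.update_eq_self]

theorem tryAll_spec (hc : c ≤ 3) {B m : ℕ} {l : List ℕ} {M : ℕ → ℕ} (hB : 2 * I.size + 4 ≤ B)
    (σ : Mem) (h0 : σ 0 = I.input) (hl : l.Nodup) (h : HoldsList l σ)
    (hlen : l.length ≤ I.encode.length) (hn : ∀ y ∈ l, y < I.n) (h18 : σ 18 0 = m) (h30 : σ 30 = maskLabel l m)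
    (h33 : σ 33 = M) (hm : m ≠ 0) (hMm : M m = 0) (hM : ∀ m' < m, M m' ≤ I.totalWeight) :
    WP B tryAll (fun s σ' => s ≤ l.length * (1480 * I.encode.length) + 5 ∧
      σ' 30 = maskLabel l m ∧ σ' 33 = Function.update M m (I.best l M m l.length)) σ := by
  have hs := I.length_le_size
  have hB1 : 2 ^ (l.length + 4) ≤ 2 ^ B := Nat.pow_le_pow_right (by norm_num) (by omega)
  have hB2 : 2 ^ (I.size + 4) ≤ 2 ^ B := Nat.pow_le_pow_right (by norm_num) (by omega)
  have hlt : l.length < 2 ^ l.length := Nat.lt_two_pow_self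
  have hL := I.three_mul_length_le
  have hLs := I.sum_add_length_encode_le
  rw [pow_add] at hB1 hB2
  refine WP.append (WP.append (WP.set ?_ (WP.set ?_ ?_)))
  · simp
  · simp; omega
  refine WP.loop (fun i σ' => σ' 20 0 = i ∧ σ' 21 0 = 2 ^ i ∧ σ' 30 = maskLabel l m ∧
    σ' 33 = Function.update M m (I.best l M m i)) l.length (1480 * I.encode.length - 1)
    ?_ ?_ ?_ ?_
  · refine ⟨by simp [Mem.store_apply], by simp [Mem.store_apply], ?_, ?_⟩
    · rw [Mem.store_of_ne _ _ _ (by norm_num), Mem.store_of_ne _ _ _ (by norm_num), h30]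
    · rw [Mem.store_of_ne _ _ _ (by norm_num), Mem.store_of_ne _ _ _ (by norm_num), h33]
      have : I.best l M m 0 = M m := by rw [hMm]; rfl
      rw [this, Function.update_eq_self]
  · rintro i hi σ' hf ⟨h20, h21, h30', h33'⟩
    obtain ⟨g16, g32⟩ : HoldsList l σ' := by
      refine holdsList_congr h ?_ ?_
      all_goals
        rw [hf _ (by decide), Mem.store_of_ne _ _ _ (by norm_num),
          Mem.store_of_ne _ _ _ (by norm_num)]
    have g0 : σ' 0 = I.input := by
      rw [hf 0 (by decide), Mem.store_of_ne _ _ _ (by norm_num), Mem.store_of_ne _ _ _ (by norm_num),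
        h0]
    have g18 : σ' 18 0 = m := by rw [hf 18 (by decide), ← h18]; rfl
    have hp : 2 ^ (i + 1) ≤ 2 ^ l.length := Nat.pow_le_pow_right (by norm_num) hi
    rw [pow_succ] at hp
    have hdig : (digit (reg 21)).eval σ' = if m.testBit i then 1 else 0 := by
      rw [eval_digit σ' _ i (by simpa using h21), g18]
    have hstep : ∀ s₁ ≤ 1480 * I.encode.length - 6, ∀ σ₁ : Mem, σ₁ 20 0 = i → σ₁ 21 0 = 2 ^ i →
        σ₁ 30 = maskLabel l m → σ₁ 33 = Function.update M m (I.best l M m (i + 1)) →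
        WP B (RAM.set 20 (reg 20 + 1)) (fun s₂ σ₂ => WP B (RAM.set 21 (reg 21 * 2))
          (fun s₃ σ₃ => s₁ + s₂ + 1 + s₃ + 1 ≤ 1480 * I.encode.length - 1 ∧ σ₃ 20 0 = i + 1 ∧
            σ₃ 21 0 = 2 ^ (i + 1) ∧ σ₃ 30 = maskLabel l m ∧
            σ₃ 33 = Function.update M m (I.best l M m (i + 1))) σ₂) σ₁ := by
      intro s₁ hs₁ σ₁ k20 k21 k30 k33
      refine WP.set ?_ (WP.set ?_ ⟨by omega, ?_, ?_, ?_, ?_⟩)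
      · simp [k20]; omega
      · simp [Mem.store_apply, k21]; omega
      · simp [Mem.store_apply, k20]
      · simp [Mem.store_apply, k21, pow_succ]
      · rw [Mem.store_of_ne _ _ _ (by norm_num), Mem.store_of_ne _ _ _ (by norm_num), k30]
      · rw [Mem.store_of_ne _ _ _ (by norm_num), Mem.store_of_ne _ _ _ (by norm_num), k33]
    refine ⟨?_, WP.append (WP.append (WP.branch (fun hb => ?_) (fun hb => WP.skip ?_)))⟩
    · simp [g16, h20]; omega
    · rw [hdig] at hb
      have hbit : m.testBit i := by
        by_contra hn
        simp [hn] at hb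
      have hpos : 0 < 2 ^ i := by positivity
      have hlt' : m - 2 ^ i < m := by omega
      have hin := hn _ (List.getElem_mem hi)
      have hI0 := I.input_lt 0
      rw [I.input_zero] at hI0
      refine WP.append (WP.set ?_ ?_)
      · simp [h20, g32 i hi]; omega
      refine (I.tryVariable_spec hc (m := m) (p := 2 ^ i) (y := l[i]) (by omega) _ ?_ ?_ ?_ ?_ ?_
        ?_).mono ?_
      · rw [Mem.store_of_ne _ _ _ (by norm_num), g0]
      · rw [Mem.store_of_ne _ _ _ (by norm_num), g18]
      · rw [Mem.store_of_ne _ _ _ (by norm_num), h21]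
      · simp [Mem.store_apply, h20, g32 i hi]
      · rw [Mem.store_of_ne _ _ _ (by norm_num), h30', maskLabel, hl.idxOf_getElem,
          if_pos ⟨List.getElem_mem hi, hbit⟩]
      · rw [Mem.store_of_ne _ _ _ (by norm_num), h33', Function.update_of_ne hlt'.ne]
        exact hM _ hlt'
      · rintro s₁ σ₁ hf₁ ⟨hs₁, k30, k33⟩
        rw [Mem.store_of_ne _ _ _ (by norm_num), h30'] at k30
        rw [Mem.store_of_ne _ _ _ (by norm_num), Mem.store_of_ne _ _ _ (by norm_num), h30',
          h33', Function.update_of_ne hlt'.ne, Function.update_self, Function.update_idem] at k33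
        refine hstep _ (by omega) σ₁ ?_ ?_ k30 ?_
        · rw [hf₁ 20 (by decide), Mem.store_of_ne _ _ _ (by norm_num), h20]
        · rw [hf₁ 21 (by decide), Mem.store_of_ne _ _ _ (by norm_num), h21]
        · rw [k33, best_succ, if_pos hbit, candidate, List.getD_eq_getElem _ _ hi]
    · rw [hdig] at hb
      have hbit : ¬ m.testBit i := by
        intro hn
        simp [hn] at hb
      refine hstep _ (by omega) σ' h20 h21 h30' ?_
      rw [best_succ, if_neg hbit, h33']
  · rintro σ' hf ⟨h20, -⟩
    have e16 : σ' 16 0 = l.length := by rw [hf 16 (by decide), ← h.1]; rfl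
    simp [e16, h20]
  · rintro s σ' hs' - ⟨-, -, h30', h33'⟩
    refine ⟨?_, h30', h33'⟩
    have e : 1480 * I.encode.length - 1 + 1 = 1480 * I.encode.length := by omega
    rw [e] at hs'
    omega

end Instance

end PermCSP

namespace PermCSP

open RAM

namespace Instance

variable {c : ℕ} (I : Instance c)

theorem mean6_le : I.mean6 ≤ 6 * I.totalWeight := by
  unfold totalWeight mean6
  rw [← List.sum_map_mul_left]
  exact List.sum_le_sum fun C _ => I.gain6_le C

theorem maxWeight_le (S : Finset (Fin I.n)) : I.maxWeight S ≤ I.totalWeight :=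
  Finset.sup_le fun _ _ => I.keyWeight_le _

theorem allSets_spec (hc : c ≤ 3) {B : ℕ} {l : List ℕ} (hB : 3 * I.size + 4 ≤ B) (σ : Mem)
    (h0 : σ 0 = I.input) (hl : l.Nodup) (h : HoldsList l σ) (hlen : l.length ≤ I.encode.length)
    (hn : ∀ y ∈ l, y < I.n) (h30 : σ 30 = fun _ => 0) (h33 : σ 33 = fun _ => 0) :
    WP B allSets (fun s σ' => s ≤ 2 ^ l.length * (2000 * I.encode.length ^ 2) ∧
      σ' 19 0 = 2 ^ l.length ∧ σ' 25 0 = I.mean6 ∧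
      σ' 33 (2 ^ l.length - 1) = I.maxWeight (maskSet I.n l (2 ^ l.length - 1))) σ := by
  have hs := I.length_le_size
  have hB1 : 2 ^ (l.length + 4) ≤ 2 ^ B := Nat.pow_le_pow_right (by norm_num) (by omega)
  have hB2 : 2 ^ (I.size + 4) ≤ 2 ^ B := Nat.pow_le_pow_right (by norm_num) (by omega)
  have hL := I.three_mul_length_le
  have hW := I.totalWeight_lt
  have h6 := I.mean6_le
  have hpos : 0 < 2 ^ l.length := by positivity
  rw [pow_add] at hB1 hB2
  refine WP.append (WP.append (WP.append (WP.append (WP.append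
    ((I.evalOrder_spec hc (by omega) σ h0).mono ?_)))))
  rintro s₁ σ₁ hf₁ ⟨hs₁, h3, h4, -⟩
  have e33 : σ₁ 33 = fun _ => 0 := by rw [hf₁ 33 (by decide), h33]
  have hk := I.keyWeight_le (arrayKey (σ 30))
  have hbase : σ₁ 3 0 = I.maxWeight (maskSet I.n l 0) := by
    rw [h3, h30, maskSet_zero, maxWeight_empty]
  refine WP.write ?_ (WP.set ?_ ?_)
  · simp [h3]; omega
  · simp [Mem.store_apply, h4]; omega
  refine (powerOfTwo_spec (r := l.length) _ ?_ (by omega)).mono ?_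
  · rw [Mem.store_of_ne _ _ _ (by norm_num), Mem.store_of_ne _ _ _ (by norm_num),
      hf₁ 16 (by decide), h.1]
  rintro s₂ σ₂ hf₂ ⟨hs₂, h19⟩
  have e0 : σ₂ 0 = I.input := by
    rw [hf₂ 0 (by decide), Mem.store_of_ne _ _ _ (by norm_num), Mem.store_of_ne _ _ _ (by norm_num),
      hf₁ 0 (by decide), h0]
  have elist : HoldsList l σ₂ := by
    refine holdsList_congr h ?_ ?_
    all_goals
      rw [hf₂ _ (by decide), Mem.store_of_ne _ _ _ (by norm_num),
        Mem.store_of_ne _ _ _ (by norm_num), hf₁ _ (by decide)]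
  have e30 : σ₂ 30 = fun _ => 0 := by
    rw [hf₂ 30 (by decide), Mem.store_of_ne _ _ _ (by norm_num),
      Mem.store_of_ne _ _ _ (by norm_num), hf₁ 30 (by decide), h30]
  have e25 : σ₂ 25 0 = I.mean6 := by
    rw [hf₂ 25 (by decide)]
    simp [Mem.store_apply, h4]
  have e33' : σ₂ 33 = Function.update (fun _ => 0) 0 (I.maxWeight (maskSet I.n l 0)) := by
    rw [hf₂ 33 (by decide)]
    funext i
    simp [Mem.store_apply, e33, hbase, Function.update_apply]
  refine WP.set ?_ ?_
  · simp; omega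
  refine WP.loop (fun t σ' => σ' 18 0 = t + 1 ∧ (∀ y ∉ l, σ' 30 y = 0) ∧
    (∀ m ≤ t, σ' 33 m = I.maxWeight (maskSet I.n l m)) ∧ ∀ m > t, σ' 33 m = 0)
    (2 ^ l.length - 1) (1500 * I.encode.length ^ 2 - 1) ?_ ?_ ?_ ?_
  · refine ⟨by simp [Mem.store_apply], ?_, ?_, ?_⟩
    · rw [Mem.store_of_ne _ _ _ (by norm_num), e30]
      simp
    · rw [Mem.store_of_ne _ _ _ (by norm_num), e33']
      intro m hm
      rw [Nat.le_zero.1 hm, Function.update_self]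
    · rw [Mem.store_of_ne _ _ _ (by norm_num), e33']
      intro m hm
      rw [Function.update_of_ne hm.ne']
  · rintro t ht σ' hf ⟨h18, h30', hdone, hrest⟩
    have g0 : σ' 0 = I.input := by
      rw [hf 0 (by decide), Mem.store_of_ne _ _ _ (by norm_num), e0]
    have g19 : σ' 19 0 = 2 ^ l.length := by rw [hf 19 (by decide), ← h19]; rfl
    have glist : HoldsList l σ' := by
      refine holdsList_congr elist ?_ ?_
      all_goals rw [hf _ (by decide), Mem.store_of_ne _ _ _ (by norm_num)]
    refine ⟨?_, WP.append (WP.append ((setLabels_spec (m := t + 1) σ' hl glist (by omega) h18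
      h30').mono ?_))⟩
    · simp [g19, h18]; omega
    rintro s₃ σ₃ hf₃ ⟨hs₃, k30⟩
    refine (I.tryAll_spec hc (m := t + 1) (M := σ' 33) (by omega) σ₃ ?_ hl ?_ hlen hn ?_ k30 ?_
      (by omega) (hrest _ (by omega)) ?_).mono ?_
    · rw [hf₃ 0 (by decide), g0]
    · exact holdsList_congr glist (hf₃ _ (by decide)) (hf₃ _ (by decide))
    · rw [hf₃ 18 (by decide), h18]
    · rw [hf₃ 33 (by decide)]
    · intro m hm
      rw [hdone m (by omega)]
      exact I.maxWeight_le _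
    rintro s₄ σ₄ hf₄ ⟨hs₄, j30, j33⟩
    have j18 : σ₄ 18 0 = t + 1 := by rw [hf₄ 18 (by decide), hf₃ 18 (by decide), h18]
    have hbest : I.best l (σ' 33) (t + 1) l.length = I.maxWeight (maskSet I.n l (t + 1)) :=
      I.best_eq_maxWeight hc hl hn (by omega) (by omega) fun m hm => hdone m (by omega)
    refine WP.set ?_ ⟨?_, ?_, ?_, ?_, ?_⟩
    · simp [j18]; omega
    · have h1 : l.length * (1480 * I.encode.length) ≤ 1480 * I.encode.length ^ 2 := by
        rw [pow_two, mul_left_comm]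
        exact Nat.mul_le_mul_left _ (Nat.mul_le_mul_right _ hlen)
      have h2 : I.encode.length * 3 ≤ I.encode.length ^ 2 := by
        rw [pow_two]
        exact Nat.mul_le_mul_left _ (by omega)
      omega
    · simp [Mem.store_apply, j18]
    · rw [Mem.store_of_ne _ _ _ (by norm_num), j30]
      intro y hy
      simp [maskLabel, hy]
    · rw [Mem.store_of_ne _ _ _ (by norm_num), j33, hbest]
      intro m hm
      rcases Nat.le_succ_iff.1 hm with h' | rfl
      · rw [Function.update_of_ne (by omega), hdone m h']
      · rw [Nat.succ_eq_add_one, Function.update_self]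
    · rw [Mem.store_of_ne _ _ _ (by norm_num), j33]
      intro m hm
      rw [Function.update_of_ne (by omega), hrest m (by omega)]
  · rintro σ' hf ⟨h18, -⟩
    have g19 : σ' 19 0 = 2 ^ l.length := by rw [hf 19 (by decide), ← h19]; rfl
    simp [g19, h18]
    omega
  · rintro s σ' hs' hf ⟨-, -, hdone, -⟩
    refine ⟨?_, ?_, ?_, hdone _ le_rfl⟩
    · have h2 : I.encode.length * 3 ≤ I.encode.length ^ 2 := by
        rw [pow_two]
        exact Nat.mul_le_mul_left _ (by omega)
      have e : 1500 * I.encode.length ^ 2 - 1 + 1 = 1500 * I.encode.length ^ 2 := by omega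
      rw [e, Nat.sub_mul] at hs'
      have h3 : I.encode.length ^ 2 ≤ 2 ^ l.length * I.encode.length ^ 2 :=
        Nat.le_mul_of_pos_left _ hpos
      have h4 : 2 ^ l.length * (1500 * I.encode.length ^ 2) =
          1500 * (2 ^ l.length * I.encode.length ^ 2) := by ring
      have h5 : 2 ^ l.length * (2000 * I.encode.length ^ 2) =
          2000 * (2 ^ l.length * I.encode.length ^ 2) := by ring
      omega
    · rw [hf 19 (by decide), ← h19]; rfl
    · rw [hf 25 (by decide), ← e25]; rfl

end Instance

end PermCSP

/-! ### The decision program -/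

namespace RAM

/-- The answer is yes if there are at least `K` times as many relevant variables as the parameter.
Otherwise the maximal weight is computed and compared with the bound, where `T` is the denominator
of the excess demanded over the mean. -/
def solve (K T : ℕ) : Prog :=
  findRelevant ++
    .branch (.const K * inp 1 - reg 16)
      (allSets ++
        .branch ((.const T * reg 25 + 6 * inp 1) - 6 * .const T * .read 33 (reg 19 - 1))
          (set 1 0) (set 1 1))
      (set 1 1)

end RAM

namespace PermCSP

open RAM

namespace Instance

variable {c : ℕ} (I : Instance c)

theorem exists_mean_le_weight : ∃ φ, I.mean ≤ I.weight φ := by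
  have h := I.sum_keyWeight (X := Equiv.Perm (Fin I.n)) (fun φ i => φ i)
    (fun φ i j h => φ.injective (Fin.ext h)) (fun τ => Equiv.mulRight τ) (fun τ φ => rfl)
  simp only [← weight_eq_keyWeight] at h
  by_contra! hlt
  have := Finset.sum_lt_sum_of_nonempty (s := (Finset.univ : Finset (Equiv.Perm (Fin I.n))))
    ⟨1, Finset.mem_univ _⟩ fun φ _ => hlt φ
  rw [Finset.sum_const, Finset.card_univ, nsmul_eq_mul, ← h] at this
  push_cast at this
  exact this.false

theorem isYes_iff : I.IsYes ↔ ∃ φ, I.mean + (I.k : ℚ) / (c.factorial * 4 ^ c) ≤ I.weight φ := by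
  simp only [IsYes, rho_mul_totalWeight, ge_iff_le]

theorem card_maskSet_full {n : ℕ} {l : List ℕ} (hl : l.Nodup) (hn : ∀ y ∈ l, y < n) :
    (maskSet n l (2 ^ l.length - 1)).card = l.length := by
  refine Eq.trans ?_ (List.toFinset_card_of_nodup hl)
  rw [← Finset.card_map Fin.valEmbedding]
  congr 1
  ext y
  rw [Finset.mem_map, List.mem_toFinset]
  constructor
  · rintro ⟨v, hv, rfl⟩
    exact mem_maskSet_full.1 hv
  · exact fun hy => ⟨⟨y, hn y hy⟩, mem_maskSet_full.2 hy, rfl⟩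

/-- Many relevant variables force a yes-instance. -/
theorem isYes_of_le_card {K : ℕ} (hK0 : 0 < K) (hK : ∀ R : Finset (Fin I.n),
    (∀ v ∈ R, I.Relevant v) → ∃ φ, (R.card : ℚ) ≤ K * (I.weight φ - I.mean))
    {R : Finset (Fin I.n)} (hR : ∀ v ∈ R, I.Relevant v) (h : K * I.k ≤ R.card) : I.IsYes := by
  rw [isYes_iff]
  obtain ⟨φ, hφ⟩ := hK R hR
  refine ⟨φ, ?_⟩
  have h1 : (K : ℚ) * I.k ≤ R.card := by exact_mod_cast h
  have h2 : (I.k : ℚ) ≤ I.weight φ - I.mean :=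
    le_of_mul_le_mul_left (h1.trans hφ) (by exact_mod_cast hK0)
  have h3 : (1 : ℚ) ≤ c.factorial * 4 ^ c := by
    have : 0 < c.factorial * 4 ^ c := by positivity
    exact_mod_cast this
  have h4 : (I.k : ℚ) / (c.factorial * 4 ^ c) ≤ I.k := div_le_self (by positivity) h3
  linarith

/-- The bound is compared with the maximal weight over the relevant variables in integers. -/
theorem isYes_iff_maxWeight (hc : c ≤ 3) {S : Finset (Fin I.n)} (hS : ∀ v ∉ S, ¬ I.Relevant v) :
    I.IsYes ↔ c.factorial * 4 ^ c * I.mean6 + 6 * I.k ≤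
      6 * (c.factorial * 4 ^ c) * I.maxWeight S := by
  have hT : (0 : ℚ) < c.factorial * 4 ^ c := by positivity
  have key : ∀ w : ℕ, I.mean + (I.k : ℚ) / (c.factorial * 4 ^ c) ≤ w ↔
      c.factorial * 4 ^ c * I.mean6 + 6 * I.k ≤ 6 * (c.factorial * 4 ^ c) * w := by
    intro w
    have h6 := I.cast_mean6 hc
    rw [← Nat.cast_le (α := ℚ)]
    push_cast
    rw [h6, ← mul_le_mul_iff_right₀ (mul_pos (by norm_num : (0 : ℚ) < 6) hT), mul_add]
    have : 6 * ((c.factorial : ℚ) * 4 ^ c) * (I.k / (c.factorial * 4 ^ c)) = 6 * I.k := by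
      field_simp
    rw [this]
    ring_nf
  rw [isYes_iff, ← key]
  constructor
  · rintro ⟨φ, hφ⟩
    exact hφ.trans (by exact_mod_cast I.weight_le_maxWeight hc S hS φ)
  · intro h
    obtain ⟨φ, hφ⟩ := I.exists_weight_eq_maxWeight S
    exact ⟨φ, by rwa [hφ]⟩

theorem solve_spec (hc : c ≤ 3) {K : ℕ} (hK0 : 0 < K) (hK : ∀ R : Finset (Fin I.n),
    (∀ v ∈ R, I.Relevant v) → ∃ φ, (R.card : ℚ) ≤ K * (I.weight φ - I.mean)) :
    WP (3 * I.size + 4) (solve K (c.factorial * 4 ^ c)) (fun s σ' =>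
      s ≤ 4000 * 2 ^ (K * I.k) * I.encode.length ^ 4 ∧ (I.IsYes → σ' 1 0 = 1) ∧
        (¬ I.IsYes → σ' 1 0 = 0)) (initialMem I.encode) := by
  have hB : 2 ^ 4 ≤ 2 ^ (3 * I.size + 4) := Nat.pow_le_pow_right (by norm_num) (by omega)
  have hL := I.three_mul_length_le
  have h0 : initialMem I.encode 0 = I.input := rfl
  set L := I.encode.length with hLdef
  have hpow : 1 ≤ 2 ^ (K * I.k) := Nat.one_le_two_pow
  have hL4 : L ^ 4 ≤ 2 ^ (K * I.k) * L ^ 4 := Nat.le_mul_of_pos_left _ hpow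
  have hL1 : 1 ≤ L ^ 4 := Nat.one_le_pow _ _ (by omega)
  have hassoc : 4000 * 2 ^ (K * I.k) * L ^ 4 = 4000 * (2 ^ (K * I.k) * L ^ 4) := by ring
  refine WP.append ((I.findRelevant_spec hc le_rfl _ h0 rfl rfl rfl).mono ?_)
  rintro s₁ σ₁ hf₁ ⟨hs₁, h30, l, hl, hlen, hmem⟩
  rw [← hLdef] at hs₁
  have e0 : σ₁ 0 = I.input := by rw [hf₁ 0 (by decide), h0]
  have hn : ∀ y ∈ l, y < I.n := fun y hy => ((hmem y).1 hy).1
  have hrel : ∀ v : Fin I.n, v ∈ maskSet I.n l (2 ^ l.length - 1) ↔ I.Relevant v := by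
    intro v
    rw [mem_maskSet_full, hmem]
    exact ⟨fun h => h.2, fun h => ⟨v.isLt, h⟩⟩
  have hbranch : (Expr.const K * inp 1 - reg 16).eval σ₁ = K * I.k - l.length := by
    simp [e0, I.input_one, hl.2.1]
  refine WP.branch (fun hb => ?_) (fun hb => ?_)
  · rw [hbranch] at hb
    refine WP.append ((I.allSets_spec hc le_rfl σ₁ e0 hl.1 ⟨hl.2.1, hl.2.2.1⟩ hlen hn h30
      ?_).mono ?_)
    · rw [hf₁ 33 (by decide)]
      rfl
    rintro s₂ σ₂ hf₂ ⟨hs₂, h19, h25, h33⟩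
    have g0 : σ₂ 0 = I.input := by rw [hf₂ 0 (by decide), e0]
    have hiff := I.isYes_iff_maxWeight hc fun v hv => mt (hrel v).2 hv
    have htime : s₁ + (s₂ + (1 + 1) + 1 + 1) + 1 ≤ 4000 * 2 ^ (K * I.k) * L ^ 4 := by
      have h1 : 2 ^ l.length ≤ 2 ^ (K * I.k) := Nat.pow_le_pow_right (by norm_num) (by omega)
      have h2 : L ^ 2 ≤ L ^ 4 := Nat.pow_le_pow_right (by omega) (by norm_num)
      have h3 : 2 ^ l.length * (2000 * L ^ 2) ≤ 2000 * (2 ^ (K * I.k) * L ^ 4) := by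
        rw [mul_left_comm]
        exact Nat.mul_le_mul_left _ (Nat.mul_le_mul h1 h2)
      rw [← hLdef] at hs₂
      omega
    have hcmp : (Expr.const (c.factorial * 4 ^ c) * reg 25 + 6 * inp 1 -
        6 * Expr.const (c.factorial * 4 ^ c) * Expr.read 33 (reg 19 - 1)).eval σ₂ =
          c.factorial * 4 ^ c * I.mean6 + 6 * I.k - 6 * (c.factorial * 4 ^ c) *
            I.maxWeight (maskSet I.n l (2 ^ l.length - 1)) := by
      simp only [Expr.eval_sub, Expr.eval_add, Expr.eval_mul, Expr.eval_read, Expr.eval_ofNat,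
        Expr.eval_const, h19, h25, h33, g0, I.input_one]
    refine WP.branch (fun hb' => WP.set ?_ ⟨?_, ?_, ?_⟩) (fun hb' => WP.set ?_ ⟨?_, ?_, ?_⟩)
    · simp
    · omega
    · intro h
      rw [hcmp] at hb'
      exact absurd (Nat.sub_eq_zero_of_le (hiff.1 h)) hb'
    · intro _
      simp [Mem.store_apply]
    · simp only [Expr.eval_ofNat]
      omega
    · omega
    · intro _
      simp [Mem.store_apply]
    · intro h
      rw [hcmp] at hb'
      exact absurd (hiff.2 (Nat.le_of_sub_eq_zero hb')) h
  · rw [hbranch] at hb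
    have hyes : I.IsYes := I.isYes_of_le_card hK0 hK (fun v hv => (hrel v).1 hv) (by
      rw [card_maskSet_full hl.1 hn]
      omega)
    refine WP.set ?_ ⟨?_, ?_, ?_⟩
    · simp only [Expr.eval_ofNat]
      omega
    · omega
    · intro _
      simp [Mem.store_apply]
    · exact fun h => absurd hyes h

end Instance

end PermCSP

theorem mainTheorem9 (c : ℕ) (hc : c = 2 ∨ c = 3) :
    ∃ A B D : ℕ,
      RAM.DecidableWithin (PermCSP.Instance.encode (c := c))
        {I : PermCSP.Instance c | I.IsYes}
        (fun I => A * 2 ^ (B * I.k) * I.size ^ D) := by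
  have hc3 : c ≤ 3 := by omega
  obtain ⟨K, hK⟩ := PermCSP.exists_card_relevant_le
  -- The program needs a positive constant, which `K` need not be: the assignment found must have
  -- at least the mean weight even if there is no relevant variable.
  have hK' : ∀ (I : PermCSP.Instance c) (R : Finset (Fin I.n)), (∀ v ∈ R, I.Relevant v) →
      ∃ φ, (R.card : ℚ) ≤ ((K + 1 : ℕ) : ℚ) * (I.weight φ - I.mean) := by
    intro I R hR
    obtain ⟨φ, hφ⟩ := hK c hc3 I R hR
    obtain ⟨φ', hφ'⟩ := I.exists_mean_le_weight
    push_cast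
    rcases le_total (I.weight φ) (I.weight φ') with h | h
    · have h1 : (I.weight φ : ℚ) ≤ I.weight φ' := by exact_mod_cast h
      refine ⟨φ', ?_⟩
      have h2 := mul_le_mul_of_nonneg_left (sub_le_sub_right h1 I.mean) (Nat.cast_nonneg (α := ℚ) K)
      linarith
    · have h1 : (I.weight φ' : ℚ) ≤ I.weight φ := by exact_mod_cast h
      exact ⟨φ, by linarith⟩
  set p := RAM.solve (K + 1) (c.factorial * 4 ^ c) with hp
  refine ⟨p.unit * 20000, K + 1, 5, p, fun I => ?_⟩
  obtain ⟨s, σ, hexec, hs, hyes, hno⟩ := I.solve_spec hc3 K.succ_pos (hK' I)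
  have hmem : ∀ a i, RAM.initialMem I.encode a i < 2 ^ (3 * I.size + 4) := by
    intro a i
    have h1 : 2 ^ I.size ≤ 2 ^ (3 * I.size + 4) := Nat.pow_le_pow_right (by norm_num) (by omega)
    unfold RAM.initialMem
    split_ifs
    · exact (I.input_lt i).trans_le h1
    · positivity
  obtain ⟨⟨t, ht, hle⟩, -⟩ := hexec.exec hmem
  refine ⟨t, σ, ht, hle.trans ?_, hyes, hno⟩
  have h1 := I.three_mul_length_le
  have h2 := I.length_le_size
  -- One factor `I.size` pays for the logarithmic cost of a step on cells of `3 * I.size + 4` bits,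
  -- and four factors pay for the number of steps.
  calc p.unit * (3 * I.size + 4 + 1) * s
      ≤ p.unit * (5 * I.size) * (4000 * 2 ^ ((K + 1) * I.k) * I.size ^ 4) :=
        Nat.mul_le_mul (Nat.mul_le_mul_left _ (by omega))
          (hs.trans (Nat.mul_le_mul_left _ (Nat.pow_le_pow_left h2 4)))
    _ = p.unit * 20000 * 2 ^ ((K + 1) * I.k) * I.size ^ 5 := by ring
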